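/- Let $d\ge 1$. A Borel measure $\mu$ on $\mathbb R^d$ has $n$-growth if there is $c_\mu>0$ with $\mu(B(x,r))\le c_\mu r^n$ for all $x\in\mathbb R^d$, $r>0$. A set $E\subset\mathbb R^d$ is $n$-AD regular if the restriction $\sigma=\mathcal H^n\lfloor_E$ of the $n$-dimensional Hausdorff measure is a Radon measure and there is $c>0$ with $c^{-1}r^n\le\sigma(B(x,r))\le c\,r^n$ for all $x\in\operatorname{spt}\sigma$ and all $0<r\le\operatorname{diam}(\operatorname{spt}\sigma)$ (for infinite diameter, all $r>0$). A function $k:\{(x,y)\in\mathbb R^d\times\mathbb R^d: x\ne y\}\to\mathbb C$ is an $n$-dimensional Calderón–Zygmund kernel if there are $c>0$ and $0<\eta\le 1$ such that for all $x\neq y$ one has $|k(x,y)|\le c\,|x-y|^{-n}$ and $$|k(x,y)-k(x',y)|+|k(y,x)-k(y,x')|\le \frac{c\,|x-x'|^\eta}{|x-y|^{n+\eta}}\quad\text{whenever } |x-x'|\le |x-y|/2 .$$ For a measure $\sigma$ and $\varepsilon>0$ put $T^k_\varepsilon(f\sigma)(x)=\int_{|x-y|>\varepsilon}k(x,y)f(y)\,d\sigma(y)$.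 **Theorem.** Let $U\subset\mathbb R^d$ be a domain (a nonempty connected open set) whose boundary $\Gamma=\partial U$ is $(d-1)$-AD regular. Let $\mu,\nu$ be Borel measures with $(d-1)$-growth such that $\mu(\mathbb R^d\setminus U)=0$ and $\nu(U)=0$. Let $k$ be a $(d-1)$-dimensional Calderón–Zygmund kernel, let $1<q<\infty$, and assume that $T^k_{\mathcal H^{d-1}\lfloor_\Gamma}$ is bounded from $L^q(\mathcal H^{d-1}\lfloor_\Gamma)$ to $L^q(\mu)$, i.e. there is $C$ such that $\|T^k_\varepsilon(f\,\mathcal H^{d-1}\lfloor_\Gamma)\|_{L^q(\mu)}\le C\|f\|_{L^q(\mathcal H^{d-1}\lfloor_\Gamma)}$ for all $\varepsilon>0$ and all complex-valued $f\in L^q(\mathcal H^{d-1}\lfloor_\Gamma)$. Then for every $1<p<q$ the operators $T^k$ are bounded from $L^p(\nu)$ to $L^{p,\infty}(\mu)$ uniformly in the truncation: for all $\varepsilon>0$ and all complex-valued $f\in L^p(\nu)$ the integral defining $T^k_\varepsilon(f\nu)(x)$ converges absolutely for every $x\in\mathbb R^d$; moreover, there is a constant $c<\infty$, independent of $\varepsilon$,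 $f$ and $\lambda$, such that $$\mu\{x\in\mathbb R^d: |T^k_\varepsilon(f\nu)(x)|>\lambda\}\le\frac{c}{\lambda^p}\,\|f\|^p_{L^p(\nu)}\qquad\text{for all }\varepsilon>0,\ f\in L^p(\nu),\ \lambda>0 .$$ -/

import Mathlib

open MeasureTheory

open scoped ENNReal NNReal

/-- `n`-growth of a Borel measure on `ℝ^d`: `μ (B(x,r)) ≤ c r^n` for all `x` and all `r > 0`. Such a
measure is locally finite, hence Radon. -/
def HasGrowth {d : ℕ} (n : ℕ) (μ : Measure (EuclideanSpace ℝ (Fin d))) : Prop :=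
  ∃ c : ℝ, 0 < c ∧ ∀ (x : EuclideanSpace ℝ (Fin d)) (r : ℝ), 0 < r →
    μ (Metric.ball x r) ≤ ENNReal.ofReal (c * r ^ n)

/-- `n`-Ahlfors-David regularity of a Radon measure on `ℝ^d`: `c⁻¹ r^n ≤ μ (B(x,r)) ≤ c r^n` for all
`x ∈ spt μ` and `0 < r ≤ diam (spt μ)`; the diameter may be infinite. -/
def IsADRegularMeasure {d : ℕ} (n : ℕ) (μ : Measure (EuclideanSpace ℝ (Fin d))) : Prop :=
  IsLocallyFiniteMeasure μ ∧
    ∃ c : ℝ, 0 < c ∧ ∀ x ∈ μ.support, ∀ r : ℝ, 0 < r →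
      ENNReal.ofReal r ≤ Metric.ediam μ.support →
        ENNReal.ofReal (c⁻¹ * r ^ n) ≤ μ (Metric.ball x r) ∧
          μ (Metric.ball x r) ≤ ENNReal.ofReal (c * r ^ n)

/-- The restriction `ℋ^n⌊E` of the `n`-dimensional Hausdorff measure to `E ⊆ ℝ^d`. -/
noncomputable def hausdorffOn {d : ℕ} (n : ℕ) (E : Set (EuclideanSpace ℝ (Fin d))) :
    Measure (EuclideanSpace ℝ (Fin d)) :=
  (Measure.hausdorffMeasure (n : ℝ)).restrict E

/-- A set `E` is `n`-AD regular if `ℋ^n⌊E` is. -/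
def IsADRegularSet {d : ℕ} (n : ℕ) (E : Set (EuclideanSpace ℝ (Fin d))) : Prop :=
  IsADRegularMeasure n (hausdorffOn n E)

/-- `n`-dimensional Calderón-Zygmund kernels. Only the values of `k` off the diagonal matter. -/
def IsCZKernel {d : ℕ} (n : ℕ)
    (k : EuclideanSpace ℝ (Fin d) → EuclideanSpace ℝ (Fin d) → ℂ) : Prop :=
  ∃ c η : ℝ, 0 < c ∧ 0 < η ∧ η ≤ 1 ∧
    (∀ x y, x ≠ y → ‖k x y‖ ≤ c / ‖x - y‖ ^ n) ∧
    ∀ x x' y, x ≠ y → ‖x - x'‖ ≤ ‖x - y‖ / 2 →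
      ‖k x y - k x' y‖ + ‖k y x - k y x'‖ ≤ c * ‖x - x'‖ ^ η / ‖x - y‖ ^ ((n : ℝ) + η)

/-- The truncated operator `T^k_ε (f ν)(x) = ∫_{|x-y|>ε} k(x,y) f(y) dν(y)`. -/
noncomputable def truncOp {d : ℕ} (k : EuclideanSpace ℝ (Fin d) → EuclideanSpace ℝ (Fin d) → ℂ)
    (ν : Measure (EuclideanSpace ℝ (Fin d))) (ε : ℝ) (f : EuclideanSpace ℝ (Fin d) → ℂ)
    (x : EuclideanSpace ℝ (Fin d)) : ℂ :=
  ∫ y in {y | ε < ‖x - y‖}, k x y * f y ∂ν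

/-- `T^k_σ` is bounded from `L^q(σ)` to `L^q(μ)`: the truncated operators are, uniformly in `ε`. -/
def IsStrongBounded {d : ℕ} (k : EuclideanSpace ℝ (Fin d) → EuclideanSpace ℝ (Fin d) → ℂ)
    (σ μ : Measure (EuclideanSpace ℝ (Fin d))) (q : ℝ) : Prop :=
  ∃ C : ℝ≥0, ∀ ε : ℝ, 0 < ε → ∀ f : EuclideanSpace ℝ (Fin d) → ℂ,
    MemLp f (ENNReal.ofReal q) σ →
      eLpNorm (truncOp k σ ε f) (ENNReal.ofReal q) μ ≤ C * eLpNorm f (ENNReal.ofReal q) σ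

/-- `T^k_ν` is bounded from `L^p(ν)` to `L^{p,∞}(μ)`, uniformly in `ε`. -/
def IsWeakBounded {d : ℕ} (k : EuclideanSpace ℝ (Fin d) → EuclideanSpace ℝ (Fin d) → ℂ)
    (ν μ : Measure (EuclideanSpace ℝ (Fin d))) (p : ℝ) : Prop :=
  ∃ c : ℝ≥0, ∀ ε : ℝ, 0 < ε → ∀ f : EuclideanSpace ℝ (Fin d) → ℂ,
    MemLp f (ENNReal.ofReal p) ν → ∀ t : ℝ, 0 < t →
      μ {x | t < ‖truncOp k ν ε f x‖} ≤
        c / ENNReal.ofReal t ^ p * eLpNorm f (ENNReal.ofReal p) ν ^ p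

/-! Write `n = d - 1` and let `σ` be the surface measure on the boundary of `U`. The proof moves the
mass of `ν` onto `σ`, where the operator is controlled by hypothesis, and bounds the resulting error
by positive operators.

On the boundary itself, growth of `ν` forces a bounded density with respect to `σ`
(`BallGrowth.exists_density`), so that part is `T_σ` applied to a multiple of `f`. The rest of `ν`
lives in the exterior of `U`. Let `δ(y)` be the distance from an exterior point `y` to the support
of `σ`. A segment from `x ∈ U` to `y` must cross that support, so `δ(y) ≤ |x - y|` for every `x ∈ U`
(`infDist_support_le_dist`): scale `δ(y)` is never larger than the distance at which the kernel is
seen.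

If `δ(y)` is at most the diameter of the support, the ball of radius `2 δ(y)` about `y` has `σ`-mass
at least a multiple of `δ(y)^n`, and the unit mass at `y` is replaced by the `σ`-average over that
ball. When `|x - y| ≥ 4 δ(y)` the smoothness of `k` bounds the error by `δ^η / |x - y|^(n+η)` plus a
term from the jump of the truncation at `ε`. When `|x - y| < 4 δ(y)`, the size of `k` gives the
first of these bounds again for `k(x, y)`, and what remains is `T_σ` of a normalized indicator,
controlled on a ball by Hölder and the `L^q` hypothesis. If `δ(y)` exceeds the diameter, then all of
`U` lies within `3 δ(y)` of `y` (`dist_le_three_infDist`), and the size of `k` suffices.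

The error operators have adjoints dominated by a maximal function of order `1` or `q'`; since `p <
q` gives `q' < p'`, duality makes them bounded on `L^p` (`exists_lintegral_kernel_rpow_le`). The
averaging operator is bounded from `L^p(ν)` to `L^p(σ)` for the same reason. The remaining
ingredient is that the strong `(q,q)` bound for `T_σ` yields a weak `(p,p)` bound
(`CZBound.exists_measure_lt_truncOp_le`). This is a Calderón-Zygmund decomposition at density `t^p`,
and its bad part is averaged over balls by the same `transfer` mechanism.

For `d = 1` the kernel is bounded and both measures are finite, so Hölder's inequality is enough. -/

open Metric Set Filter Topology

set_option linter.unusedSectionVars false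

/-! ### Maximal function for measures of polynomial growth -/

section Maximal

variable {X : Type*} [MetricSpace X] [MeasurableSpace X] [BorelSpace X]
  [SecondCountableTopology X]

/-- `μ (closedBall x r) ≤ C r^n` for all centres and all positive radii. -/
def BallGrowth (n : ℕ) (C : ℝ≥0∞) (μ : Measure X) : Prop :=
  ∀ (x : X) (r : ℝ), 0 < r → μ (closedBall x r) ≤ C * ENNReal.ofReal r ^ n

/-- The radial maximal function `sup_r r^{-n} ∫_{B(y,r)} h dμ`. -/
noncomputable def radialMax (n : ℕ) (μ : Measure X) (h : X → ℝ≥0∞) (y : X) : ℝ≥0∞ :=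
  ⨆ (r : ℝ) (_ : 0 < r), (∫⁻ x in closedBall y r, h x ∂μ) / ENNReal.ofReal r ^ n

theorem ofReal_pow_ne_zero {r : ℝ} (hr : 0 < r) (n : ℕ) : ENNReal.ofReal r ^ n ≠ 0 :=
  pow_ne_zero _ (by simpa using hr)

theorem ofReal_pow_ne_top (r : ℝ) (n : ℕ) : ENNReal.ofReal r ^ n ≠ ∞ :=
  ENNReal.pow_ne_top ENNReal.ofReal_ne_top

theorem lintegral_closedBall_le_radialMax (n : ℕ) (μ : Measure X) (h : X → ℝ≥0∞) (y : X)
    {r : ℝ} (hr : 0 < r) :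
    ∫⁻ x in closedBall y r, h x ∂μ ≤ radialMax n μ h y * ENNReal.ofReal r ^ n := by
  rw [← ENNReal.div_le_iff (ofReal_pow_ne_zero hr n) (ofReal_pow_ne_top r n)]
  exact le_iSup₂ (f := fun (r : ℝ) (_ : 0 < r) =>
    (∫⁻ x in closedBall y r, h x ∂μ) / ENNReal.ofReal r ^ n) r hr

theorem lt_radialMax_iff {n : ℕ} {μ : Measure X} {h : X → ℝ≥0∞} {y : X} {t : ℝ≥0∞} :
    t < radialMax n μ h y ↔
      ∃ r : ℝ, 0 < r ∧ t * ENNReal.ofReal r ^ n < ∫⁻ x in closedBall y r, h x ∂μ := by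
  simp only [radialMax, lt_iSup_iff]
  constructor
  · rintro ⟨r, hr, h1⟩
    refine ⟨r, hr, ?_⟩
    rwa [ENNReal.lt_div_iff_mul_lt (Or.inl (ofReal_pow_ne_zero hr n))
      (Or.inl (ofReal_pow_ne_top r n))] at h1
  · rintro ⟨r, hr, h1⟩
    refine ⟨r, hr, ?_⟩
    rwa [ENNReal.lt_div_iff_mul_lt (Or.inl (ofReal_pow_ne_zero hr n))
      (Or.inl (ofReal_pow_ne_top r n))]

/-- A strict inequality at radius `r` survives a small increase of `r` in the normalizing power, and
the larger ball about a nearby centre contains the original one. This supplies the measurability of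
the maximal function. -/
theorem lowerSemicontinuous_radialMax (n : ℕ) (μ : Measure X) (h : X → ℝ≥0∞) :
    LowerSemicontinuous (radialMax n μ h) := by
  intro y t ht
  obtain ⟨r, hr, h1⟩ := lt_radialMax_iff.1 ht
  have hc : Tendsto (fun s : ℝ => t * ENNReal.ofReal s ^ n) (𝓝 r)
      (𝓝 (t * ENNReal.ofReal r ^ n)) := by
    refine ENNReal.Tendsto.const_mul ?_ (Or.inr ht.ne_top)
    exact (ENNReal.continuous_pow n).continuousAt.tendsto.comp
      (ENNReal.continuous_ofReal.tendsto r)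
  have h2 := hc.eventually (gt_mem_nhds h1)
  obtain ⟨δ, hδ, h3⟩ := Metric.eventually_nhds_iff.1 h2
  filter_upwards [Metric.ball_mem_nhds y (half_pos hδ)] with y' hy'
  refine lt_radialMax_iff.2 ?_
  refine ⟨r + δ / 2, by positivity, ?_⟩
  refine (h3 (y := r + δ / 2) ?_).trans_le (lintegral_mono_set ?_)
  · rw [Real.dist_eq]; rw [show r + δ / 2 - r = δ / 2 by ring, abs_of_pos (half_pos hδ)]; linarith
  · apply closedBall_subset_closedBall'
    rw [dist_comm]; linarith [mem_ball.1 hy']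

theorem measurable_radialMax (n : ℕ) (μ : Measure X) (h : X → ℝ≥0∞) :
    Measurable (radialMax n μ h) :=
  (lowerSemicontinuous_radialMax n μ h).measurable

theorem radialMax_one_le {n : ℕ} {μ : Measure X} {C : ℝ≥0∞} (hμ : BallGrowth n C μ) (y : X) :
    radialMax n μ (fun _ => 1) y ≤ C := by
  refine iSup₂_le fun r hr => ?_
  rw [ENNReal.div_le_iff (ofReal_pow_ne_zero hr n) (ofReal_pow_ne_top r n)]
  simpa using hμ y r hr

/-- Selection of disjoint balls whose radii are comparable with the last radius at which the
density of `m` exceeds `τ`, and whose enlargements cover all such points. -/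
theorem exists_disjoint_balls_of_density {n : ℕ} (hn : 1 ≤ n) (m : Measure X)
    (hm : m univ ≠ ∞) {τ : ℝ≥0∞} (hτ : τ ≠ 0) (hτ' : τ ≠ ∞) (S : Set X) :
    ∃ (u : Set X) (ρ : X → ℝ), u ⊆ S ∧ u.Countable ∧ (∀ a ∈ u, 0 < ρ a) ∧
      (∀ a ∈ u, τ * ENNReal.ofReal (ρ a) ^ n < m (closedBall a (ρ a))) ∧
      u.PairwiseDisjoint (fun a => closedBall a (ρ a)) ∧
      (∀ a ∈ u, ∀ r, 2 * ρ a ≤ r → m (closedBall a r) ≤ τ * ENNReal.ofReal r ^ n) ∧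
      ∀ x ∈ S, (∃ r, 0 < r ∧ τ * ENNReal.ofReal r ^ n < m (closedBall x r)) →
        ∃ a ∈ u, x ∈ closedBall a (5 * ρ a) := by
  classical
  -- A radius `r > 1` at which the density exceeds `τ` satisfies `τ r ≤ τ r^n < m univ`, since `n ≥
  -- 1`; this bounds all such radii by `max K 1`.
  set K := (m univ / τ).toReal with hK
  have hKtop : m univ / τ ≠ ∞ := ENNReal.div_ne_top hm hτ
  set R := max K 1 with hR
  have hbd : ∀ x r, 0 < r → τ * ENNReal.ofReal r ^ n < m (closedBall x r) → r ≤ R := by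
    intro x r hr h
    rcases le_or_gt r 1 with h1 | h1
    · exact h1.trans (le_max_right _ _)
    refine le_trans ?_ (le_max_left _ _)
    have h2 : τ * ENNReal.ofReal r ≤ m univ := by
      refine le_trans ?_ (h.le.trans (measure_mono (subset_univ _)))
      gcongr
      have h3 : (1 : ℝ≥0∞) ≤ ENNReal.ofReal r := by simpa using h1.le
      exact le_self_pow h3 (by omega)
    rw [hK, ← ENNReal.ofReal_le_iff_le_toReal hKtop, ENNReal.le_div_iff_mul_le (Or.inl hτ)
      (Or.inl hτ'), mul_comm]
    exact h2
  set A : Set X := {x | x ∈ S ∧ ∃ r, 0 < r ∧ τ * ENNReal.ofReal r ^ n < m (closedBall x r)}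
  have hsel : ∀ x, x ∈ A → ∃ ρ, 0 < ρ ∧ τ * ENNReal.ofReal ρ ^ n < m (closedBall x ρ) ∧
      ∀ r, 2 * ρ ≤ r → m (closedBall x r) ≤ τ * ENNReal.ofReal r ^ n := by
    rintro x ⟨-, r₀, hr₀, hx⟩
    set T : Set ℝ := {r | 0 < r ∧ τ * ENNReal.ofReal r ^ n < m (closedBall x r)}
    have hTb : BddAbove T := ⟨R, fun r hr => hbd x r hr.1 hr.2⟩
    have hTn : T.Nonempty := ⟨r₀, hr₀, hx⟩
    have hs : 0 < sSup T := hr₀.trans_le (le_csSup hTb ⟨hr₀, hx⟩)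
    -- Choosing `ρ` above half the supremum of bad radii places every `r ≥ 2 ρ` beyond that
    -- supremum, so the density bound holds from there on.
    obtain ⟨ρ, hρ, h1⟩ := exists_lt_of_lt_csSup hTn (half_lt_self hs)
    refine ⟨ρ, hρ.1, hρ.2, fun r hr => ?_⟩
    by_contra! hc
    have : r ≤ sSup T := le_csSup hTb ⟨by linarith [hρ.1], hc⟩
    linarith
  choose! ρ hρ0 hρ1 hρ2 using hsel
  obtain ⟨u, huA, hdis, hcov⟩ := Vitali.exists_disjoint_subfamily_covering_enlargement_closedBall
    A (fun x => x) ρ R (fun a ha => hbd a _ (hρ0 a ha) (hρ1 a ha)) 5 (by norm_num)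
  refine ⟨u, ρ, fun a ha => (huA ha).1, ?_, fun a ha => hρ0 a (huA ha),
    fun a ha => hρ1 a (huA ha), hdis, fun a ha => hρ2 a (huA ha), ?_⟩
  · refine Set.PairwiseDisjoint.countable_of_nonempty_interior hdis fun a ha => ?_
    exact ⟨a, ball_subset_interior_closedBall (mem_ball_self (hρ0 a (huA ha)))⟩
  · intro x hxS hx
    obtain ⟨b, hb, hsub⟩ := hcov x ⟨hxS, hx⟩
    exact ⟨b, hb, hsub (mem_closedBall_self (hρ0 x ⟨hxS, hx⟩).le)⟩

theorem tsum_radius_pow_le {n : ℕ} {m : Measure X} {τ : ℝ≥0∞} {u : Set X} {ρ : X → ℝ}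
    (hc : u.Countable)
    (hd : ∀ a ∈ u, τ * ENNReal.ofReal (ρ a) ^ n < m (closedBall a (ρ a)))
    (hdis : u.PairwiseDisjoint (fun a => closedBall a (ρ a))) :
    τ * ∑' a : u, ENNReal.ofReal (ρ a) ^ n ≤ m univ := by
  have := hc.to_subtype
  rw [← ENNReal.tsum_mul_left]
  refine (ENNReal.tsum_le_tsum fun a : u => (hd a a.2).le).trans ?_
  refine (tsum_meas_le_meas_iUnion_of_disjoint m (fun i => measurableSet_closedBall) ?_).trans
    (measure_mono (subset_univ _))
  intro a b hab
  exact hdis a.2 b.2 (fun h => hab (Subtype.ext h))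

/-- The measure of the enlarged balls is controlled by the total mass. -/
theorem measure_enlarged_balls_le {n : ℕ} {m ν : Measure X} {τ C : ℝ≥0∞} (hτ : τ ≠ 0)
    (hτ' : τ ≠ ∞) (hν : BallGrowth n C ν) {u : Set X} {ρ : X → ℝ} (hc : u.Countable)
    (hρ : ∀ a ∈ u, 0 < ρ a)
    (hd : ∀ a ∈ u, τ * ENNReal.ofReal (ρ a) ^ n < m (closedBall a (ρ a)))
    (hdis : u.PairwiseDisjoint (fun a => closedBall a (ρ a))) {K : ℝ} (hK : 0 < K) :
    ν (⋃ a ∈ u, closedBall a (K * ρ a)) ≤ C * ENNReal.ofReal K ^ n * (m univ / τ) := by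
  have h1 : ∑' a : u, ENNReal.ofReal (ρ a) ^ n ≤ m univ / τ := by
    rw [ENNReal.le_div_iff_mul_le (Or.inl hτ) (Or.inl hτ'), mul_comm]
    exact tsum_radius_pow_le hc hd hdis
  calc ν (⋃ a ∈ u, closedBall a (K * ρ a)) ≤ ∑' a : u, ν (closedBall a (K * ρ a)) :=
        measure_biUnion_le _ hc _
    _ ≤ ∑' a : u, C * ENNReal.ofReal K ^ n * ENNReal.ofReal (ρ a) ^ n := by
        refine ENNReal.tsum_le_tsum fun a => (hν _ _ (mul_pos hK (hρ a a.2))).trans ?_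
        rw [ENNReal.ofReal_mul hK.le, mul_pow, mul_assoc]
    _ ≤ _ := by rw [ENNReal.tsum_mul_left]; gcongr

/-- Vitali selection applied to the measure `h μ`: the disjoint balls pay for their radii with the
mass of `h μ`, and growth of `ν` converts the radii back into `ν`-mass. No relation between `μ` and
`ν` is needed, because both are compared with `r^n`. -/
theorem measure_lt_radialMax_le {n : ℕ} (hn : 1 ≤ n) {μ ν : Measure X} {C : ℝ≥0∞}
    (hν : BallGrowth n C ν) (h : X → ℝ≥0∞) {t : ℝ≥0∞} (ht : t ≠ 0)
    (ht' : t ≠ ∞) (hC : C ≠ 0) :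
    ν {y | t < radialMax n μ h y} ≤ C * 5 ^ n * ((∫⁻ x, h x ∂μ) / t) := by
  rcases eq_or_ne (∫⁻ x, h x ∂μ) ∞ with hfin | hfin
  · rw [hfin, ENNReal.top_div_of_ne_top ht', ENNReal.mul_top (mul_ne_zero hC (by simp))]
    exact le_top
  have hm : (μ.withDensity h) univ = ∫⁻ x, h x ∂μ := by
    rw [withDensity_apply _ MeasurableSet.univ, Measure.restrict_univ]
  obtain ⟨u, ρ, -, hc, hρ, hd, hdis, -, hcov⟩ := exists_disjoint_balls_of_density hn
    (μ.withDensity h) (by rwa [hm]) ht ht' univ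
  have := measure_enlarged_balls_le ht ht' hν hc hρ hd hdis (K := 5) (by norm_num)
  rw [hm] at this
  refine (measure_mono ?_).trans (this.trans (by simp))
  intro y hy
  obtain ⟨r, hr, h1⟩ := lt_radialMax_iff.1 hy
  obtain ⟨a, ha, hya⟩ := hcov y (mem_univ _) ⟨r, hr, by
    rwa [withDensity_apply _ measurableSet_closedBall]⟩
  exact mem_biUnion ha hya

/-- The `L^∞` endpoint of the interpolation: by growth, a constant `b` adds at most `b C` to the
maximal function. -/
theorem radialMax_le_add {n : ℕ} {μ : Measure X} {C : ℝ≥0∞} (hμ : BallGrowth n C μ)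
    {h h₁ : X → ℝ≥0∞} {b : ℝ≥0∞} (hle : ∀ x, h x ≤ h₁ x + b)
    (y : X) : radialMax n μ h y ≤ radialMax n μ h₁ y + b * C := by
  refine iSup₂_le fun r hr => ?_
  rw [ENNReal.div_le_iff (ofReal_pow_ne_zero hr n) (ofReal_pow_ne_top r n), add_mul]
  calc ∫⁻ x in closedBall y r, h x ∂μ ≤ ∫⁻ x in closedBall y r, (h₁ x + b) ∂μ :=
        lintegral_mono fun x => hle x
    _ = ∫⁻ x in closedBall y r, h₁ x ∂μ + b * μ (closedBall y r) := by
        rw [lintegral_add_right _ measurable_const]; simp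
    _ ≤ _ := by
        rw [mul_assoc]
        gcongr
        · exact lintegral_closedBall_le_radialMax n μ h₁ y hr
        · exact hμ y r hr

/-! ### Layer-cake integrals and the strong type maximal inequality -/

theorem lintegral_Ioi_rpow_indicator {s : ℝ} (hs : 0 < s) {b : ℝ} (hb : 0 ≤ b) :
    ∫⁻ t in Ioi (0 : ℝ), (if t < b then ENNReal.ofReal (t ^ (s - 1)) else 0)
      = ENNReal.ofReal (b ^ s / s) := by
  have h1 : ∫ t in (0:ℝ)..b, t ^ (s - 1) = b ^ s / s := by
    rw [integral_rpow (Or.inl (by linarith))]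
    simp [Real.zero_rpow hs.ne']
  have h2 : IntervalIntegrable (fun t : ℝ => t ^ (s - 1)) volume 0 b :=
    intervalIntegral.intervalIntegrable_rpow' (by linarith)
  rw [intervalIntegral.integral_of_le hb, integral_Ioc_eq_integral_Ioo] at h1
  have h3 : IntegrableOn (fun t : ℝ => t ^ (s - 1)) (Ioo 0 b) :=
    ((intervalIntegrable_iff_integrableOn_Ioc_of_le hb).1 h2).mono_set Ioo_subset_Ioc_self
  rw [← h1, ofReal_integral_eq_lintegral_ofReal h3, ← Ioi_inter_Iio, inter_comm,
    ← Measure.restrict_restrict measurableSet_Iio, ← lintegral_indicator measurableSet_Iio]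
  · rfl
  · filter_upwards [ae_restrict_mem measurableSet_Ioo] with t ht
    exact Real.rpow_nonneg ht.1.le _

theorem lintegral_layer_le {s : ℝ} (hs : 0 < s) (a : ℝ≥0∞) :
    ∫⁻ t in Ioi (0 : ℝ), (if ENNReal.ofReal t < a then ENNReal.ofReal (t ^ (s - 1)) else 0)
      ≤ ENNReal.ofReal s⁻¹ * a ^ s := by
  rcases eq_or_ne a ∞ with rfl | ha
  · rw [ENNReal.top_rpow_of_pos hs, ENNReal.mul_top (by simpa using hs)]
    exact le_top
  · lift a to ℝ≥0 using ha
    have := lintegral_Ioi_rpow_indicator hs a.coe_nonneg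
    rw [div_eq_inv_mul, ENNReal.ofReal_mul (by positivity),
      ← ENNReal.ofReal_rpow_of_nonneg a.coe_nonneg hs.le] at this
    simp only [ENNReal.ofReal_coe_nnreal] at this
    rw [← this]
    refine lintegral_mono fun t => ?_
    by_cases ht : ENNReal.ofReal t < a
    · have : t < a := by
        rw [← ENNReal.ofReal_coe_nnreal] at ht
        exact (ENNReal.ofReal_lt_ofReal_iff'.1 ht).1
      simp [ht, this]
    · simp [ht]

theorem le_lintegral_layer {s : ℝ} (hs : 0 < s) (a : ℝ≥0∞) :
    ENNReal.ofReal s⁻¹ * a ^ s ≤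
    ∫⁻ t in Ioi (0 : ℝ), (if ENNReal.ofReal t < a then ENNReal.ofReal (t ^ (s - 1)) else 0) := by
  have key : ∀ b : ℝ≥0, (b : ℝ≥0∞) ≤ a → ENNReal.ofReal s⁻¹ * (b : ℝ≥0∞) ^ s ≤
      ∫⁻ t in Ioi (0 : ℝ), (if ENNReal.ofReal t < a then ENNReal.ofReal (t ^ (s - 1)) else 0) := by
    intro b hb
    have := lintegral_Ioi_rpow_indicator hs b.coe_nonneg
    rw [div_eq_inv_mul, ENNReal.ofReal_mul (by positivity),
      ← ENNReal.ofReal_rpow_of_nonneg b.coe_nonneg hs.le] at this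
    simp only [ENNReal.ofReal_coe_nnreal] at this
    rw [← this]
    refine setLIntegral_mono' measurableSet_Ioi fun t ht0 => ?_
    by_cases ht : t < b
    · have : ENNReal.ofReal t < a := by
        refine lt_of_lt_of_le ?_ hb
        rw [← ENNReal.ofReal_coe_nnreal]
        exact (ENNReal.ofReal_lt_ofReal_iff_of_nonneg (le_of_lt ht0)).2 ht
      simp [ht, this]
    · simp [ht]
  rcases eq_or_ne a ∞ with rfl | ha
  · rw [ENNReal.top_rpow_of_pos hs, ENNReal.mul_top (by simpa using hs)]
    have h1 : Tendsto (fun N : ℕ => ENNReal.ofReal s⁻¹ * ((N : ℝ≥0) : ℝ≥0∞) ^ s) atTop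
        (𝓝 (ENNReal.ofReal s⁻¹ * ∞)) := by
      refine ENNReal.Tendsto.const_mul ?_ (Or.inl (by simp))
      have := (ENNReal.continuous_rpow_const (y := s)).tendsto ∞
      rw [ENNReal.top_rpow_of_pos hs] at this
      refine this.comp ?_
      simpa using ENNReal.tendsto_nat_nhds_top
    rw [ENNReal.mul_top (by simpa using hs)] at h1
    exact le_of_tendsto' h1 fun N => key N le_top
  · lift a to ℝ≥0 using ha
    exact key a le_rfl

/-- The strong type maximal inequality between two measures with polynomial growth. -/
theorem lintegral_radialMax_rpow_le {n : ℕ} (hn : 1 ≤ n) {μ ν : Measure X} [SFinite μ] [SFinite ν]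
    {C₁ C₂ : ℝ≥0∞} (hC₁ : C₁ ≠ ∞) (hC₂ : C₂ ≠ ∞) (hμ : BallGrowth n C₁ μ)
    (hν : BallGrowth n C₂ ν) {s : ℝ} (hs : 1 < s) :
    ∃ A : ℝ≥0∞, A ≠ ∞ ∧ ∀ h : X → ℝ≥0∞, Measurable h →
      ∫⁻ y, radialMax n μ h y ^ s ∂ν ≤ A * ∫⁻ x, h x ^ s ∂μ := by
  -- The growth constants are enlarged to be nonzero, since they occur in denominators and multiply
  -- a possibly infinite integral.
  set c : ℝ≥0∞ := max C₁ 1 with hc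
  set c' : ℝ≥0∞ := max C₂ 1 with hc'
  have hc0 : c ≠ 0 := (zero_lt_one.trans_le (le_max_right _ _)).ne'
  have hct : c ≠ ∞ := max_ne_top hC₁ ENNReal.one_ne_top
  have hc0' : c' ≠ 0 := (zero_lt_one.trans_le (le_max_right _ _)).ne'
  have hct' : c' ≠ ∞ := max_ne_top hC₂ ENNReal.one_ne_top
  have hμ' : BallGrowth n c μ := fun x r hr => (hμ x r hr).trans (by gcongr; exact le_max_left _ _)
  have hν' : BallGrowth n c' ν := fun x r hr => (hν x r hr).trans (by gcongr; exact le_max_left _ _)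
  have hs0 : 0 < s := by linarith
  have hs1 : 0 < s - 1 := by linarith
  set B : ℝ≥0∞ := c' * 5 ^ n * 2
  have hB : B ≠ ∞ := by finiteness
  refine ⟨ENNReal.ofReal s * (B * (ENNReal.ofReal (s - 1)⁻¹ * (2 * c) ^ (s - 1))), ?_,
    fun h hh => ?_⟩
  · have : (2 * c) ^ (s - 1) ≠ ∞ := ENNReal.rpow_ne_top_of_nonneg hs1.le (by finiteness)
    finiteness
  have weak : ∀ t : ℝ, 0 < t → ν {y | ENNReal.ofReal t < radialMax n μ h y} ≤
      B * (∫⁻ x, (if ENNReal.ofReal t < 2 * c * h x then h x else 0) ∂μ) / ENNReal.ofReal t := by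
    intro t ht
    have hT0 : ENNReal.ofReal t ≠ 0 := by simpa using ht
    have hTt : ENNReal.ofReal t ≠ ∞ := ENNReal.ofReal_ne_top
    -- Marcinkiewicz splitting at height `t / (2c)`: the part of `h` below it contributes at most `t
    -- / 2` to the maximal function, so the weak bound is applied to the part above at height `t /
    -- 2`.
    have hb : ∀ x, h x ≤ (if ENNReal.ofReal t < 2 * c * h x then h x else 0) +
        ENNReal.ofReal t / (2 * c) := by
      intro x
      split_ifs with h1
      · exact le_self_add
      · rw [zero_add, ENNReal.le_div_iff_mul_le (Or.inl (by simp [hc0]))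
          (Or.inl (by finiteness)), mul_comm]
        exact not_lt.1 h1
    have hle := radialMax_le_add hμ' hb
    have h2 : ENNReal.ofReal t / (2 * c) * c = ENNReal.ofReal t / 2 := by
      rw [ENNReal.div_eq_inv_mul, ENNReal.mul_inv (Or.inl (by simp)) (Or.inl (by simp)),
        ENNReal.div_eq_inv_mul]
      calc 2⁻¹ * c⁻¹ * ENNReal.ofReal t * c = 2⁻¹ * ENNReal.ofReal t * (c⁻¹ * c) := by ring
        _ = _ := by rw [ENNReal.inv_mul_cancel hc0 hct, mul_one]
    have hsub : {y | ENNReal.ofReal t < radialMax n μ h y} ⊆ {y | ENNReal.ofReal t / 2 <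
        radialMax n μ (fun x => if ENNReal.ofReal t < 2 * c * h x then h x else 0) y} := by
      intro y hy
      have h3 := lt_of_lt_of_le hy (hle y)
      rw [h2] at h3
      by_contra hcon
      have h4 := add_le_add_left (not_lt.1 hcon) (ENNReal.ofReal t / 2)
      rw [ENNReal.add_halves] at h4
      exact absurd h3 (not_lt.2 h4)
    refine (measure_mono hsub).trans ((measure_lt_radialMax_le hn hν' _
      (by simpa using ht) (by finiteness) hc0').trans (le_of_eq ?_))
    rw [ENNReal.div_eq_inv_mul, ENNReal.div_eq_inv_mul, ENNReal.div_eq_inv_mul,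
      ENNReal.mul_inv (Or.inl (by simp)) (Or.inl (by simp)), inv_inv]
    ring
  have hm1 : Measurable (Function.uncurry fun (y : X) (t : ℝ) =>
      if ENNReal.ofReal t < radialMax n μ h y then ENNReal.ofReal (t ^ (s - 1)) else 0) := by
    refine Measurable.ite (measurableSet_lt (by fun_prop)
      ((measurable_radialMax n μ h).comp measurable_fst)) (by fun_prop) measurable_const
  have hm2 : Measurable (Function.uncurry fun (t : ℝ) (x : X) =>
      ENNReal.ofReal (t ^ (s - 1 - 1)) *
        if ENNReal.ofReal t < 2 * c * h x then h x else 0) := by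
    refine Measurable.mul (by fun_prop) (Measurable.ite (measurableSet_lt (by fun_prop)
      (by fun_prop)) (by fun_prop) measurable_const)
  calc ∫⁻ y, radialMax n μ h y ^ s ∂ν
      ≤ ∫⁻ y, ENNReal.ofReal s * (∫⁻ t in Ioi (0 : ℝ),
        (if ENNReal.ofReal t < radialMax n μ h y then ENNReal.ofReal (t ^ (s - 1)) else 0)) ∂ν := by
        refine lintegral_mono fun y => ?_
        refine le_trans (le_of_eq ?_) (mul_le_mul_right (le_lintegral_layer hs0 _) _)
        rw [← mul_assoc, ← ENNReal.ofReal_mul hs0.le, mul_inv_cancel₀ hs0.ne']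
        simp
    _ = ENNReal.ofReal s * ∫⁻ t in Ioi (0 : ℝ), ∫⁻ y,
        (if ENNReal.ofReal t < radialMax n μ h y then ENNReal.ofReal (t ^ (s - 1)) else 0) ∂ν := by
        rw [lintegral_const_mul' _ _ ENNReal.ofReal_ne_top,
          lintegral_lintegral_swap hm1.aemeasurable]
    _ ≤ ENNReal.ofReal s * ∫⁻ t in Ioi (0 : ℝ), B * ∫⁻ x, (ENNReal.ofReal (t ^ (s - 1 - 1)) *
        if ENNReal.ofReal t < 2 * c * h x then h x else 0) ∂μ := by
        gcongr ENNReal.ofReal s * ?_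
        refine setLIntegral_mono' measurableSet_Ioi fun t ht => ?_
        have ht : 0 < t := ht
        have hset : MeasurableSet {y | ENNReal.ofReal t < radialMax n μ h y} :=
          measurableSet_lt measurable_const (measurable_radialMax n μ h)
        have h5 : ∫⁻ y, (if ENNReal.ofReal t < radialMax n μ h y
            then ENNReal.ofReal (t ^ (s - 1)) else 0) ∂ν =
            ENNReal.ofReal (t ^ (s - 1)) * ν {y | ENNReal.ofReal t < radialMax n μ h y} := by
          rw [← lintegral_indicator_const hset]; simp [indicator]
        rw [h5, lintegral_const_mul' _ _ ENNReal.ofReal_ne_top]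
        refine (mul_le_mul_right (weak t ht) _).trans (le_of_eq ?_)
        rw [Real.rpow_sub_one ht.ne' (s - 1), ENNReal.ofReal_div_of_pos ht,
          ENNReal.div_eq_inv_mul, ENNReal.div_eq_inv_mul]
        ring
    _ = ENNReal.ofReal s * (B * ∫⁻ x, (∫⁻ t in Ioi (0 : ℝ), ENNReal.ofReal (t ^ (s - 1 - 1)) *
        if ENNReal.ofReal t < 2 * c * h x then h x else 0) ∂μ) := by
        rw [lintegral_const_mul' _ _ hB, lintegral_lintegral_swap hm2.aemeasurable]
    _ ≤ ENNReal.ofReal s * (B * ∫⁻ x, (ENNReal.ofReal (s - 1)⁻¹ * (2 * c) ^ (s - 1)) *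
        h x ^ s ∂μ) := by
        gcongr with x
        have h6 : ∀ t : ℝ, (ENNReal.ofReal (t ^ (s - 1 - 1)) *
            if ENNReal.ofReal t < 2 * c * h x then h x else 0) =
            h x * (if ENNReal.ofReal t < 2 * c * h x then
              ENNReal.ofReal (t ^ (s - 1 - 1)) else 0) := by
          intro t; split_ifs <;> simp [mul_comm]
        simp_rw [h6]
        rw [lintegral_const_mul _ (Measurable.ite (measurableSet_lt (by fun_prop)
          (by fun_prop)) (by fun_prop) measurable_const)]
        refine (mul_le_mul_right (lintegral_layer_le hs1 _) _).trans (le_of_eq ?_)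
        rw [ENNReal.mul_rpow_of_nonneg _ _ hs1.le]
        have h7 : h x ^ s = h x * h x ^ (s - 1) := by
          conv_lhs => rw [show s = 1 + (s - 1) by ring]
          rw [ENNReal.rpow_add_of_nonneg _ _ zero_le_one hs1.le, ENNReal.rpow_one]
        rw [h7]; ring
    _ = _ := by
        rw [lintegral_const_mul _ (by fun_prop)]
        ring

end Maximal

/-! ### Positive kernels dominated by maximal functions -/

section Kernels

variable {X : Type*} [MetricSpace X] [MeasurableSpace X] [BorelSpace X]
  [SecondCountableTopology X]

/-- The absorption step of the duality argument: after raising to the power `p`, the factor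
`x^(p-1)` cancels. Finiteness of `x` is essential, and is the reason for the truncations made where
this is used. -/
theorem le_of_le_rpow_mul_rpow {p p' : ℝ} (hpp : p.HolderConjugate p') {x a b : ℝ≥0∞}
    (hx : x ≠ ∞) (h : x ≤ a * b ^ (1 / p) * x ^ (1 / p')) : x ≤ a ^ p * b := by
  rcases eq_or_ne x 0 with rfl | hx0
  · exact zero_le
  have hp0 : 0 < p := hpp.pos
  have h1 := ENNReal.rpow_le_rpow h hp0.le
  rw [ENNReal.mul_rpow_of_nonneg _ _ hp0.le, ENNReal.mul_rpow_of_nonneg _ _ hp0.le,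
    ← ENNReal.rpow_mul, ← ENNReal.rpow_mul, one_div_mul_cancel hp0.ne', ENNReal.rpow_one,
    show 1 / p' * p = p - 1 by rw [← hpp.div_conj_eq_sub_one]; ring] at h1
  have hp1 : 0 < p - 1 := hpp.sub_one_pos
  have h2 : x ^ p = x * x ^ (p - 1) := by
    conv_lhs => rw [show p = 1 + (p - 1) by ring]
    rw [ENNReal.rpow_add_of_nonneg _ _ zero_le_one hp1.le, ENNReal.rpow_one]
  rw [h2] at h1
  refine (ENNReal.mul_le_mul_iff_left ?_ ?_).1 h1
  · exact (ENNReal.rpow_pos (pos_iff_ne_zero.2 hx0) hx).ne'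
  · exact ENNReal.rpow_ne_top_of_nonneg hp1.le hx

/-- A positive integral operator whose adjoint is dominated by a maximal function of order
`s < p'` is bounded on `L^p`, with a bound that does not depend on the kernel. -/
theorem exists_lintegral_kernel_rpow_le {n : ℕ} (hn : 1 ≤ n) {μ ν : Measure X} [SigmaFinite μ]
    [SFinite ν] {C₁ C₂ : ℝ≥0∞} (hC₁ : C₁ ≠ ∞) (hC₂ : C₂ ≠ ∞) (hμ : BallGrowth n C₁ μ)
    (hν : BallGrowth n C₂ ν) {p p' s : ℝ} (hpp : p.HolderConjugate p') (hs : 0 < s)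
    (hsp : s < p') {A : ℝ≥0∞} (hA : A ≠ ∞) :
    ∃ B : ℝ≥0∞, B ≠ ∞ ∧ ∀ K : X → X → ℝ≥0∞, Measurable (Function.uncurry K) →
      (∀ᵐ y ∂ν, ∀ h : X → ℝ≥0∞, Measurable h →
        ∫⁻ x, K x y * h x ∂μ ≤ A * radialMax n μ (fun x => h x ^ s) y ^ (1 / s)) →
      ∀ f : X → ℝ≥0∞, Measurable f →
        ∫⁻ x, (∫⁻ y, K x y * f y ∂ν) ^ p ∂μ ≤ B * ∫⁻ y, f y ^ p ∂ν := by
  obtain ⟨B₀, hB₀, hmax⟩ := lintegral_radialMax_rpow_le hn hC₁ hC₂ hμ hν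
    (s := p' / s) ((one_lt_div hs).2 hsp)
  have hp0 : 0 < p := hpp.pos
  have hp0' : 0 < p' := hpp.symm.pos
  refine ⟨(A * B₀ ^ (1 / p')) ^ p, ?_, fun K hK hadj f hf => ?_⟩
  · refine ENNReal.rpow_ne_top_of_nonneg hp0.le (ENNReal.mul_ne_top hA ?_)
    exact ENNReal.rpow_ne_top_of_nonneg (by positivity) hB₀
  set F : X → ℝ≥0∞ := fun x => ∫⁻ y, K x y * f y ∂ν with hF
  have hKf : Measurable (Function.uncurry fun x y => K x y * f y) :=
    hK.mul (hf.comp measurable_snd)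
  have hFm : Measurable F := hKf.lintegral_prod_right'
  -- Cutting `F` off in height and in space makes its `L^p` norm finite a priori; the bound is
  -- uniform in `N` and passes to `F` by monotone convergence.
  set FN : ℕ → X → ℝ≥0∞ := fun N => (spanningSets μ N).indicator (fun x => min (F x) N) with hFN
  have hFNm : ∀ N, Measurable (FN N) := fun N =>
    (hFm.min measurable_const).indicator (measurableSet_spanningSets μ N)
  have hFNle : ∀ N x, FN N x ≤ F x := fun N x => by
    by_cases hx : x ∈ spanningSets μ N <;> simp [hFN, hx]
  have hfin : ∀ N, ∫⁻ x, FN N x ^ p ∂μ ≠ ∞ := by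
    intro N
    have h1 : ∀ x, FN N x ^ p ≤ (spanningSets μ N).indicator (fun _ => (N : ℝ≥0∞) ^ p) x := by
      intro x
      by_cases hx : x ∈ spanningSets μ N
      · simp only [hFN, hx, indicator_of_mem]
        exact ENNReal.rpow_le_rpow (min_le_right _ _) hp0.le
      · simp [hFN, hx, hp0]
    refine ((lintegral_mono h1).trans_lt ?_).ne
    rw [lintegral_indicator_const (measurableSet_spanningSets μ N)]
    exact ENNReal.mul_lt_top (ENNReal.rpow_lt_top_of_nonneg hp0.le (by simp))
      (measure_spanningSets_lt_top μ N)
  have hbound : ∀ N, ∫⁻ x, FN N x ^ p ∂μ ≤ (A * B₀ ^ (1 / p')) ^ p * ∫⁻ y, f y ^ p ∂ν := by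
    intro N
    refine le_of_le_rpow_mul_rpow hpp (hfin N) ?_
    -- The extremal dual function: `g^p' = FN^p`. The maximal inequality is then used at exponent
    -- `p' / s > 1`.
    set g : X → ℝ≥0∞ := fun x => FN N x ^ (p - 1)
    have hg : Measurable g := (hFNm N).pow_const _
    have hp1 : 0 < p - 1 := hpp.sub_one_pos
    calc ∫⁻ x, FN N x ^ p ∂μ ≤ ∫⁻ x, F x * g x ∂μ := by
          refine lintegral_mono fun x => ?_
          have : FN N x ^ p = FN N x * FN N x ^ (p - 1) := by
            conv_lhs => rw [show p = 1 + (p - 1) by ring]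
            rw [ENNReal.rpow_add_of_nonneg _ _ zero_le_one hp1.le, ENNReal.rpow_one]
          rw [this]
          exact mul_le_mul_left (hFNle N x) _
      _ = ∫⁻ x, ∫⁻ y, K x y * f y * g x ∂ν ∂μ := by
          refine lintegral_congr fun x => ?_
          exact (lintegral_mul_const _ (hKf.comp measurable_prodMk_left)).symm
      _ = ∫⁻ y, ∫⁻ x, K x y * f y * g x ∂μ ∂ν := by
          refine lintegral_lintegral_swap (Measurable.aemeasurable ?_)
          exact hKf.mul (hg.comp measurable_fst)
      _ = ∫⁻ y, f y * ∫⁻ x, K x y * g x ∂μ ∂ν := by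
          refine lintegral_congr fun y => ?_
          rw [← lintegral_const_mul]
          · refine lintegral_congr fun x => by ring
          · exact (hK.comp measurable_prodMk_right).mul hg
      _ ≤ ∫⁻ y, A * (f y * radialMax n μ (fun x => g x ^ s) y ^ (1 / s)) ∂ν := by
          refine lintegral_mono_ae ?_
          filter_upwards [hadj] with y hy
          calc f y * ∫⁻ x, K x y * g x ∂μ ≤
              f y * (A * radialMax n μ (fun x => g x ^ s) y ^ (1 / s)) := by
                gcongr; exact hy g hg
            _ = _ := by ring
      _ = A * ∫⁻ y, f y * radialMax n μ (fun x => g x ^ s) y ^ (1 / s) ∂ν :=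
          lintegral_const_mul' _ _ hA
      _ ≤ A * ((∫⁻ y, f y ^ p ∂ν) ^ (1 / p) *
          (∫⁻ y, (radialMax n μ (fun x => g x ^ s) y ^ (1 / s)) ^ p' ∂ν) ^ (1 / p')) := by
          gcongr
          exact ENNReal.lintegral_mul_le_Lp_mul_Lq ν hpp hf.aemeasurable
            ((measurable_radialMax n μ _).pow_const _).aemeasurable
      _ ≤ A * ((∫⁻ y, f y ^ p ∂ν) ^ (1 / p) * (B₀ * ∫⁻ x, FN N x ^ p ∂μ) ^ (1 / p')) := by
          gcongr
          refine (le_of_eq ?_).trans ((hmax (fun x => g x ^ s) (hg.pow_const _)).trans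
            (le_of_eq ?_))
          · refine lintegral_congr fun y => ?_
            rw [← ENNReal.rpow_mul]; congr 1; ring
          · congr 1
            refine lintegral_congr fun x => ?_
            simp only [g]
            rw [← ENNReal.rpow_mul, ← ENNReal.rpow_mul]; congr 1
            rw [mul_div_cancel₀ _ hs.ne', hpp.sub_one_mul_conj]
      _ = _ := by rw [ENNReal.mul_rpow_of_nonneg _ _ (by positivity)]; ring
  have hmono : ∀ x, Monotone fun N => FN N x ^ p := by
    intro x N M hNM
    refine ENNReal.rpow_le_rpow ?_ hp0.le
    by_cases hx : x ∈ spanningSets μ N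
    · have hx' := monotone_spanningSets μ hNM hx
      simp only [hFN, hx, hx', indicator_of_mem]
      gcongr
    · simp [hFN, hx]
  have hlim : ∀ x, Tendsto (fun N => FN N x ^ p) atTop (𝓝 (F x ^ p)) := by
    intro x
    refine (ENNReal.continuous_rpow_const.tendsto _).comp ?_
    have h1 : Tendsto (fun N : ℕ => min (F x) (N : ℝ≥0∞)) atTop (𝓝 (min (F x) ∞)) :=
      tendsto_const_nhds.min ENNReal.tendsto_nat_nhds_top
    rw [min_top_right] at h1
    refine h1.congr' ?_
    have h2 : x ∈ ⋃ N, spanningSets μ N := by rw [iUnion_spanningSets]; trivial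
    obtain ⟨N₀, hN₀⟩ := mem_iUnion.1 h2
    filter_upwards [eventually_ge_atTop N₀] with N hN
    simp [hFN, monotone_spanningSets μ hN hN₀]
  exact le_of_tendsto' (lintegral_tendsto_of_tendsto_of_monotone
    (fun N => ((hFNm N).pow_const p).aemeasurable) (ae_of_all _ hmono) (ae_of_all _ hlim)) hbound

theorem measure_lt_le_of_lintegral_rpow_le {μ : Measure X} {p : ℝ} (hp : 0 < p) {F : X → ℝ≥0∞}
    (hF : Measurable F) {N t : ℝ≥0∞} (h : ∫⁻ x, F x ^ p ∂μ ≤ N) (ht : t ≠ 0) (ht' : t ≠ ∞) :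
    μ {x | t < F x} ≤ N / t ^ p := by
  have h0 : t ^ p ≠ 0 := (ENNReal.rpow_pos (pos_iff_ne_zero.2 ht) ht').ne'
  have h1 : t ^ p ≠ ∞ := ENNReal.rpow_ne_top_of_nonneg hp.le ht'
  refine (measure_mono fun x hx => ?_).trans ((meas_ge_le_lintegral_div
    (hF.pow_const p).aemeasurable h0 h1).trans (ENNReal.div_le_div_right h _))
  exact ENNReal.rpow_le_rpow (le_of_lt hx) hp.le

/-- The kernel `r(y)^η / |x-y|^{n+η}` on `|x-y| ≥ r(y)`. -/
noncomputable def tailKernel (n : ℕ) (η : ℝ) (r : X → ℝ) (x y : X) : ℝ≥0∞ :=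
  if r y ≤ dist x y then ENNReal.ofReal (r y ^ η / dist x y ^ ((n : ℝ) + η)) else 0

/-- The kernel `ε^{-n}` on `|x-y| ≤ 2ε`. -/
noncomputable def annulusKernel (n : ℕ) (ε : ℝ) (x y : X) : ℝ≥0∞ :=
  if dist x y ≤ 2 * ε then (ENNReal.ofReal ε ^ n)⁻¹ else 0

theorem measurable_tailKernel (n : ℕ) (η : ℝ) {r : X → ℝ} (hr : Measurable r) :
    Measurable (Function.uncurry (tailKernel n η r)) := by
  refine Measurable.ite (measurableSet_le (by fun_prop) (by fun_prop)) ?_ measurable_const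
  fun_prop

theorem measurable_annulusKernel (n : ℕ) (ε : ℝ) :
    Measurable (Function.uncurry (annulusKernel (X := X) n ε)) := by
  refine Measurable.ite (measurableSet_le (by fun_prop) (by fun_prop)) ?_ measurable_const
  fun_prop

/-- The sum of the geometric series that bounds the tail kernels. -/
noncomputable def tailConst (n : ℕ) (η : ℝ) : ℝ≥0∞ :=
  2 ^ n * ∑' j : ℕ, ENNReal.ofReal (2 ^ (-η)) ^ j

theorem tailConst_ne_top (n : ℕ) {η : ℝ} (hη : 0 < η) : tailConst n η ≠ ∞ := by
  refine ENNReal.mul_ne_top (by simp) ?_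
  rw [ENNReal.tsum_geometric]
  refine ENNReal.inv_ne_top.2 ?_
  refine (tsub_pos_of_lt ?_).ne'
  rw [ENNReal.ofReal_lt_one]
  exact Real.rpow_lt_one_of_one_lt_of_neg one_lt_two (by linarith)

/-- Dyadic decomposition around `y`: when `2^j r ≤ |x - y| < 2^(j+1) r`, the kernel is at most
`2^(-jη) (2^j r)^(-n)`. -/
theorem tailKernel_le_tsum (n : ℕ) {η : ℝ} (hη : 0 < η) {r : X → ℝ} {y : X} (hr : 0 < r y)
    (x : X) : tailKernel n η r x y ≤ ∑' j : ℕ, ENNReal.ofReal (2 ^ (-η)) ^ j *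
      (ENNReal.ofReal (2 ^ j * r y) ^ n)⁻¹ *
        (closedBall y (2 ^ (j + 1) * r y)).indicator (fun _ => 1) x := by
  unfold tailKernel
  split_ifs with h
  swap
  · exact zero_le
  obtain ⟨j, hj1, hj2⟩ := exists_nat_pow_near ((one_le_div hr).2 h) one_lt_two
  rw [le_div_iff₀ hr] at hj1
  rw [div_lt_iff₀ hr] at hj2
  refine le_trans ?_ (ENNReal.le_tsum j)
  rw [indicator_of_mem (by exact hj2.le), mul_one]
  have hb : 0 < 2 ^ j * r y := by positivity
  rw [← ENNReal.ofReal_pow (by positivity), ← ENNReal.ofReal_pow hb.le,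
    ← ENNReal.ofReal_inv_of_pos (by positivity), ← ENNReal.ofReal_mul (by positivity)]
  refine ENNReal.ofReal_le_ofReal ?_
  calc r y ^ η / dist x y ^ ((n : ℝ) + η) ≤ r y ^ η / (2 ^ j * r y) ^ ((n : ℝ) + η) := by
        gcongr
    _ = ((2 : ℝ) ^ (-η)) ^ j * ((2 ^ j * r y) ^ n)⁻¹ := by
        rw [Real.rpow_add hb, Real.rpow_natCast, Real.mul_rpow (by positivity) hr.le,
          ← Real.rpow_natCast (2 ^ (-η)) j, ← Real.rpow_mul (by norm_num),
          ← Real.rpow_natCast 2 j, ← Real.rpow_mul (by norm_num), show -η * (j : ℝ) = -(j * η)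
          by ring, Real.rpow_neg (by norm_num)]
        have : 0 < r y ^ η := by positivity
        field_simp

/-- Each dyadic ball contributes one average of `h`, at most `2^n` times the maximal function, with
weight `2^(-jη)`. The bound does not depend on `r`, so the radius may vary with `y`. -/
theorem lintegral_tailKernel_le (n : ℕ) {μ : Measure X} {η : ℝ} (hη : 0 < η) {r : X → ℝ} {y : X}
    (hr : 0 < r y) {h : X → ℝ≥0∞} (hh : Measurable h) :
    ∫⁻ x, tailKernel n η r x y * h x ∂μ ≤ tailConst n η * radialMax n μ h y := by
  calc ∫⁻ x, tailKernel n η r x y * h x ∂μ ≤ ∫⁻ x, ∑' j : ℕ, ENNReal.ofReal (2 ^ (-η)) ^ j *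
      (ENNReal.ofReal (2 ^ j * r y) ^ n)⁻¹ *
        (closedBall y (2 ^ (j + 1) * r y)).indicator h x ∂μ := by
        refine lintegral_mono fun x => ?_
        refine (mul_le_mul_left (tailKernel_le_tsum n hη hr x) _).trans ?_
        rw [← ENNReal.tsum_mul_right]
        refine ENNReal.tsum_le_tsum fun j => ?_
        by_cases hx : x ∈ closedBall y (2 ^ (j + 1) * r y) <;> simp [hx]
    _ = ∑' j : ℕ, ENNReal.ofReal (2 ^ (-η)) ^ j * (ENNReal.ofReal (2 ^ j * r y) ^ n)⁻¹ *
        ∫⁻ x in closedBall y (2 ^ (j + 1) * r y), h x ∂μ := by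
        rw [lintegral_tsum]
        · refine tsum_congr fun j => ?_
          rw [lintegral_const_mul _ (hh.indicator measurableSet_closedBall),
            lintegral_indicator measurableSet_closedBall]
        · intro j
          exact ((hh.indicator measurableSet_closedBall).const_mul _).aemeasurable
    _ ≤ ∑' j : ℕ, 2 ^ n * ENNReal.ofReal (2 ^ (-η)) ^ j * radialMax n μ h y := by
        refine ENNReal.tsum_le_tsum fun j => ?_
        have hb : 0 < 2 ^ j * r y := by positivity
        have h1 := lintegral_closedBall_le_radialMax n μ h y
          (show 0 < 2 ^ (j + 1) * r y by positivity)
        rw [show (2 : ℝ) ^ (j + 1) * r y = 2 * (2 ^ j * r y) by ring,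
          ENNReal.ofReal_mul zero_le_two, mul_pow] at h1
        rw [show (2 : ℝ) ^ (j + 1) * r y = 2 * (2 ^ j * r y) by ring]
        have h2 := ENNReal.inv_mul_cancel (ofReal_pow_ne_zero hb n) (ofReal_pow_ne_top _ n)
        calc _ ≤ ENNReal.ofReal (2 ^ (-η)) ^ j * (ENNReal.ofReal (2 ^ j * r y) ^ n)⁻¹ *
            (radialMax n μ h y * (ENNReal.ofReal 2 ^ n * ENNReal.ofReal (2 ^ j * r y) ^ n)) := by
              gcongr
          _ = ENNReal.ofReal 2 ^ n * ENNReal.ofReal (2 ^ (-η)) ^ j * radialMax n μ h y *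
            ((ENNReal.ofReal (2 ^ j * r y) ^ n)⁻¹ * ENNReal.ofReal (2 ^ j * r y) ^ n) := by ring
          _ = _ := by rw [h2]; simp
    _ = _ := by rw [ENNReal.tsum_mul_right, ENNReal.tsum_mul_left, tailConst]

theorem lintegral_annulusKernel_le (n : ℕ) {μ : Measure X} {ε : ℝ} (hε : 0 < ε) (y : X)
    {h : X → ℝ≥0∞} (hh : Measurable h) :
    ∫⁻ x, annulusKernel n ε x y * h x ∂μ ≤ 2 ^ n * radialMax n μ h y := by
  have h1 : ∀ x, annulusKernel n ε x y * h x =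
      (ENNReal.ofReal ε ^ n)⁻¹ * (closedBall y (2 * ε)).indicator h x := by
    intro x
    unfold annulusKernel
    by_cases hx : dist x y ≤ 2 * ε
    · rw [if_pos hx, indicator_of_mem (by exact hx)]
    · rw [if_neg hx, indicator_of_notMem (by exact hx)]; simp
  simp_rw [h1]
  rw [lintegral_const_mul _ (hh.indicator measurableSet_closedBall),
    lintegral_indicator measurableSet_closedBall]
  have h2 := lintegral_closedBall_le_radialMax n μ h y (show 0 < 2 * ε by positivity)
  rw [ENNReal.ofReal_mul zero_le_two, mul_pow] at h2
  have h3 := ENNReal.inv_mul_cancel (ofReal_pow_ne_zero hε n) (ofReal_pow_ne_top _ n)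
  calc _ ≤ (ENNReal.ofReal ε ^ n)⁻¹ *
      (radialMax n μ h y * (ENNReal.ofReal 2 ^ n * ENNReal.ofReal ε ^ n)) := by gcongr
    _ = ENNReal.ofReal 2 ^ n * radialMax n μ h y *
      ((ENNReal.ofReal ε ^ n)⁻¹ * ENNReal.ofReal ε ^ n) := by ring
    _ = _ := by rw [h3]; simp

theorem exists_measure_lt_tailKernel_le {n : ℕ} (hn : 1 ≤ n) {μ ν : Measure X} [SigmaFinite μ]
    [SFinite ν] {C₁ C₂ : ℝ≥0∞} (hC₁ : C₁ ≠ ∞) (hC₂ : C₂ ≠ ∞) (hμ : BallGrowth n C₁ μ)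
    (hν : BallGrowth n C₂ ν) {p η : ℝ} (hp : 1 < p) (hη : 0 < η) :
    ∃ B : ℝ≥0∞, B ≠ ∞ ∧ ∀ r : X → ℝ, Measurable r → (∀ᵐ y ∂ν, 0 < r y) →
      ∀ f : X → ℝ≥0∞, Measurable f → ∀ t : ℝ≥0∞, t ≠ 0 → t ≠ ∞ →
        μ {x | t < ∫⁻ y, tailKernel n η r x y * f y ∂ν} ≤ B * (∫⁻ y, f y ^ p ∂ν) / t ^ p := by
  have hpp := Real.HolderConjugate.conjExponent hp
  obtain ⟨B, hB, h⟩ := exists_lintegral_kernel_rpow_le hn hC₁ hC₂ hμ hν hpp zero_lt_one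
    hpp.symm.lt (tailConst_ne_top n hη)
  refine ⟨B, hB, fun r hr hr0 f hf t ht ht' => ?_⟩
  refine measure_lt_le_of_lintegral_rpow_le hpp.pos ?_ (h _ (measurable_tailKernel n η hr) ?_ f hf)
    ht ht'
  · exact ((measurable_tailKernel n η hr).mul (hf.comp measurable_snd)).lintegral_prod_right'
  · filter_upwards [hr0] with y hy g hg
    simpa using lintegral_tailKernel_le n hη hy hg

theorem exists_measure_lt_annulusKernel_le {n : ℕ} (hn : 1 ≤ n) {μ ν : Measure X} [SigmaFinite μ]
    [SFinite ν] {C₁ C₂ : ℝ≥0∞} (hC₁ : C₁ ≠ ∞) (hC₂ : C₂ ≠ ∞) (hμ : BallGrowth n C₁ μ)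
    (hν : BallGrowth n C₂ ν) {p : ℝ} (hp : 1 < p) :
    ∃ B : ℝ≥0∞, B ≠ ∞ ∧ ∀ ε : ℝ, 0 < ε →
      ∀ f : X → ℝ≥0∞, Measurable f → ∀ t : ℝ≥0∞, t ≠ 0 → t ≠ ∞ →
        μ {x | t < ∫⁻ y, annulusKernel n ε x y * f y ∂ν} ≤ B * (∫⁻ y, f y ^ p ∂ν) / t ^ p := by
  have hpp := Real.HolderConjugate.conjExponent hp
  obtain ⟨B, hB, h⟩ := exists_lintegral_kernel_rpow_le hn hC₁ hC₂ hμ hν hpp zero_lt_one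
    hpp.symm.lt (A := 2 ^ n) (by simp)
  refine ⟨B, hB, fun ε hε f hf t ht ht' => ?_⟩
  refine measure_lt_le_of_lintegral_rpow_le hpp.pos ?_ (h _ (measurable_annulusKernel n ε) ?_ f hf)
    ht ht'
  · exact ((measurable_annulusKernel n ε).mul (hf.comp measurable_snd)).lintegral_prod_right'
  · filter_upwards with y g hg
    simpa using lintegral_annulusKernel_le n hε y hg

end Kernels

/-- Shorthand for `ℝ^d`. -/
abbrev Eucl (d : ℕ) := EuclideanSpace ℝ (Fin d)

/-! ### Truncated Calderón-Zygmund operators and transfer of mass -/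

section CalderonZygmund

variable {d : ℕ}

/-- The size and smoothness bounds of a Calderón-Zygmund kernel with explicit constants. -/
structure CZBound (n : ℕ) (c η : ℝ) (k : Eucl d → Eucl d → ℂ) : Prop where
  c_pos : 0 < c
  η_pos : 0 < η
  size : ∀ x y, x ≠ y → ‖k x y‖ ≤ c / ‖x - y‖ ^ n
  smooth : ∀ x x' y, x ≠ y → ‖x - x'‖ ≤ ‖x - y‖ / 2 →
    ‖k x y - k x' y‖ + ‖k y x - k y x'‖ ≤ c * ‖x - x'‖ ^ η / ‖x - y‖ ^ ((n : ℝ) + η)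

/-- The kernel `k` set to zero on `|x-y| ≤ ε`. -/
noncomputable def truncKernel (k : Eucl d → Eucl d → ℂ) (ε : ℝ) (x y : Eucl d) : ℂ :=
  open Classical in if ε < ‖x - y‖ then k x y else 0

theorem truncOp_eq_integral (k : Eucl d → Eucl d → ℂ) (ν : Measure (Eucl d)) (ε : ℝ)
    (f : Eucl d → ℂ) (x : Eucl d) :
    truncOp k ν ε f x = ∫ y, truncKernel k ε x y * f y ∂ν := by
  have hs : MeasurableSet {y : Eucl d | ε < ‖x - y‖} :=
    measurableSet_lt measurable_const (by fun_prop)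
  rw [truncOp, ← integral_indicator hs]
  congr 1; ext y
  by_cases hy : ε < ‖x - y‖ <;> simp [truncKernel, indicator, hy]

variable {n : ℕ} {c η : ℝ} {k : Eucl d → Eucl d → ℂ}

/-- Each variable is moved separately and the Hölder bound applied to each move. Off-diagonal
continuity is what makes the truncated kernel jointly measurable, as Fubini requires. -/
theorem CZBound.continuousAt (hk : CZBound n c η k) {x₀ y₀ : Eucl d} (h : x₀ ≠ y₀) :
    ContinuousAt (Function.uncurry k) (x₀, y₀) := by
  have hpos : 0 < ‖x₀ - y₀‖ := norm_pos_iff.2 (sub_ne_zero.2 h)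
  set g : Eucl d × Eucl d → ℝ := fun q => c * ‖x₀ - q.1‖ ^ η / ‖x₀ - q.2‖ ^ ((n : ℝ) + η) +
    c * ‖y₀ - q.2‖ ^ η / ‖y₀ - x₀‖ ^ ((n : ℝ) + η) with hg
  have hgc : ContinuousAt g (x₀, y₀) := by
    refine ContinuousAt.add ?_ ?_
    · refine ContinuousAt.div ?_ ?_ ?_
      · exact continuousAt_const.mul (ContinuousAt.rpow_const (by fun_prop) (Or.inr hk.η_pos.le))
      · exact ContinuousAt.rpow_const (by fun_prop) (Or.inl hpos.ne')
      · exact (Real.rpow_pos_of_pos hpos _).ne'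
    · refine ContinuousAt.div_const ?_ _
      exact continuousAt_const.mul (ContinuousAt.rpow_const (by fun_prop) (Or.inr hk.η_pos.le))
  have hg0 : g (x₀, y₀) = 0 := by
    simp only [hg, sub_self, norm_zero, Real.zero_rpow hk.η_pos.ne', mul_zero, zero_div, add_zero]
  rw [ContinuousAt, hg0] at hgc
  have h1 : ∀ᶠ q : Eucl d × Eucl d in 𝓝 (x₀, y₀), x₀ ≠ q.2 := by
    refine ContinuousAt.eventually_ne continuousAt_snd h.symm |>.mono fun q hq => hq.symm
  have h2 : ∀ᶠ q : Eucl d × Eucl d in 𝓝 (x₀, y₀), ‖x₀ - q.1‖ < ‖x₀ - q.2‖ / 2 := by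
    refine ContinuousAt.eventually_lt (by fun_prop) (by fun_prop) ?_
    simpa using hpos
  have h3 : ∀ᶠ q : Eucl d × Eucl d in 𝓝 (x₀, y₀), ‖y₀ - q.2‖ < ‖y₀ - x₀‖ / 2 := by
    refine ContinuousAt.eventually_lt (by fun_prop) (by fun_prop) ?_
    simpa [norm_sub_rev] using hpos
  rw [ContinuousAt, tendsto_iff_norm_sub_tendsto_zero]
  refine squeeze_zero' (Eventually.of_forall fun q => norm_nonneg _) ?_ hgc
  filter_upwards [h1, h2, h3] with q hq1 hq2 hq3
  have e1 := hk.smooth x₀ q.1 q.2 hq1 hq2.le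
  have e2 := hk.smooth y₀ q.2 x₀ h.symm hq3.le
  calc ‖k q.1 q.2 - k x₀ y₀‖ ≤ ‖k q.1 q.2 - k x₀ q.2‖ + ‖k x₀ q.2 - k x₀ y₀‖ :=
        norm_sub_le_norm_sub_add_norm_sub _ _ _
    _ = ‖k x₀ q.2 - k q.1 q.2‖ + ‖k x₀ y₀ - k x₀ q.2‖ := by
        rw [norm_sub_rev (k q.1 q.2), norm_sub_rev (k x₀ q.2) (k x₀ y₀)]
    _ ≤ _ := add_le_add (by linarith [norm_nonneg (k q.2 x₀ - k q.2 q.1)])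
        (by linarith [norm_nonneg (k y₀ x₀ - k q.2 x₀)])

theorem CZBound.measurable_truncKernel (hk : CZBound n c η k) {ε : ℝ} (hε : 0 < ε) :
    Measurable (Function.uncurry (truncKernel k ε)) := by
  classical
  have hs : MeasurableSet {q : Eucl d × Eucl d | ε < ‖q.1 - q.2‖} :=
    measurableSet_lt measurable_const (by fun_prop)
  have := ContinuousOn.measurable_piecewise (f := Function.uncurry k) (g := fun _ => (0 : ℂ))
    (s := {q : Eucl d × Eucl d | ε < ‖q.1 - q.2‖}) ?_ continuousOn_const hs
  · convert this using 1
    ext q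
    simp [truncKernel, Set.piecewise, Function.uncurry]
  · rintro ⟨x, y⟩ hq
    refine (hk.continuousAt ?_).continuousWithinAt
    rintro rfl
    simp at hq
    linarith

theorem CZBound.enorm_truncKernel_le (hk : CZBound n c η k) {ε : ℝ} (hε : 0 < ε) (x y : Eucl d) :
    ‖truncKernel k ε x y‖ₑ ≤ ENNReal.ofReal c * (ENNReal.ofReal ε ^ n)⁻¹ := by
  unfold truncKernel
  split_ifs with h
  · have hne : x ≠ y := by rintro rfl; simp at h; linarith
    rw [← ENNReal.ofReal_pow hε.le, ← ENNReal.ofReal_inv_of_pos (by positivity),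
      ← ENNReal.ofReal_mul hk.c_pos.le, ← ofReal_norm]
    refine ENNReal.ofReal_le_ofReal ((hk.size x y hne).trans ?_)
    rw [div_eq_mul_inv]
    have := hk.c_pos.le
    gcongr
  · simp

theorem CZBound.enorm_truncKernel_le_inv (hk : CZBound n c η k) {ε : ℝ} (hε : 0 < ε)
    (x y : Eucl d) :
    ‖truncKernel k ε x y‖ₑ ≤ ENNReal.ofReal (c / ‖x - y‖ ^ n) := by
  unfold truncKernel
  split_ifs with h
  · have hne : x ≠ y := by rintro rfl; simp at h; linarith
    rw [← ofReal_norm]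
    exact ENNReal.ofReal_le_ofReal (hk.size x y hne)
  · simp

/-- Hölder reduces this to the `p'`-integrability of `|x - y|^(-n)` away from `x`. Since `n p' = n +
a` with `a = n (p' - 1) > 0`, the power is a tail kernel of exponent `a` and constant radius `ε`;
positivity of `a` uses `n ≥ 1`. -/
theorem CZBound.lintegral_truncKernel_mul_ne_top (hk : CZBound n c η k) (hn : 1 ≤ n) {ε : ℝ}
    (hε : 0 < ε) {ν : Measure (Eucl d)} {C : ℝ≥0∞} (hC : C ≠ ∞) (hν : BallGrowth n C ν) {p : ℝ}
    (hp : 1 < p) {F : Eucl d → ℝ≥0∞} (hF : AEMeasurable F ν) (hFp : ∫⁻ y, F y ^ p ∂ν ≠ ∞)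
    (x : Eucl d) :
    ∫⁻ y, ‖truncKernel k ε x y‖ₑ * F y ∂ν ≠ ∞ := by
  obtain ⟨p', hpp⟩ : ∃ p', p.HolderConjugate p' := ⟨_, Real.HolderConjugate.conjExponent hp⟩
  have hp' : 1 < p' := hpp.symm.lt
  set a : ℝ := n * (p' - 1) with ha
  have ha0 : 0 < a := mul_pos (by exact_mod_cast hn) (by linarith)
  have hm : Measurable fun y => ‖truncKernel k ε x y‖ₑ :=
    ((hk.measurable_truncKernel hε).comp measurable_prodMk_left).enorm
  refine ((ENNReal.lintegral_mul_le_Lp_mul_Lq ν hpp.symm hm.aemeasurable hF).trans_lt ?_).ne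
  refine ENNReal.mul_lt_top (ENNReal.rpow_lt_top_of_nonneg (by have := hpp.symm.pos; positivity) ?_)
    (ENNReal.rpow_lt_top_of_nonneg (by have := hpp.pos; positivity) hFp)
  have hb : ∀ y, ‖truncKernel k ε x y‖ₑ ^ p' ≤
      ENNReal.ofReal (c ^ p' / ε ^ a) * tailKernel n a (fun _ => ε) y x := by
    intro y
    have hc := hk.c_pos
    unfold truncKernel
    split_ifs with h
    · have hne : x ≠ y := by rintro rfl; simp at h; linarith
      have hd : 0 < ‖x - y‖ := hε.trans h
      rw [tailKernel, if_pos (by rw [dist_comm, dist_eq_norm]; exact h.le), dist_comm,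
        dist_eq_norm, ← ENNReal.ofReal_mul (by positivity), ← ofReal_norm,
        ENNReal.ofReal_rpow_of_nonneg (norm_nonneg _) hpp.symm.nonneg]
      refine ENNReal.ofReal_le_ofReal ?_
      refine (Real.rpow_le_rpow (norm_nonneg _) (hk.size x y hne) hpp.symm.nonneg).trans
        (le_of_eq ?_)
      rw [Real.div_rpow hc.le (by positivity), ← Real.rpow_natCast, ← Real.rpow_mul hd.le,
        show (n : ℝ) * p' = n + a by rw [ha]; ring]
      have : 0 < ε ^ a := by positivity
      field_simp
    · simp [hpp.symm.pos]
  refine ((lintegral_mono hb).trans_lt ?_).ne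
  rw [lintegral_const_mul' _ _ ENNReal.ofReal_ne_top]
  refine ENNReal.mul_lt_top ENNReal.ofReal_lt_top ?_
  have := lintegral_tailKernel_le n (μ := ν) ha0 (r := fun _ => ε) (y := x) hε
    (h := fun _ => 1) measurable_const
  simp only [mul_one] at this
  exact this.trans_lt (ENNReal.mul_lt_top (tailConst_ne_top n ha0).lt_top
    ((radialMax_one_le hν x).trans_lt hC.lt_top))

theorem CZBound.integrable_truncKernel_mul (hk : CZBound n c η k) (hn : 1 ≤ n) {ε : ℝ}
    (hε : 0 < ε) {ν : Measure (Eucl d)} {C : ℝ≥0∞} (hC : C ≠ ∞) (hν : BallGrowth n C ν) {p : ℝ}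
    (hp : 1 < p) {f : Eucl d → ℂ} (hf : AEStronglyMeasurable f ν) (hfp : ∫⁻ y, ‖f y‖ₑ ^ p ∂ν ≠ ∞)
    (x : Eucl d) : Integrable (fun y => truncKernel k ε x y * f y) ν := by
  refine ⟨((hk.measurable_truncKernel hε).comp
    measurable_prodMk_left).aestronglyMeasurable.mul hf, ?_⟩
  rw [hasFiniteIntegral_iff_enorm]
  simp_rw [enorm_mul]
  exact (hk.lintegral_truncKernel_mul_ne_top hn hε hC hν hp hf.enorm hfp x).lt_top

/-- Difference of truncated kernels at two points far from `x`. -/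
theorem CZBound.enorm_truncKernel_sub_le (hk : CZBound n c η k) {ε : ℝ} (hε : 0 < ε)
    {r : Eucl d → ℝ} {x y z : Eucl d} (hr : 0 < r y) (hxy : 2 * r y ≤ ‖x - y‖)
    (hz : ‖z - y‖ ≤ r y) :
    ‖truncKernel k ε x y - truncKernel k ε x z‖ₑ ≤
      ENNReal.ofReal c * (tailKernel n η r x y + annulusKernel n ε x y) := by
  have hc := hk.c_pos
  have hd : 0 < ‖x - y‖ := by linarith
  have hxy' : x ≠ y := by rintro rfl; simp at hd
  have tri1 : ‖x - y‖ ≤ ‖x - z‖ + ‖z - y‖ := norm_sub_le_norm_sub_add_norm_sub _ _ _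
  by_cases h1 : ε < ‖x - y‖ <;> by_cases h2 : ε < ‖x - z‖
  -- With both points outside the truncation, the smoothness of `k` in its second variable gives the
  -- tail term.
  · rw [mul_add]
    refine le_trans ?_ le_self_add
    rw [tailKernel, if_pos (by rw [dist_eq_norm]; linarith), ← ENNReal.ofReal_mul hc.le,
      ← ofReal_norm]
    refine ENNReal.ofReal_le_ofReal ?_
    simp only [truncKernel, h1, h2, if_true]
    have := hk.smooth y z x hxy'.symm (by rw [norm_sub_rev y z, norm_sub_rev y x]; linarith)
    have h3 : ‖y - z‖ ≤ r y := by rwa [norm_sub_rev]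
    calc ‖k x y - k x z‖ ≤ c * ‖y - z‖ ^ η / ‖y - x‖ ^ ((n : ℝ) + η) := by
          linarith [norm_nonneg (k y x - k z x)]
      _ ≤ c * r y ^ η / ‖y - x‖ ^ ((n : ℝ) + η) := by
          have := hk.η_pos.le
          gcongr
      _ = _ := by rw [dist_eq_norm, norm_sub_rev]; ring
  -- Here `|x - y| ≤ |x - z| + |z - y| ≤ ε + |x - y| / 2`, so `|x - y| ≤ 2ε` and the annulus kernel
  -- is active.
  · have h4 : truncKernel k ε x z = 0 := by simp [truncKernel, h2]
    rw [h4, sub_zero, mul_add]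
    refine (hk.enorm_truncKernel_le hε x y).trans ?_
    rw [annulusKernel, if_pos (by rw [dist_eq_norm]; linarith)]
    exact le_add_self
  · have h4 : truncKernel k ε x y = 0 := by simp [truncKernel, h1]
    rw [h4, zero_sub, enorm_neg, mul_add]
    refine (hk.enorm_truncKernel_le hε x z).trans ?_
    rw [annulusKernel, if_pos (by rw [dist_eq_norm]; linarith)]
    exact le_add_self
  · simp [truncKernel, h1, h2]

/-- The function `z ↦ ∫ φ(y,z) f(y) dν(y)`. -/
noncomputable def transfer (φ : Eucl d → Eucl d → ℝ) (ν : Measure (Eucl d)) (f : Eucl d → ℂ)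
    (z : Eucl d) : ℂ :=
  ∫ y, (φ y z : ℂ) * f y ∂ν

/-- The error made by replacing the unit mass at `y` by `φ(y,·) σ`. -/
noncomputable def transferError (k : Eucl d → Eucl d → ℂ) (φ : Eucl d → Eucl d → ℝ)
    (σ : Measure (Eucl d)) (ε : ℝ) (x y : Eucl d) : ℂ :=
  truncKernel k ε x y - ∫ z, truncKernel k ε x z * φ y z ∂σ

theorem enorm_transfer_le {φ : Eucl d → Eucl d → ℝ} (hφ0 : ∀ y z, 0 ≤ φ y z)
    (ν : Measure (Eucl d)) (f : Eucl d → ℂ) (z : Eucl d) :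
    ‖transfer φ ν f z‖ₑ ≤ ∫⁻ y, ENNReal.ofReal (φ y z) * ‖f y‖ₑ ∂ν := by
  refine (enorm_integral_le_lintegral_enorm _).trans (lintegral_mono fun y => ?_)
  rw [enorm_mul, ← ofReal_norm ((φ y z : ℝ) : ℂ), Complex.norm_real, Real.norm_of_nonneg
    (hφ0 y z)]

theorem measurable_transfer {φ : Eucl d → Eucl d → ℝ} (hφm : Measurable (Function.uncurry φ))
    (ν : Measure (Eucl d)) [SFinite ν] {f : Eucl d → ℂ} (hf : Measurable f) :
    Measurable (transfer φ ν f) := by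
  have : StronglyMeasurable (Function.uncurry fun (z y : Eucl d) => (φ y z : ℂ) * f y) := by
    have h1 : Measurable fun q : Eucl d × Eucl d => φ q.2 q.1 := hφm.comp measurable_swap
    have h2 : Measurable fun q : Eucl d × Eucl d => (φ q.2 q.1 : ℂ) := by fun_prop
    exact (h2.mul (hf.comp measurable_snd)).stronglyMeasurable
  exact this.integral_prod_right.measurable

/-- Fubini: applying `T_σ` to the transferred function is integrating, against `f ν`, the operator
applied to each `φ(y, ·) σ`. The `L^p` bound on the absolute transfer supplies the joint
integrability. -/
theorem CZBound.truncOp_sub_truncOp_transfer (hk : CZBound n c η k) (hn : 1 ≤ n) {ε : ℝ}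
    (hε : 0 < ε) {σ ν : Measure (Eucl d)} [SFinite σ] [SFinite ν] {C₁ C₂ : ℝ≥0∞} (hC₁ : C₁ ≠ ∞)
    (hC₂ : C₂ ≠ ∞) (hσ : BallGrowth n C₁ σ) (hν : BallGrowth n C₂ ν) {p : ℝ} (hp : 1 < p)
    {φ : Eucl d → Eucl d → ℝ} (hφm : Measurable (Function.uncurry φ)) (hφ0 : ∀ y z, 0 ≤ φ y z)
    {f : Eucl d → ℂ} (hf : Measurable f) (hfp : ∫⁻ y, ‖f y‖ₑ ^ p ∂ν ≠ ∞)
    (hF : ∫⁻ z, (∫⁻ y, ENNReal.ofReal (φ y z) * ‖f y‖ₑ ∂ν) ^ p ∂σ ≠ ∞) (x : Eucl d) :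
    truncOp k ν ε f x - truncOp k σ ε (transfer φ ν f) x =
      ∫ y, transferError k φ σ ε x y * f y ∂ν := by
  have hkm : Measurable fun z => truncKernel k ε x z :=
    (hk.measurable_truncKernel hε).of_uncurry_left
  have hφm' : Measurable fun q : Eucl d × Eucl d => φ q.2 q.1 := hφm.comp measurable_swap
  have hFm : Measurable fun z => ∫⁻ y, ENNReal.ofReal (φ y z) * ‖f y‖ₑ ∂ν :=
    Measurable.lintegral_prod_right' (f := fun q : Eucl d × Eucl d =>
      ENNReal.ofReal (φ q.2 q.1) * ‖f q.2‖ₑ) (by fun_prop)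
  have hprod : Integrable (fun q : Eucl d × Eucl d =>
      truncKernel k ε x q.1 * ((φ q.2 q.1 : ℂ) * f q.2))
      (σ.prod ν) := by
    have hmeas : Measurable fun q : Eucl d × Eucl d =>
        truncKernel k ε x q.1 * ((φ q.2 q.1 : ℂ) * f q.2) := by
      have h2 : Measurable fun q : Eucl d × Eucl d => (φ q.2 q.1 : ℂ) := by fun_prop
      exact (hkm.comp measurable_fst).mul (h2.mul (hf.comp measurable_snd))
    refine ⟨hmeas.aestronglyMeasurable, ?_⟩
    rw [hasFiniteIntegral_iff_enorm, lintegral_prod _ hmeas.enorm.aemeasurable]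
    refine lt_of_eq_of_lt ?_ (hk.lintegral_truncKernel_mul_ne_top hn hε hC₁ hσ hp
      hFm.aemeasurable hF x).lt_top
    refine lintegral_congr fun z => ?_
    rw [← lintegral_const_mul]
    · refine lintegral_congr fun y => ?_
      rw [enorm_mul, enorm_mul, ← ofReal_norm (φ y z : ℂ), Complex.norm_real,
        Real.norm_of_nonneg (hφ0 y z)]
    · have : Measurable fun y => φ y z := hφm.comp measurable_prodMk_right
      fun_prop
  have h1 : truncOp k σ ε (transfer φ ν f) x =
      ∫ y, (∫ z, truncKernel k ε x z * φ y z ∂σ) * f y ∂ν := by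
    rw [truncOp_eq_integral]
    simp only [transfer]
    simp_rw [← integral_const_mul]
    rw [integral_integral_swap hprod]
    refine integral_congr_ae (ae_of_all _ fun y => ?_)
    simp only
    rw [← integral_mul_const]
    refine integral_congr_ae (ae_of_all _ fun z => ?_)
    simp only
    ring
  have h2 : Integrable (fun y => (∫ z, truncKernel k ε x z * φ y z ∂σ) * f y) ν := by
    refine hprod.integral_prod_right.congr (ae_of_all _ fun y => ?_)
    simp only
    rw [← integral_mul_const]
    refine integral_congr_ae (ae_of_all _ fun z => ?_)
    simp only
    ring
  rw [h1, truncOp_eq_integral, ← integral_sub (hk.integrable_truncKernel_mul hn hε hC₂ hν hp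
    hf.aestronglyMeasurable hfp x) h2]
  refine integral_congr_ae (ae_of_all _ fun y => ?_)
  simp only [transferError]
  ring

/-- As `φ(y, ·) σ` has total mass one, the error is the average of `k_ε(x, y) - k_ε(x, z)` over
points `z` within `r(y)` of `y`, and the pointwise difference bound applies to each. -/
theorem CZBound.enorm_transferError_le (hk : CZBound n c η k) {ε : ℝ} (hε : 0 < ε)
    {σ : Measure (Eucl d)} {φ : Eucl d → Eucl d → ℝ} (hφm : Measurable (Function.uncurry φ))
    (hφ0 : ∀ y z, 0 ≤ φ y z) {r : Eucl d → ℝ} {x y : Eucl d} (hr : 0 < r y)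
    (hxy : 2 * r y ≤ ‖x - y‖) (hφ1 : ∫⁻ z, ENNReal.ofReal (φ y z) ∂σ = 1)
    (hφr : ∀ z, φ y z ≠ 0 → ‖z - y‖ ≤ r y) :
    ‖transferError k φ σ ε x y‖ₑ ≤
      ENNReal.ofReal c * (tailKernel n η r x y + annulusKernel n ε x y) := by
  have hkm : Measurable fun z => truncKernel k ε x z :=
    (hk.measurable_truncKernel hε).of_uncurry_left
  have hφy : Measurable fun z => φ y z := hφm.comp measurable_prodMk_left
  have hi : Integrable (fun z => φ y z) σ := by
    refine ⟨hφy.aestronglyMeasurable, ?_⟩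
    rw [hasFiniteIntegral_iff_ofReal (ae_of_all _ (hφ0 y)), hφ1]
    exact ENNReal.one_lt_top
  have hint : ∫ z, (φ y z : ℂ) ∂σ = 1 := by
    rw [integral_complex_ofReal, integral_eq_lintegral_of_nonneg_ae (ae_of_all _ (hφ0 y))
      hφy.aestronglyMeasurable, hφ1]
    simp
  have hi' : Integrable (fun z => (φ y z : ℂ)) σ := hi.ofReal
  have hi2 : Integrable (fun z => truncKernel k ε x z * φ y z) σ := by
    refine hi'.bdd_mul (c := (ENNReal.ofReal c * (ENNReal.ofReal ε ^ n)⁻¹).toReal)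
      hkm.aestronglyMeasurable (ae_of_all _ fun z => ?_)
    rw [← toReal_enorm]
    refine ENNReal.toReal_mono ?_ (hk.enorm_truncKernel_le hε x z)
    exact ENNReal.mul_ne_top ENNReal.ofReal_ne_top
      (ENNReal.inv_ne_top.2 (ofReal_pow_ne_zero hε n))
  have heq : transferError k φ σ ε x y =
      ∫ z, (truncKernel k ε x y - truncKernel k ε x z) * φ y z ∂σ := by
    simp_rw [sub_mul]
    rw [integral_sub (hi'.const_mul _) hi2, integral_const_mul, hint, mul_one, transferError]
  rw [heq]
  refine (enorm_integral_le_lintegral_enorm _).trans ?_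
  set M := ENNReal.ofReal c * (tailKernel n η r x y + annulusKernel n ε x y)
  calc ∫⁻ z, ‖(truncKernel k ε x y - truncKernel k ε x z) * φ y z‖ₑ ∂σ
      ≤ ∫⁻ z, M * ENNReal.ofReal (φ y z) ∂σ := by
        refine lintegral_mono fun z => ?_
        rcases eq_or_ne (φ y z) 0 with h | h
        · simp [h]
        · rw [enorm_mul, ← ofReal_norm ((φ y z : ℝ) : ℂ), Complex.norm_real,
            Real.norm_of_nonneg (hφ0 y z)]
          gcongr
          exact hk.enorm_truncKernel_sub_le hε hr hxy (hφr z h)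
    _ = M := by rw [lintegral_const_mul _ (by fun_prop), hφ1, mul_one]

theorem CZBound.measurable_truncOp (hk : CZBound n c η k) {ε : ℝ} (hε : 0 < ε)
    (ν : Measure (Eucl d)) [SFinite ν] {f : Eucl d → ℂ} (hf : Measurable f) : Measurable (truncOp k ν ε f) := by
  have : StronglyMeasurable (Function.uncurry fun (x y : Eucl d) => truncKernel k ε x y * f y) :=
    ((hk.measurable_truncKernel hε).mul (hf.comp measurable_snd)).stronglyMeasurable
  have h := (this.integral_prod_right (ν := ν)).measurable
  rwa [show (fun x => ∫ y, truncKernel k ε x y * f y ∂ν) = truncOp k ν ε f from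
    funext fun x => (truncOp_eq_integral k ν ε f x).symm] at h

theorem truncOp_congr_ae {ν : Measure (Eucl d)} {f g : Eucl d → ℂ} (h : f =ᵐ[ν] g)
    (k : Eucl d → Eucl d → ℂ) (ε : ℝ) (x : Eucl d) :
    truncOp k ν ε f x = truncOp k ν ε g x := by
  rw [truncOp_eq_integral, truncOp_eq_integral]
  refine integral_congr_ae ?_
  filter_upwards [h] with y hy
  rw [hy]

end CalderonZygmund

/-! ### Tools for the Calderón-Zygmund decomposition -/

section WeakType

variable {d : ℕ} {n : ℕ} {c η : ℝ} {k : Eucl d → Eucl d → ℂ}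

/-- The normalized indicator function of the ball `closedBall (ctr y) (rad y)`. -/
noncomputable def ballAverage (σ : Measure (Eucl d)) (ctr : Eucl d → Eucl d) (rad : Eucl d → ℝ)
    (y z : Eucl d) : ℝ :=
  open Classical in
  if dist z (ctr y) ≤ rad y then (σ (closedBall (ctr y) (rad y))).toReal⁻¹ else 0

theorem ballAverage_nonneg (σ : Measure (Eucl d)) (ctr : Eucl d → Eucl d) (rad : Eucl d → ℝ)
    (y z : Eucl d) : 0 ≤ ballAverage σ ctr rad y z := by
  unfold ballAverage
  split_ifs <;> positivity

theorem measurable_ballAverage (σ : Measure (Eucl d)) [SFinite σ] {ctr : Eucl d → Eucl d}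
    {rad : Eucl d → ℝ} (hc : Measurable ctr) (hr : Measurable rad) :
    Measurable (Function.uncurry (ballAverage σ ctr rad)) := by
  have hs : MeasurableSet {q : Eucl d × Eucl d | dist q.2 (ctr q.1) ≤ rad q.1} :=
    measurableSet_le (by fun_prop) (by fun_prop)
  have hV : Measurable fun y => σ (closedBall (ctr y) (rad y)) :=
    measurable_measure_prodMk_left (ν := σ) hs
  refine Measurable.ite hs ?_ measurable_const
  exact ((hV.comp measurable_fst).ennreal_toReal).inv

theorem dist_le_of_ballAverage_ne_zero {σ : Measure (Eucl d)} {ctr : Eucl d → Eucl d}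
    {rad : Eucl d → ℝ} {y z : Eucl d} (h : ballAverage σ ctr rad y z ≠ 0) :
    dist z (ctr y) ≤ rad y := by
  by_contra hc
  exact h (by simp [ballAverage, hc])

theorem ofReal_ballAverage_le {σ : Measure (Eucl d)} {ctr : Eucl d → Eucl d}
    {rad : Eucl d → ℝ} {y : Eucl d} (h0 : σ (closedBall (ctr y) (rad y)) ≠ 0)
    (hT : σ (closedBall (ctr y) (rad y)) ≠ ∞) (z : Eucl d) :
    ENNReal.ofReal (ballAverage σ ctr rad y z) = (closedBall (ctr y) (rad y)).indicator
      (fun _ => (σ (closedBall (ctr y) (rad y)))⁻¹) z := by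
  unfold ballAverage
  split_ifs with h
  · rw [indicator_of_mem (by exact h), ENNReal.ofReal_inv_of_pos (ENNReal.toReal_pos h0 hT),
      ENNReal.ofReal_toReal hT]
  · rw [indicator_of_notMem (by exact h), ENNReal.ofReal_zero]

theorem lintegral_ballAverage {σ : Measure (Eucl d)} {ctr : Eucl d → Eucl d}
    {rad : Eucl d → ℝ} {y : Eucl d} (h0 : σ (closedBall (ctr y) (rad y)) ≠ 0)
    (hT : σ (closedBall (ctr y) (rad y)) ≠ ∞) :
    ∫⁻ z, ENNReal.ofReal (ballAverage σ ctr rad y z) ∂σ = 1 := by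
  simp_rw [ofReal_ballAverage_le h0 hT]
  rw [lintegral_indicator_const measurableSet_closedBall, ENNReal.inv_mul_cancel h0 hT]

/-- The enlarged balls overlap, so each point of their union is assigned to the first ball
containing it in a fixed enumeration. This partitions the bad set measurably while keeping the
centres and radii of the selected balls. -/
theorem exists_measurable_center {u : Set (Eucl d)} (hu : u.Countable) {ρ : Eucl d → ℝ}
    (hρ : ∀ a ∈ u, 0 < ρ a) :
    ∃ (ctr : Eucl d → Eucl d) (rad : Eucl d → ℝ), Measurable ctr ∧ Measurable rad ∧
      (∀ y, 0 < rad y) ∧ ∀ y ∈ ⋃ a ∈ u, closedBall a (5 * ρ a),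
        ctr y ∈ u ∧ rad y = ρ (ctr y) ∧ y ∈ closedBall (ctr y) (5 * rad y) := by
  classical
  rcases u.eq_empty_or_nonempty with rfl | hne
  · exact ⟨fun _ => 0, fun _ => 1, measurable_const, measurable_const, fun _ => one_pos,
      fun y hy => by simp at hy⟩
  obtain ⟨e, he⟩ := hu.exists_eq_range hne
  have hmem : ∀ i, e i ∈ u := fun i => he ▸ mem_range_self i
  set Ω := ⋃ a ∈ u, closedBall a (5 * ρ a) with hΩ
  have hΩm : MeasurableSet Ω := MeasurableSet.biUnion hu fun a _ => measurableSet_closedBall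
  -- Adding the complement of `Ω` makes the predicate satisfiable at every point, so that `Nat.find`
  -- is a total measurable function.
  set P : Eucl d → ℕ → Prop := fun y i => y ∈ Ωᶜ ∪ closedBall (e i) (5 * ρ (e i)) with hP
  have hex : ∀ y, ∃ i, P y i := by
    intro y
    by_cases hy : y ∈ Ω
    · obtain ⟨a, ha, hya⟩ := mem_iUnion₂.1 hy
      obtain ⟨i, rfl⟩ := he ▸ ha
      exact ⟨i, Or.inr hya⟩
    · exact ⟨0, Or.inl hy⟩
  have hfind : Measurable fun y => Nat.find (hex y) :=
    measurable_find hex fun i => hΩm.compl.union measurableSet_closedBall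
  refine ⟨fun y => e (Nat.find (hex y)), fun y => ρ (e (Nat.find (hex y))),
    (measurable_of_countable e).comp hfind, (measurable_of_countable fun i => ρ (e i)).comp hfind,
    fun y => hρ _ (hmem _), fun y hy => ⟨hmem _, rfl, ?_⟩⟩
  exact (Nat.find_spec (hex y)).resolve_left fun h => h hy

theorem IsStrongBounded.exists_lintegral_le {σ μ : Measure (Eucl d)} {q : ℝ} (hq : 0 < q)
    (hT : IsStrongBounded k σ μ q) : ∃ C : ℝ≥0∞, C ≠ ∞ ∧ ∀ ε : ℝ, 0 < ε → ∀ g : Eucl d → ℂ,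
      Measurable g → ∫⁻ y, ‖g y‖ₑ ^ q ∂σ ≠ ∞ →
        ∫⁻ x, ‖truncOp k σ ε g x‖ₑ ^ q ∂μ ≤ C * ∫⁻ y, ‖g y‖ₑ ^ q ∂σ := by
  obtain ⟨C, hC⟩ := hT
  have hq0 : ENNReal.ofReal q ≠ 0 := by simpa using hq
  refine ⟨(C : ℝ≥0∞) ^ q, ENNReal.rpow_ne_top_of_nonneg hq.le ENNReal.coe_ne_top,
    fun ε hε g hg hfin => ?_⟩
  have hmem : MemLp g (ENNReal.ofReal q) σ := by
    refine ⟨hg.aestronglyMeasurable, ?_⟩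
    rw [eLpNorm_lt_top_iff_lintegral_rpow_enorm_lt_top hq0 ENNReal.ofReal_ne_top,
      ENNReal.toReal_ofReal hq.le]
    exact hfin.lt_top
  have h := ENNReal.rpow_le_rpow (hC ε hε g hmem) hq.le
  rw [ENNReal.mul_rpow_of_nonneg _ _ hq.le] at h
  simp only [eLpNorm_eq_lintegral_rpow_enorm_toReal hq0 ENNReal.ofReal_ne_top,
    ENNReal.toReal_ofReal hq.le, ← ENNReal.rpow_mul, one_div_mul_cancel hq.ne',
    ENNReal.rpow_one] at h
  exact h

/-- A density bound at almost every point where all small balls have small density. -/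
theorem ae_le_of_density_le {σ : Measure (Eucl d)} [IsLocallyFiniteMeasure σ] {a : ℝ≥0∞}
    (hlow : ∀ x ∈ σ.support, ∀ r : ℝ, 0 < r → ENNReal.ofReal r ≤ ediam σ.support →
      a * ENNReal.ofReal r ^ n ≤ σ (closedBall x r)) (hdiam : ediam σ.support ≠ 0)
    {w : Eucl d → ℝ≥0∞} (hw : Measurable w) (hfin : ∫⁻ y, w y ∂σ ≠ ∞) (τ : ℝ≥0∞) :
    ∀ᵐ x ∂σ, (∀ r, 0 < r → ∫⁻ y in closedBall x r, w y ∂σ ≤ τ * ENNReal.ofReal r ^ n) →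
      w x ≤ τ / a := by
  have hsupp : ∀ᵐ x ∂σ, x ∈ σ.support := Measure.support_mem_ae
  filter_upwards [hsupp, (Besicovitch.vitaliFamily σ).ae_tendsto_lintegral_div hw.aemeasurable
    hfin] with x hx hlim hden
  have h1 := hlim.comp (Besicovitch.tendsto_filterAt σ x)
  refine le_of_tendsto h1 ?_
  -- The lower mass bound is available only up to the diameter of the support; a positive diameter
  -- suffices, as only small radii matter for differentiation.
  have h2 : ∀ᶠ r : ℝ in 𝓝[>] 0, ENNReal.ofReal r ≤ ediam σ.support := by
    have h3 : Tendsto (fun r : ℝ => ENNReal.ofReal r) (𝓝[>] 0) (𝓝 0) := by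
      have := (ENNReal.continuous_ofReal.tendsto 0).mono_left
        (nhdsWithin_le_nhds (s := Ioi (0 : ℝ)))
      simpa using this
    exact (h3.eventually (gt_mem_nhds (pos_iff_ne_zero.2 hdiam))).mono fun r hr => hr.le
  filter_upwards [h2, self_mem_nhdsWithin] with r hr hr0
  have hr0 : 0 < r := hr0
  have hb0 := ofReal_pow_ne_zero hr0 n
  have hbt := ofReal_pow_ne_top r n
  simp only [Function.comp]
  calc (∫⁻ y in closedBall x r, w y ∂σ) / σ (closedBall x r)
      ≤ (τ * ENNReal.ofReal r ^ n) / (a * ENNReal.ofReal r ^ n) :=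
        ENNReal.div_le_div (hden r hr0) (hlow x hx r hr0 hr)
    _ = τ / a := ENNReal.mul_div_mul_right _ _ hb0 hbt

theorem lintegral_enorm_le_holder {σ : Measure (Eucl d)} {p p' : ℝ} (hpp : p.HolderConjugate p')
    {g : Eucl d → ℂ} (hg : Measurable g) (s : Set (Eucl d)) :
    ∫⁻ y in s, ‖g y‖ₑ ∂σ ≤ (∫⁻ y in s, ‖g y‖ₑ ^ p ∂σ) ^ (1 / p) * σ s ^ (1 / p') := by
  have := ENNReal.lintegral_mul_le_Lp_mul_Lq (σ.restrict s) hpp (f := fun y => ‖g y‖ₑ)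
    (g := fun _ => 1) hg.enorm.aemeasurable aemeasurable_const
  simpa using this

theorem rpow_mul_rpow_conj {p p' : ℝ} (hpp : p.HolderConjugate p') (x : ℝ≥0∞) :
    x ^ (1 / p) * x ^ (1 / p') = x := by
  rw [← ENNReal.rpow_add_of_nonneg _ _ hpp.one_div_nonneg hpp.symm.one_div_nonneg,
    hpp.one_div_add_one_div]
  simp

/-- Hölder's inequality on a ball on which `∫ |g|^p ≤ t^p s` and whose mass is at most `C s`. -/
theorem lintegral_enorm_le_of_density {σ : Measure (Eucl d)} {p p' : ℝ}
    (hpp : p.HolderConjugate p') {g : Eucl d → ℂ} (hg : Measurable g) {A : Set (Eucl d)}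
    {t s C : ℝ≥0∞} (h1 : ∫⁻ y in A, ‖g y‖ₑ ^ p ∂σ ≤ t ^ p * s) (h2 : σ A ≤ C * s) :
    ∫⁻ y in A, ‖g y‖ₑ ∂σ ≤ C ^ (1 / p') * t * s := by
  refine (lintegral_enorm_le_holder hpp hg A).trans ?_
  calc _ ≤ (t ^ p * s) ^ (1 / p) * (C * s) ^ (1 / p') := by
        have := hpp.one_div_nonneg
        have := hpp.symm.one_div_nonneg
        gcongr
    _ = C ^ (1 / p') * t * (s ^ (1 / p) * s ^ (1 / p')) := by
        rw [ENNReal.mul_rpow_of_nonneg _ _ hpp.one_div_nonneg,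
          ENNReal.mul_rpow_of_nonneg _ _ hpp.symm.one_div_nonneg, ← ENNReal.rpow_mul,
          mul_one_div_cancel hpp.ne_zero, ENNReal.rpow_one]
        ring
    _ = _ := by rw [rpow_mul_rpow_conj hpp]

end WeakType

/-! ### From strong type `(q,q)` to weak type `(p,p)` on the surface measure -/

section WeakTypeOfStrong

variable {d : ℕ} {n : ℕ} {c η : ℝ} {k : Eucl d → Eucl d → ℂ}

theorem enorm_truncOp_le (k : Eucl d → Eucl d → ℂ) (ν : Measure (Eucl d)) (ε : ℝ) (f : Eucl d → ℂ)
    (x : Eucl d) : ‖truncOp k ν ε f x‖ₑ ≤ ∫⁻ y, ‖truncKernel k ε x y‖ₑ * ‖f y‖ₑ ∂ν := by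
  rw [truncOp_eq_integral]
  refine (enorm_integral_le_lintegral_enorm _).trans (le_of_eq ?_)
  simp_rw [enorm_mul]

/-- The weak type estimate at heights for which the support of `σ` is small. -/
theorem CZBound.measure_lt_truncOp_le_of_small_support (hk : CZBound n c η k) (hn : 1 ≤ n)
    {σ μ : Measure (Eucl d)} {C₁ C₂ : ℝ≥0∞}
    (hσ : BallGrowth n C₁ σ) (hμ : BallGrowth n C₂ μ) {p p' : ℝ} (hpp : p.HolderConjugate p')
    {D : ℝ} (hD : 0 < D) (hdiam : ediam σ.support ≤ ENNReal.ofReal D) {ε : ℝ} (hε : 0 < ε)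
    {g : Eucl d → ℂ} (hg : Measurable g) (hfin : ∫⁻ y, ‖g y‖ₑ ^ p ∂σ ≠ ∞) {t : ℝ≥0∞}
    (ht : t ≠ 0) (ht' : t ≠ ∞)
    (hsmall : ENNReal.ofReal D ^ n ≤ (∫⁻ y, ‖g y‖ₑ ^ p ∂σ) / t ^ p) :
    μ {x | ENNReal.ofReal c * C₁ ^ (1 / p') * t < ‖truncOp k σ ε g x‖ₑ} ≤
      C₂ * 2 ^ n * ((∫⁻ y, ‖g y‖ₑ ^ p ∂σ) / t ^ p) := by
  set N := ∫⁻ y, ‖g y‖ₑ ^ p ∂σ with hN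
  have htp0 : t ^ p ≠ 0 := (ENNReal.rpow_pos (pos_iff_ne_zero.2 ht) ht').ne'
  have htpt : t ^ p ≠ ∞ := ENNReal.rpow_ne_top_of_nonneg hpp.nonneg ht'
  set M := N / t ^ p with hM
  have hMt : M ≠ ∞ := ENNReal.div_ne_top hfin htp0
  rcases σ.support.eq_empty_or_nonempty with hS | ⟨z, hz⟩
  · rw [Measure.support_eq_empty_iff] at hS
    subst hS
    simp [truncOp]
  -- `R` is chosen so that `R^n = N / t^p`. Outside the ball of radius `2R` the kernel is at most `c
  -- R^(-n)`, which keeps the operator below the threshold; the ball itself has `μ`-mass of the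
  -- desired order.
  set R : ℝ := M.toReal ^ (n : ℝ)⁻¹ with hR
  have hR0 : 0 ≤ R := by positivity
  have hRM : ENNReal.ofReal R ^ n = M := by
    rw [← ENNReal.ofReal_pow hR0, hR, Real.rpow_inv_natCast_pow (by positivity) (by omega),
      ENNReal.ofReal_toReal hMt]
  have hDR : D ≤ R := by
    rw [← hRM, ← ENNReal.ofReal_pow hD.le, ← ENNReal.ofReal_pow hR0,
      ENNReal.ofReal_le_ofReal_iff (by positivity)] at hsmall
    exact (pow_le_pow_iff_left₀ hD.le hR0 (by omega)).1 hsmall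
  have hRpos : 0 < R := hD.trans_le hDR
  have hM0 : M ≠ 0 := by rw [← hRM]; exact ofReal_pow_ne_zero hRpos n
  have hball : σ.support ⊆ closedBall z D := by
    intro y hy
    have := (edist_le_ediam_of_mem hy hz).trans hdiam
    rw [edist_dist, ENNReal.ofReal_le_ofReal_iff hD.le] at this
    exact this
  have hmass : σ univ ≤ C₁ * M := by
    calc σ univ ≤ σ (closedBall z D) + σ σ.supportᶜ := by
          refine (measure_mono fun y _ => ?_).trans (measure_union_le _ _)
          by_cases hy : y ∈ σ.support
          · exact Or.inl (hball hy)
          · exact Or.inr hy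
      _ ≤ C₁ * M := by
          rw [Measure.measure_compl_support, add_zero, ← hRM]
          refine (hσ z D hD).trans ?_
          gcongr
  have hL1 : ∫⁻ y, ‖g y‖ₑ ∂σ ≤ C₁ ^ (1 / p') * t * M := by
    have h := lintegral_enorm_le_of_density hpp hg (σ := σ) (A := univ) (t := t) (s := M)
      (C := C₁) (by rw [Measure.restrict_univ, hM, ENNReal.mul_div_cancel htp0 htpt]) hmass
    simpa using h
  have hsub : {x | ENNReal.ofReal c * C₁ ^ (1 / p') * t < ‖truncOp k σ ε g x‖ₑ} ⊆
      closedBall z (2 * R) := by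
    intro x hx
    rw [mem_ofPred_eq] at hx
    by_contra hxb
    refine absurd hx (not_lt.2 ?_)
    have hxz : 2 * R < dist x z := not_le.1 hxb
    refine (enorm_truncOp_le k σ ε g x).trans ?_
    calc ∫⁻ y, ‖truncKernel k ε x y‖ₑ * ‖g y‖ₑ ∂σ ≤
        ∫⁻ y, ENNReal.ofReal c * M⁻¹ * ‖g y‖ₑ ∂σ := by
          refine lintegral_mono_ae ?_
          have hsupp : ∀ᵐ x ∂σ, x ∈ σ.support := Measure.support_mem_ae
          filter_upwards [hsupp] with y hy
          gcongr
          refine (hk.enorm_truncKernel_le_inv hε x y).trans ?_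
          have h1 : R ≤ ‖x - y‖ := by
            have h2 := dist_triangle x y z
            have h3 : dist y z ≤ D := hball hy
            rw [← dist_eq_norm]; linarith
          rw [← hRM, ← ENNReal.ofReal_pow hR0, ← ENNReal.ofReal_inv_of_pos (by positivity),
            ← ENNReal.ofReal_mul hk.c_pos.le, ← div_eq_mul_inv]
          have := hk.c_pos.le
          gcongr
      _ ≤ ENNReal.ofReal c * M⁻¹ * (C₁ ^ (1 / p') * t * M) := by
          rw [lintegral_const_mul _ hg.enorm]
          gcongr
      _ = ENNReal.ofReal c * C₁ ^ (1 / p') * t * (M⁻¹ * M) := by ring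
      _ = _ := by rw [ENNReal.inv_mul_cancel hM0 hMt, mul_one]
  refine (measure_mono hsub).trans ((hμ z (2 * R) (by positivity)).trans (le_of_eq ?_))
  rw [ENNReal.ofReal_mul zero_le_two, mul_pow, hRM]
  simp [mul_assoc]

/-- A bounded part at height `t` gains `t^(q-p)` over its `p`-th power integral. This turns the
strong `q` bound into an estimate of order `t^(-p)`. -/
theorem lintegral_enorm_rpow_le_of_le {σ : Measure (Eucl d)} {p q : ℝ} (hp : 0 < p) (hpq : p < q)
    {g : Eucl d → ℂ} {A : ℝ≥0∞} (h : ∀ᵐ y ∂σ, ‖g y‖ₑ ≤ A) (hA : A ≠ ∞) :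
    ∫⁻ y, ‖g y‖ₑ ^ q ∂σ ≤ A ^ (q - p) * ∫⁻ y, ‖g y‖ₑ ^ p ∂σ := by
  rw [← lintegral_const_mul' _ _ (ENNReal.rpow_ne_top_of_nonneg (by linarith) hA)]
  refine lintegral_mono_ae ?_
  filter_upwards [h] with y hy
  conv_lhs => rw [show q = (q - p) + p by ring]
  rw [ENNReal.rpow_add_of_nonneg _ _ (by linarith) hp.le]
  have : 0 ≤ q - p := by linarith
  gcongr

/-- The function obtained by averaging the bad part over the selected balls is bounded and lives
on the union of the enlarged balls. -/
theorem lintegral_ballAverage_mul_le {σ : Measure (Eucl d)} {u : Set (Eucl d)}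
    (hu : u.Countable) {ρ : Eucl d → ℝ} (hρ : ∀ a ∈ u, 0 < ρ a)
    (hdis : u.PairwiseDisjoint (fun a => closedBall a (ρ a))) {ctr : Eucl d → Eucl d}
    {rad : Eucl d → ℝ} (hctr : ∀ y ∈ ⋃ a ∈ u, closedBall a (5 * ρ a),
        ctr y ∈ u ∧ rad y = ρ (ctr y) ∧ y ∈ closedBall (ctr y) (5 * rad y))
    (h0 : ∀ a ∈ u, σ (closedBall a (ρ a)) ≠ 0) (hT : ∀ a ∈ u, σ (closedBall a (ρ a)) ≠ ∞)
    {w : Eucl d → ℝ≥0∞} {A : ℝ≥0∞}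
    (hA : ∀ a ∈ u, (σ (closedBall a (ρ a)))⁻¹ * ∫⁻ y in closedBall a (5 * ρ a), w y ∂σ ≤ A)
    (z : Eucl d) :
    ∫⁻ y in ⋃ a ∈ u, closedBall a (5 * ρ a), ENNReal.ofReal (ballAverage σ ctr rad y z) * w y ∂σ ≤
      (⋃ a ∈ u, closedBall a (5 * ρ a)).indicator (fun _ => A) z := by
  set Ω := ⋃ a ∈ u, closedBall a (5 * ρ a) with hΩ
  have hΩm : MeasurableSet Ω := MeasurableSet.biUnion hu fun a _ => measurableSet_closedBall
  by_cases hex : ∃ y ∈ Ω, ballAverage σ ctr rad y z ≠ 0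
  · obtain ⟨y₀, hy₀, hne⟩ := hex
    obtain ⟨hau, hrad, -⟩ := hctr y₀ hy₀
    set a := ctr y₀
    have hza : z ∈ closedBall a (ρ a) := hrad ▸ dist_le_of_ballAverage_ne_zero hne
    have hzΩ : z ∈ Ω := mem_biUnion hau
      (closedBall_subset_closedBall (by linarith [hρ a hau]) hza)
    rw [indicator_of_mem hzΩ]
    refine le_trans ?_ (hA a hau)
    calc ∫⁻ y in Ω, ENNReal.ofReal (ballAverage σ ctr rad y z) * w y ∂σ
        ≤ ∫⁻ y in Ω, (closedBall a (5 * ρ a)).indicator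
          (fun y => (σ (closedBall a (ρ a)))⁻¹ * w y) y ∂σ := by
          refine setLIntegral_mono' hΩm fun y hy => ?_
          obtain ⟨hyu, hyrad, hymem⟩ := hctr y hy
          rcases eq_or_ne (ballAverage σ ctr rad y z) 0 with h | h
          · simp [h]
          · have hz : z ∈ closedBall (ctr y) (ρ (ctr y)) :=
              hyrad ▸ dist_le_of_ballAverage_ne_zero h
            -- The unenlarged balls are disjoint, so all points `y` that send mass to `z` share one
            -- centre; hence no sum over overlapping balls arises.
            have hya : ctr y = a := by
              by_contra hcon
              exact disjoint_left.1 (hdis hyu hau hcon) hz hza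
            rw [ofReal_ballAverage_le (by rw [hyrad]; exact h0 _ hyu)
              (by rw [hyrad]; exact hT _ hyu)]
            rw [hyrad, hya] at hymem
            rw [hyrad, hya, indicator_of_mem hza, indicator_of_mem hymem]
      _ ≤ ∫⁻ y, (closedBall a (5 * ρ a)).indicator
          (fun y => (σ (closedBall a (ρ a)))⁻¹ * w y) y ∂σ := setLIntegral_le_lintegral _ _
      _ = _ := by
          rw [lintegral_indicator measurableSet_closedBall,
            lintegral_const_mul' _ _ (ENNReal.inv_ne_top.2 (h0 a hau))]
  · push Not at hex
    have : ∫⁻ y in Ω, ENNReal.ofReal (ballAverage σ ctr rad y z) * w y ∂σ = ∫⁻ y in Ω, 0 ∂σ :=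
      setLIntegral_congr_fun hΩm fun y hy => by simp [hex y hy]
    rw [this]
    simp

/-- The weak type estimate at heights for which the selected balls are smaller than the support:
the Calderón-Zygmund decomposition. -/
theorem CZBound.measure_lt_truncOp_le_of_large_support (hk : CZBound n c η k) (hn : 1 ≤ n)
    {σ μ : Measure (Eucl d)} [IsLocallyFiniteMeasure σ] [IsLocallyFiniteMeasure μ]
    {C₁ C₂ a : ℝ≥0∞} (hC₁ : C₁ ≠ ∞) (hC₂ : C₂ ≠ ∞)
    (hσ : BallGrowth n C₁ σ) (hμ : BallGrowth n C₂ μ) (ha : a ≠ 0) (ha' : a ≠ ∞)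
    (hlow : ∀ x ∈ σ.support, ∀ r : ℝ, 0 < r → ENNReal.ofReal r ≤ ediam σ.support →
      a * ENNReal.ofReal r ^ n ≤ σ (closedBall x r)) (hdiam : ediam σ.support ≠ 0)
    {p q : ℝ} (hp : 1 < p) (hpq : p < q) (hT : IsStrongBounded k σ μ q) :
    ∃ A B : ℝ≥0∞, A ≠ ∞ ∧ B ≠ ∞ ∧ ∀ ε : ℝ, 0 < ε → ∀ g : Eucl d → ℂ, Measurable g →
      ∫⁻ y, ‖g y‖ₑ ^ p ∂σ ≠ ∞ → ∀ t : ℝ≥0∞, t ≠ 0 → t ≠ ∞ →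
      (∀ r : ℝ, 0 < r → t ^ p * ENNReal.ofReal r ^ n < ∫⁻ y, ‖g y‖ₑ ^ p ∂σ →
        ENNReal.ofReal r ≤ ediam σ.support) →
      μ {x | A * t < ‖truncOp k σ ε g x‖ₑ} ≤ B * ((∫⁻ y, ‖g y‖ₑ ^ p ∂σ) / t ^ p) := by
  obtain ⟨p', hpp⟩ : ∃ p', p.HolderConjugate p' := ⟨_, Real.HolderConjugate.conjExponent hp⟩
  have hp0 : 0 < p := hpp.pos
  have hq0 : 0 < q := hp0.trans hpq
  have hqp : 0 ≤ q - p := by linarith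
  obtain ⟨CT, hCT, hstrong⟩ := hT.exists_lintegral_le hq0
  obtain ⟨B₁, hB₁, htail⟩ := exists_measure_lt_tailKernel_le hn hC₂ hC₁ hμ hσ hp hk.η_pos
  obtain ⟨B₂, hB₂, hann⟩ := exists_measure_lt_annulusKernel_le hn hC₂ hC₁ hμ hσ hp
  -- `A₁ t` bounds `g` outside the bad set, by differentiation; `A₂ t` bounds the averaged bad part,
  -- by Hölder on the selected balls.
  set A₁ : ℝ≥0∞ := (a⁻¹) ^ (1 / p) with hA₁
  have hA₁t : A₁ ≠ ∞ := ENNReal.rpow_ne_top_of_nonneg hpp.one_div_nonneg (ENNReal.inv_ne_top.2 ha)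
  set A₂ : ℝ≥0∞ := a⁻¹ * (C₁ ^ (1 / p') * 5 ^ n) with hA₂
  have hA₂t : A₂ ≠ ∞ := by
    have := ENNReal.rpow_ne_top_of_nonneg hpp.symm.one_div_nonneg hC₁
    have := ENNReal.inv_ne_top.2 ha
    finiteness
  refine ⟨2 + 2 * ENNReal.ofReal c, C₂ * ENNReal.ofReal 17 ^ n + CT * A₁ ^ (q - p) +
    CT * (A₂ ^ q * (C₁ * ENNReal.ofReal 5 ^ n)) + B₁ + B₂, by finiteness, ?_, ?_⟩
  · have := ENNReal.rpow_ne_top_of_nonneg hqp hA₁t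
    have := ENNReal.rpow_ne_top_of_nonneg hq0.le hA₂t
    finiteness
  intro ε hε g hg hfin t ht ht' hrad_le
  set N := ∫⁻ y, ‖g y‖ₑ ^ p ∂σ with hN
  have htp0 : t ^ p ≠ 0 := (ENNReal.rpow_pos (pos_iff_ne_zero.2 ht) ht').ne'
  have htpt : t ^ p ≠ ∞ := ENNReal.rpow_ne_top_of_nonneg hpp.nonneg ht'
  have htq0 : t ^ q ≠ 0 := (ENNReal.rpow_pos (pos_iff_ne_zero.2 ht) ht').ne'
  have htqt : t ^ q ≠ ∞ := ENNReal.rpow_ne_top_of_nonneg hq0.le ht'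
  have htqp : t ^ q = t ^ (q - p) * t ^ p := by
    rw [← ENNReal.rpow_add_of_nonneg _ _ hqp hp0.le]; congr 1; ring
  have htqp0 : t ^ (q - p) ≠ 0 := (ENNReal.rpow_pos (pos_iff_ne_zero.2 ht) ht').ne'
  have htqpt : t ^ (q - p) ≠ ∞ := ENNReal.rpow_ne_top_of_nonneg hqp ht'
  have hgp : Measurable fun y => ‖g y‖ₑ ^ p := hg.enorm.pow_const p
  set m := σ.withDensity fun y => ‖g y‖ₑ ^ p with hm
  have hm_apply : ∀ x r, m (closedBall x r) = ∫⁻ y in closedBall x r, ‖g y‖ₑ ^ p ∂σ :=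
    fun x r => withDensity_apply _ measurableSet_closedBall
  have hm_univ : m univ = N := by
    rw [hm, withDensity_apply _ MeasurableSet.univ, Measure.restrict_univ]
  obtain ⟨u, ρ, huS, huc, hρ, hden, hdis, hgood, hcov⟩ := exists_disjoint_balls_of_density hn m
    (by rwa [hm_univ]) htp0 htpt σ.support
  obtain ⟨ctr, rad, hctrm, hradm, hrad0, hctr⟩ := exists_measurable_center huc hρ
  set Ω := ⋃ a ∈ u, closedBall a (5 * ρ a) with hΩ
  have hΩm : MeasurableSet Ω := MeasurableSet.biUnion huc fun a _ => measurableSet_closedBall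
  have hmassΩ : σ Ω ≤ C₁ * ENNReal.ofReal 5 ^ n * (N / t ^ p) := by
    rw [← hm_univ]
    exact measure_enlarged_balls_le htp0 htpt hσ huc hρ hden hdis (by norm_num)
  have hmassμ : μ (⋃ a ∈ u, closedBall a (17 * ρ a)) ≤
      C₂ * ENNReal.ofReal 17 ^ n * (N / t ^ p) := by
    rw [← hm_univ]
    exact measure_enlarged_balls_le htp0 htpt hμ huc hρ hden hdis (by norm_num)
  have hσlow : ∀ b ∈ u, a * ENNReal.ofReal (ρ b) ^ n ≤ σ (closedBall b (ρ b)) := by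
    intro b hb
    refine hlow b (huS hb) _ (hρ b hb) (hrad_le _ (hρ b hb) ((hden b hb).trans_le ?_))
    rw [← hm_univ]; exact measure_mono (subset_univ _)
  have hσ0 : ∀ b ∈ u, σ (closedBall b (ρ b)) ≠ 0 := fun b hb h => by
    have := hσlow b hb
    rw [h, nonpos_iff_eq_zero, mul_eq_zero] at this
    exact this.elim ha (ofReal_pow_ne_zero (hρ b hb) n)
  have hσt : ∀ b ∈ u, σ (closedBall b (ρ b)) ≠ ∞ := fun b hb =>
    ((hσ b _ (hρ b hb)).trans_lt (ENNReal.mul_lt_top hC₁.lt_top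
      (ofReal_pow_ne_top _ n).lt_top)).ne
  set φ := ballAverage σ ctr rad with hφ
  have hφm : Measurable (Function.uncurry φ) := measurable_ballAverage σ hctrm hradm
  have hφ0 : ∀ y z, 0 ≤ φ y z := ballAverage_nonneg σ ctr rad
  set ν := σ.restrict Ω with hν
  have hνg : BallGrowth n C₁ ν := fun x r hr => (Measure.restrict_apply_le _ _).trans (hσ x r hr)
  have hF : ∀ z, ∫⁻ y, ENNReal.ofReal (φ y z) * ‖g y‖ₑ ∂ν ≤ Ω.indicator (fun _ => A₂ * t) z := by
    refine lintegral_ballAverage_mul_le huc hρ hdis hctr hσ0 hσt fun b hb => ?_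
    have hb5 : 0 < 5 * ρ b := by linarith [hρ b hb]
    have hbρ0 := ofReal_pow_ne_zero (hρ b hb) n
    have hbρt := ofReal_pow_ne_top (ρ b) n
    -- Since `5ρ ≥ 2ρ`, the selection guarantees density at most `t^p` on the enlarged ball.
    have h1 := lintegral_enorm_le_of_density hpp hg (σ := σ) (A := closedBall b (5 * ρ b))
      (t := t) (s := ENNReal.ofReal (5 * ρ b) ^ n) (C := C₁)
      (by rw [← hm_apply]; exact hgood b hb _ (by linarith [hρ b hb])) (hσ b _ hb5)
    calc _ ≤ (a * ENNReal.ofReal (ρ b) ^ n)⁻¹ *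
        (C₁ ^ (1 / p') * t * ENNReal.ofReal (5 * ρ b) ^ n) := by
          gcongr
          exact hσlow b hb
      _ = a⁻¹ * (C₁ ^ (1 / p') * 5 ^ n) * t *
          ((ENNReal.ofReal (ρ b) ^ n)⁻¹ * ENNReal.ofReal (ρ b) ^ n) := by
          rw [ENNReal.mul_inv (Or.inl ha) (Or.inl ha'), ENNReal.ofReal_mul (by norm_num), mul_pow]
          simp
          ring
      _ = _ := by rw [ENNReal.inv_mul_cancel hbρ0 hbρt, mul_one]
  have hFs : ∀ s : ℝ, 0 < s →
      ∫⁻ z, (∫⁻ y, ENNReal.ofReal (φ y z) * ‖g y‖ₑ ∂ν) ^ s ∂σ ≤ (A₂ * t) ^ s * σ Ω := by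
    intro s hs
    rw [← lintegral_indicator_const hΩm]
    refine lintegral_mono fun z => (ENNReal.rpow_le_rpow (hF z) hs.le).trans (le_of_eq ?_)
    by_cases hz : z ∈ Ω <;> simp [hz, hs]
  have hσΩt : σ Ω ≠ ∞ := (hmassΩ.trans_lt (by
    have := ENNReal.div_ne_top hfin htp0
    finiteness)).ne
  have hFfin : ∀ s : ℝ, 0 < s →
      ∫⁻ z, (∫⁻ y, ENNReal.ofReal (φ y z) * ‖g y‖ₑ ∂ν) ^ s ∂σ ≠ ∞ := fun s hs =>
    ((hFs s hs).trans_lt (ENNReal.mul_lt_top (ENNReal.rpow_lt_top_of_nonneg hs.le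
      (ENNReal.mul_ne_top hA₂t ht')) hσΩt.lt_top)).ne
  set γ₁ := Ωᶜ.indicator g with hγ₁
  set γ₂ := transfer φ ν g with hγ₂
  have hγ₁m : Measurable γ₁ := hg.indicator hΩm.compl
  have hγ₂m : Measurable γ₂ := measurable_transfer hφm ν hg
  have weakq : ∀ γ : Eucl d → ℂ, Measurable γ → ∀ C : ℝ≥0∞, C ≠ ∞ →
      ∫⁻ y, ‖γ y‖ₑ ^ q ∂σ ≤ C * (t ^ (q - p) * N) →
      μ {x | t < ‖truncOp k σ ε γ x‖ₑ} ≤ CT * C * (N / t ^ p) := by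
    intro γ hγ C hC hle
    have h1 := hstrong ε hε γ hγ ((hle.trans_lt (by finiteness)).ne)
    refine (measure_lt_le_of_lintegral_rpow_le hq0 (hk.measurable_truncOp hε σ hγ).enorm
      (h1.trans (mul_le_mul_right hle _)) ht ht').trans (le_of_eq ?_)
    rw [htqp, ← mul_assoc, mul_comm (t ^ (q - p)) N, ← mul_assoc, mul_comm (t ^ (q - p)),
      ENNReal.mul_div_mul_right _ _ htqp0 htqpt, mul_div_assoc]
  have hmeas1 : μ {x | t < ‖truncOp k σ ε γ₁ x‖ₑ} ≤ CT * A₁ ^ (q - p) * (N / t ^ p) := by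
    refine weakq γ₁ hγ₁m _ (ENNReal.rpow_ne_top_of_nonneg hqp hA₁t) ?_
    have hae : ∀ᵐ y ∂σ, ‖γ₁ y‖ₑ ≤ A₁ * t := by
      have hsupp : ∀ᵐ x ∂σ, x ∈ σ.support := Measure.support_mem_ae
      filter_upwards [hsupp, ae_le_of_density_le hlow hdiam hgp hfin (t ^ p)]
        with y hy hyd
      by_cases hyΩ : y ∈ Ω
      · simp [hγ₁, hyΩ]
      · have h1 : ‖g y‖ₑ ^ p ≤ t ^ p / a := by
          refine hyd fun r hr => ?_
          by_contra! hcon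
          rw [← hm_apply] at hcon
          obtain ⟨b, hb, hyb⟩ := hcov y hy ⟨r, hr, hcon⟩
          exact hyΩ (mem_biUnion hb hyb)
        rw [hγ₁, indicator_of_mem (by exact hyΩ)]
        have h2 := ENNReal.rpow_le_rpow h1 hpp.one_div_nonneg
        rw [ENNReal.div_eq_inv_mul, ENNReal.mul_rpow_of_nonneg _ _ hpp.one_div_nonneg,
          ← ENNReal.rpow_mul, ← ENNReal.rpow_mul, mul_one_div_cancel hpp.ne_zero,
          ENNReal.rpow_one, ENNReal.rpow_one] at h2
        exact h2
    refine (lintegral_enorm_rpow_le_of_le hp0 hpq hae (ENNReal.mul_ne_top hA₁t ht')).trans ?_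
    rw [ENNReal.mul_rpow_of_nonneg _ _ hqp, mul_assoc]
    gcongr
    refine lintegral_mono fun y => ?_
    by_cases hy : y ∈ Ω <;> simp [hγ₁, hy, hp0]
  have hmeas2 : μ {x | t < ‖truncOp k σ ε γ₂ x‖ₑ} ≤
      CT * (A₂ ^ q * (C₁ * ENNReal.ofReal 5 ^ n)) * (N / t ^ p) := by
    refine weakq γ₂ hγ₂m _ ?_ ?_
    · have := ENNReal.rpow_ne_top_of_nonneg hq0.le hA₂t
      finiteness
    calc ∫⁻ y, ‖γ₂ y‖ₑ ^ q ∂σ ≤ (A₂ * t) ^ q * σ Ω := by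
          refine (lintegral_mono fun z => ?_).trans (hFs q hq0)
          exact ENNReal.rpow_le_rpow (enorm_transfer_le hφ0 ν g z) hq0.le
      _ ≤ (A₂ * t) ^ q * (C₁ * ENNReal.ofReal 5 ^ n * (N / t ^ p)) := by gcongr
      _ = A₂ ^ q * (C₁ * ENNReal.ofReal 5 ^ n) * (t ^ (q - p) * (t ^ p * (N / t ^ p))) := by
          rw [ENNReal.mul_rpow_of_nonneg _ _ hq0.le, htqp]; ring
      _ = _ := by rw [ENNReal.mul_div_cancel htp0 htpt]
  -- For `y` assigned to a ball of radius `ρ`, the averaging points lie within `5ρ + ρ = 6ρ` of `y`.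
  -- Outside the `17ρ` ball, `|x - y| ≥ 17ρ - 5ρ = 2 · 6ρ`, exactly the separation that the
  -- smoothness estimate needs.
  set r : Eucl d → ℝ := fun y => 6 * rad y with hr
  have hrm : Measurable r := by fun_prop
  have hr0 : ∀ y, 0 < r y := fun y => by have := hrad0 y; simp only [hr]; positivity
  set G₁ : Eucl d → ℝ≥0∞ := fun x => ∫⁻ y, tailKernel n η r x y * ‖g y‖ₑ ∂σ with hG₁
  set G₂ : Eucl d → ℝ≥0∞ := fun x => ∫⁻ y, annulusKernel n ε x y * ‖g y‖ₑ ∂σ with hG₂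
  have hmeas3 : μ {x | t < G₁ x} ≤ B₁ * (N / t ^ p) :=
    (htail r hrm (ae_of_all _ hr0) _ hg.enorm t ht ht').trans (le_of_eq (mul_div_assoc _ _ _))
  have hmeas4 : μ {x | t < G₂ x} ≤ B₂ * (N / t ^ p) :=
    (hann ε hε _ hg.enorm t ht ht').trans (le_of_eq (mul_div_assoc _ _ _))
  have hpoint : ∀ x ∉ ⋃ a ∈ u, closedBall a (17 * ρ a), ‖truncOp k σ ε g x‖ₑ ≤
      ‖truncOp k σ ε γ₁ x‖ₑ + ‖truncOp k σ ε γ₂ x‖ₑ + ENNReal.ofReal c * (G₁ x + G₂ x) := by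
    intro x hx
    have hint := hk.integrable_truncKernel_mul hn hε hC₁ hσ hp hg.aestronglyMeasurable hfin x
    have hsplit : truncOp k σ ε g x = truncOp k ν ε g x + truncOp k σ ε γ₁ x := by
      rw [truncOp_eq_integral, truncOp_eq_integral, truncOp_eq_integral,
        ← integral_add_compl hΩm hint, ← integral_indicator hΩm.compl]
      congr 2
      ext y
      by_cases hy : y ∈ Ω <;> simp [hγ₁, hy]
    have herr := hk.truncOp_sub_truncOp_transfer hn hε hC₁ hC₁ hσ hνg hp hφm hφ0 hg
      (((setLIntegral_le_lintegral _ _).trans_lt hfin.lt_top).ne) (hFfin p hp0) x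
    have hE : ‖∫ y, transferError k φ σ ε x y * g y ∂ν‖ₑ ≤ ENNReal.ofReal c * (G₁ x + G₂ x) := by
      calc ‖∫ y, transferError k φ σ ε x y * g y ∂ν‖ₑ
          ≤ ∫⁻ y, ‖transferError k φ σ ε x y * g y‖ₑ ∂ν := enorm_integral_le_lintegral_enorm _
        _ ≤ ∫⁻ y in Ω, ENNReal.ofReal c * (tailKernel n η r x y * ‖g y‖ₑ +
              annulusKernel n ε x y * ‖g y‖ₑ) ∂σ := by
            refine setLIntegral_mono' hΩm fun y hy => ?_
            obtain ⟨hyu, hyrad, hymem⟩ := hctr y hy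
            rw [enorm_mul, ← add_mul, ← mul_assoc]
            gcongr
            have hyd : dist y (ctr y) ≤ 5 * rad y := hymem
            refine hk.enorm_transferError_le hε hφm hφ0 (hr0 y) ?_ ?_ ?_
            · have h1 : 17 * ρ (ctr y) < dist x (ctr y) := by
                by_contra! hcon
                exact hx (mem_biUnion hyu hcon)
              have h2 := dist_triangle x y (ctr y)
              rw [← dist_eq_norm]
              simp only [hr]
              rw [← hyrad] at h1
              linarith
            · exact lintegral_ballAverage (by rw [hyrad]; exact hσ0 _ hyu)
                (by rw [hyrad]; exact hσt _ hyu)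
            · intro z hz
              have h1 := dist_le_of_ballAverage_ne_zero hz
              have h2 := dist_triangle_right z y (ctr y)
              rw [← dist_eq_norm]
              simp only [hr]
              linarith
        _ ≤ ∫⁻ y, ENNReal.ofReal c * (tailKernel n η r x y * ‖g y‖ₑ +
              annulusKernel n ε x y * ‖g y‖ₑ) ∂σ := setLIntegral_le_lintegral _ _
        _ = _ := by
            rw [lintegral_const_mul' _ _ ENNReal.ofReal_ne_top, lintegral_add_left]
            exact (measurable_tailKernel n η hrm).of_uncurry_left.mul hg.enorm
    calc ‖truncOp k σ ε g x‖ₑ = ‖truncOp k σ ε γ₁ x + truncOp k σ ε γ₂ x +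
        ∫ y, transferError k φ σ ε x y * g y ∂ν‖ₑ := by
          rw [← herr, hsplit]; congr 1; ring
      _ ≤ _ := by
          refine (enorm_add_le _ _).trans ?_
          gcongr
          exact enorm_add_le _ _
  have hcover : {x | (2 + 2 * ENNReal.ofReal c) * t < ‖truncOp k σ ε g x‖ₑ} ⊆
      (⋃ a ∈ u, closedBall a (17 * ρ a)) ∪ {x | t < ‖truncOp k σ ε γ₁ x‖ₑ} ∪
        {x | t < ‖truncOp k σ ε γ₂ x‖ₑ} ∪ {x | t < G₁ x} ∪ {x | t < G₂ x} := by
    intro x hx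
    by_contra hcon
    simp only [mem_union, mem_ofPred_eq, not_or, not_lt] at hcon
    obtain ⟨⟨⟨⟨h1, h2⟩, h3⟩, h4⟩, h5⟩ := hcon
    refine absurd hx (not_lt.2 ((hpoint x h1).trans ?_))
    calc _ ≤ t + t + ENNReal.ofReal c * (t + t) := by gcongr
      _ = _ := by ring
  refine (measure_mono hcover).trans ?_
  refine (measure_union_le _ _).trans ((add_le_add_left (measure_union_le _ _) _).trans
    ((add_le_add_left (add_le_add_left (measure_union_le _ _) _) _).trans
    ((add_le_add_left (add_le_add_left (add_le_add_left (measure_union_le _ _) _) _) _).trans ?_)))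
  rw [add_mul, add_mul, add_mul, add_mul]
  gcongr

/-- A strong `(q,q)` bound implies weak `(p,p)` bounds for `1 < p < q`. -/
theorem CZBound.exists_measure_lt_truncOp_le (hk : CZBound n c η k) (hn : 1 ≤ n)
    {σ μ : Measure (Eucl d)} [IsLocallyFiniteMeasure σ] [IsLocallyFiniteMeasure μ]
    {C₁ C₂ a : ℝ≥0∞} (hC₁ : C₁ ≠ ∞) (hC₂ : C₂ ≠ ∞)
    (hσ : BallGrowth n C₁ σ) (hμ : BallGrowth n C₂ μ) (ha : a ≠ 0) (ha' : a ≠ ∞)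
    (hlow : ∀ x ∈ σ.support, ∀ r : ℝ, 0 < r → ENNReal.ofReal r ≤ ediam σ.support →
      a * ENNReal.ofReal r ^ n ≤ σ (closedBall x r)) (hdiam : ediam σ.support ≠ 0)
    {p q : ℝ} (hp : 1 < p) (hpq : p < q) (hT : IsStrongBounded k σ μ q) :
    ∃ B : ℝ≥0∞, B ≠ ∞ ∧ ∀ ε : ℝ, 0 < ε → ∀ g : Eucl d → ℂ, Measurable g →
      ∀ t : ℝ≥0∞, t ≠ 0 → t ≠ ∞ →
      μ {x | t < ‖truncOp k σ ε g x‖ₑ} ≤ B * ((∫⁻ y, ‖g y‖ₑ ^ p ∂σ) / t ^ p) := by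
  obtain ⟨A, B, hA, hB, hlarge⟩ := hk.measure_lt_truncOp_le_of_large_support hn hC₁ hC₂ hσ hμ ha
    ha' hlow hdiam hp hpq hT
  obtain ⟨p', hpp⟩ : ∃ p', p.HolderConjugate p' := ⟨_, Real.HolderConjugate.conjExponent hp⟩
  have hp0 : 0 < p := hpp.pos
  set A' : ℝ≥0∞ := max A (ENNReal.ofReal c * C₁ ^ (1 / p')) + 1 with hA'
  have hA't : A' ≠ ∞ := by
    have := ENNReal.rpow_ne_top_of_nonneg hpp.symm.one_div_nonneg hC₁
    exact ENNReal.add_ne_top.2 ⟨max_ne_top hA (by finiteness), by simp⟩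
  have hA'0 : A' ≠ 0 := by simp [hA']
  have hA'p0 : A' ^ p ≠ 0 := (ENNReal.rpow_pos (pos_iff_ne_zero.2 hA'0) hA't).ne'
  have hA'pt : A' ^ p ≠ ∞ := ENNReal.rpow_ne_top_of_nonneg hp0.le hA't
  set B' : ℝ≥0∞ := max B (C₂ * 2 ^ n) + 1 with hB'
  have hB't : B' ≠ ∞ := ENNReal.add_ne_top.2 ⟨max_ne_top hB (by finiteness), by simp⟩
  refine ⟨B' * A' ^ p, ENNReal.mul_ne_top hB't hA'pt, fun ε hε g hg s hs hs' => ?_⟩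
  set N := ∫⁻ y, ‖g y‖ₑ ^ p ∂σ with hN
  rcases eq_or_ne N ∞ with hfin | hfin
  · rw [hfin, ENNReal.top_div_of_ne_top (ENNReal.rpow_ne_top_of_nonneg hp0.le hs'),
      ENNReal.mul_top (mul_ne_zero (by simp [hB']) hA'p0)]
    exact le_top
  set t := s / A' with ht_def
  have hst : A' * t = s := ENNReal.mul_div_cancel hA'0 hA't
  have ht : t ≠ 0 := fun h => hs (by rw [← hst, h, mul_zero])
  have ht' : t ≠ ∞ := ENNReal.div_ne_top hs' hA'0
  have htp0 : t ^ p ≠ 0 := (ENNReal.rpow_pos (pos_iff_ne_zero.2 ht) ht').ne'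
  have htpt : t ^ p ≠ ∞ := ENNReal.rpow_ne_top_of_nonneg hpp.nonneg ht'
  have hrescale : B' * A' ^ p * (N / s ^ p) = B' * (N / t ^ p) := by
    rw [← hst, ENNReal.mul_rpow_of_nonneg _ _ hp0.le, mul_assoc, ← mul_div_assoc,
      ENNReal.mul_div_mul_left _ _ hA'p0 hA'pt]
  rw [hrescale, ← hst]
  -- The decomposition needs the selected radii not to exceed the diameter of the support. Such a
  -- radius satisfies `r^n < N / t^p`, so this can fail only when the diameter is finite with `n`-th
  -- power at most `N / t^p`, the small-support case.
  by_cases hcase : ediam σ.support ≠ ∞ ∧ ediam σ.support ^ n ≤ N / t ^ p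
  · obtain ⟨hDt, hle⟩ := hcase
    have hD : 0 < (ediam σ.support).toReal := ENNReal.toReal_pos hdiam hDt
    have hDe : ENNReal.ofReal (ediam σ.support).toReal = ediam σ.support :=
      ENNReal.ofReal_toReal hDt
    have h1 := hk.measure_lt_truncOp_le_of_small_support hn hσ hμ hpp hD hDe.ge hε hg hfin ht ht'
      (by rw [hDe]; exact hle)
    refine (measure_mono fun x hx => ?_).trans (h1.trans ?_)
    · rw [mem_ofPred_eq] at hx ⊢
      refine lt_of_le_of_lt ?_ hx
      gcongr
      exact (le_max_right _ _).trans le_self_add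
    · gcongr
      exact (le_max_right _ _).trans le_self_add
  · have h1 := hlarge ε hε g hg hfin t ht ht' ?_
    · refine (measure_mono fun x hx => ?_).trans (h1.trans ?_)
      · rw [mem_ofPred_eq] at hx ⊢
        refine lt_of_le_of_lt ?_ hx
        gcongr
        exact (le_max_left _ _).trans le_self_add
      · gcongr
        exact (le_max_left _ _).trans le_self_add
    · intro r hr hlt
      by_cases hDt : ediam σ.support = ∞
      · rw [hDt]; exact le_top
      · have h2 : N / t ^ p < ediam σ.support ^ n := by
          by_contra! h; exact hcase ⟨hDt, h⟩
        have h3 : ENNReal.ofReal r ^ n < N / t ^ p := by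
          rw [ENNReal.lt_div_iff_mul_lt (Or.inl htp0) (Or.inl htpt), mul_comm]
          exact hlt
        by_contra! hcon
        exact absurd (h3.trans h2) (not_lt.2 (pow_le_pow_left' hcon.le n))

end WeakTypeOfStrong

/-! ### Separation of the domain from its exterior by the support -/

section Geometry

variable {d : ℕ}

theorem inter_frontier_nonempty_of_isPreconnected {T s : Set (Eucl d)} (hT : IsPreconnected T)
    (h1 : (T ∩ s).Nonempty) (h2 : (T ∩ sᶜ).Nonempty) : (T ∩ frontier s).Nonempty := by
  by_contra hcon
  have hnf : ∀ x ∈ T, x ∉ frontier s := fun x hx hxf => hcon ⟨x, hx, hxf⟩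
  suffices h : (T ∩ (interior s ∩ (closure s)ᶜ)).Nonempty by
    obtain ⟨x, -, hx1, hx2⟩ := h
    exact hx2 (subset_closure (interior_subset hx1))
  refine hT _ _ isOpen_interior isClosed_closure.isOpen_compl ?_ ?_ ?_
  · intro x hx
    by_cases hxc : x ∈ closure s
    · exact Or.inl (by_contra fun h => hnf x hx ⟨hxc, h⟩)
    · exact Or.inr hxc
  · obtain ⟨x, hx, hxs⟩ := h1
    exact ⟨x, hx, by_contra fun h => hnf x hx ⟨subset_closure hxs, h⟩⟩
  · obtain ⟨x, hx, hxs⟩ := h2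
    exact ⟨x, hx, fun h => hnf x hx ⟨h, fun hi => hxs (interior_subset hi)⟩⟩

/-- Project orthogonally along `b - a`. For small `v` in the hyperplane, the segment from `a + v ∈
U` to `b + v ∈ V` crosses the frontier inside the ball and collapses to one point of the projection.
The projected frontier thus contains a ball of the hyperplane, and projections do not increase
Hausdorff measure. -/
theorem hausdorffMeasure_inter_frontier_pos {U V : Set (Eucl d)} (hd : 1 ≤ d) (hU : IsOpen U)
    (hV : IsOpen V) (hUV : Disjoint U V) {z : Eucl d} {r : ℝ} (h1 : (U ∩ ball z r).Nonempty)
    (h2 : (V ∩ ball z r).Nonempty) :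
    0 < Measure.hausdorffMeasure ((d - 1 : ℕ) : ℝ) (frontier U ∩ ball z r) := by
  obtain ⟨a, ha⟩ := h1
  obtain ⟨b, hb⟩ := h2
  have hab : b - a ≠ 0 := sub_ne_zero.2 fun h => disjoint_left.1 hUV ha.1 (h ▸ hb.1)
  obtain ⟨δ₁, hδ₁, hs1⟩ := Metric.isOpen_iff.1 (hU.inter isOpen_ball) a ha
  obtain ⟨δ₂, hδ₂, hs2⟩ := Metric.isOpen_iff.1 (hV.inter isOpen_ball) b hb
  set F : Submodule ℝ (Eucl d) := (Submodule.span ℝ {b - a})ᗮ with hF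
  have hfr : Module.finrank ℝ F = d - 1 := by
    have : Module.finrank ℝ (Submodule.span ℝ {b - a}) + Module.finrank ℝ F =
        Module.finrank ℝ (Eucl d) := Submodule.finrank_add_finrank_orthogonal _
    rw [finrank_span_singleton hab, finrank_euclideanSpace_fin] at this
    omega
  set P := F.orthogonalProjectionOnto with hP
  have himg : ball (P a) (min δ₁ δ₂) ⊆ P '' (frontier U ∩ ball z r) := by
    intro w hw
    set v : Eucl d := ((w - P a : F) : Eucl d) with hv
    have hvn : ‖v‖ < min δ₁ δ₂ := by
      rw [hv, Submodule.norm_coe, ← dist_eq_norm]; exact hw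
    have hav : a + v ∈ U ∩ ball z r := hs1 (by
      rw [mem_ball, dist_eq_norm, add_sub_cancel_left]; exact hvn.trans_le (min_le_left _ _))
    have hbv : b + v ∈ V ∩ ball z r := hs2 (by
      rw [mem_ball, dist_eq_norm, add_sub_cancel_left]; exact hvn.trans_le (min_le_right _ _))
    obtain ⟨y, hyseg, hyf⟩ := inter_frontier_nonempty_of_isPreconnected
      (convex_segment (a + v) (b + v)).isPreconnected
      ⟨a + v, left_mem_segment ℝ _ _, hav.1⟩
      ⟨b + v, right_mem_segment ℝ _ _, fun h => disjoint_left.1 hUV h hbv.1⟩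
    refine ⟨y, ⟨hyf, (convex_ball z r).segment_subset hav.2 hbv.2 hyseg⟩, ?_⟩
    rw [segment_eq_image'] at hyseg
    obtain ⟨θ, -, rfl⟩ := hyseg
    have hz : P (b - a) = 0 := by
      refine Submodule.orthogonalProjectionOnto_apply_of_mem_orthogonal ?_
      rw [hF, Submodule.orthogonal_orthogonal]
      exact Submodule.mem_span_singleton_self _
    have hPv : P v = w - P a := Submodule.orthogonalProjectionOnto_mem_subspace_eq_self _
    rw [show b + v - (a + v) = b - a by abel, map_add, map_smul, hz, smul_zero, add_zero, map_add,
      hPv]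
    abel
  have hpos : 0 < Measure.hausdorffMeasure ((d - 1 : ℕ) : ℝ) (ball (P a) (min δ₁ δ₂)) := by
    have hm : (Measure.hausdorffMeasure ((d - 1 : ℕ) : ℝ) : Measure F).IsAddHaarMeasure := by
      rw [← hfr]; infer_instance
    exact isOpen_ball.measure_pos _ ⟨P a, mem_ball_self (lt_min hδ₁ hδ₂)⟩
  refine hpos.trans_le ((measure_mono himg).trans ?_)
  have := (Submodule.lipschitzWith_orthogonalProjectionOnto F).hausdorffMeasure_image_le
    (d := ((d - 1 : ℕ) : ℝ)) (by positivity) (frontier U ∩ ball z r)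
  simpa using this

/-- Regularity speaks only of the support of the surface measure, which can be smaller than the
topological boundary, as for a punctured disc. Boundary points of the exterior are safe: every ball
around them meets both open sides, hence carries positive surface measure. -/
theorem frontier_exterior_subset_support {U : Set (Eucl d)} (hd : 1 ≤ d) (hU : IsOpen U) :
    frontier (closure U)ᶜ ⊆ (hausdorffOn (d - 1) (frontier U)).support := by
  intro z hz
  rw [Measure.mem_support_iff_forall]
  intro W hW
  obtain ⟨r, hr, hrW⟩ := Metric.mem_nhds_iff.1 hW
  have hz1 : z ∈ closure U := by
    have := frontier_subset_closure (frontier_compl (closure U) ▸ hz)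
    rwa [closure_closure] at this
  have hz2 : z ∈ closure (closure U)ᶜ := frontier_subset_closure hz
  have h1 := mem_closure_iff.1 hz1 (ball z r) isOpen_ball (mem_ball_self hr)
  have h2 := mem_closure_iff.1 hz2 (ball z r) isOpen_ball (mem_ball_self hr)
  rw [inter_comm] at h1 h2
  have := hausdorffMeasure_inter_frontier_pos hd hU isClosed_closure.isOpen_compl
    (disjoint_left.2 fun x hx hx' => hx' (subset_closure hx)) h1 h2
  refine lt_of_lt_of_le ?_ (measure_mono hrW)
  rwa [hausdorffOn, Measure.restrict_apply measurableSet_ball, inter_comm]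

theorem support_hausdorffOn_subset (n : ℕ) (U : Set (Eucl d)) :
    (hausdorffOn n (frontier U)).support ⊆ frontier U := by
  intro x hx
  have := (Measure.support_restrict_subset hx).1
  rwa [isClosed_frontier.closure_eq] at this

/-- A preconnected set that meets both sides meets the support of the surface measure. -/
theorem inter_support_nonempty {U T : Set (Eucl d)} (hd : 1 ≤ d) (hU : IsOpen U)
    (hT : IsPreconnected T) (h1 : (T ∩ U).Nonempty) (h2 : (T ∩ (closure U)ᶜ).Nonempty) :
    (T ∩ (hausdorffOn (d - 1) (frontier U)).support).Nonempty := by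
  obtain ⟨x, hxT, hxU⟩ := h1
  obtain ⟨y, hy, hyf⟩ := inter_frontier_nonempty_of_isPreconnected hT h2
    ⟨x, hxT, fun h => h (subset_closure hxU)⟩
  exact ⟨y, hy, frontier_exterior_subset_support hd hU hyf⟩

theorem infDist_support_le_dist {U : Set (Eucl d)} (hd : 1 ≤ d) (hU : IsOpen U) {x y : Eucl d}
    (hx : x ∈ U) (hy : y ∈ (closure U)ᶜ) :
    infDist y (hausdorffOn (d - 1) (frontier U)).support ≤ dist x y := by
  obtain ⟨z, hz, hzS⟩ := inter_support_nonempty hd hU (convex_segment x y).isPreconnected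
    ⟨x, left_mem_segment ℝ _ _, hx⟩ ⟨y, right_mem_segment ℝ _ _, hy⟩
  refine (infDist_le_dist_of_mem hzS).trans ?_
  have := dist_add_dist_of_mem_segment hz
  rw [dist_comm y z]
  linarith [dist_nonneg (x := x) (y := z)]

/-- The support is closed, lies in the closure of `U`, and is nonempty because a segment from `U` to
`y` meets it. Nonemptiness matters since `infDist` to the empty set is zero. -/
theorem infDist_support_pos {U : Set (Eucl d)} (hd : 1 ≤ d) (hU : IsOpen U) (hne : U.Nonempty)
    {y : Eucl d} (hy : y ∈ (closure U)ᶜ) :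
    0 < infDist y (hausdorffOn (d - 1) (frontier U)).support := by
  obtain ⟨x, hx⟩ := hne
  obtain ⟨z, -, hzS⟩ := inter_support_nonempty hd hU (convex_segment x y).isPreconnected
    ⟨x, left_mem_segment ℝ _ _, hx⟩ ⟨y, right_mem_segment ℝ _ _, hy⟩
  refine (Measure.isClosed_support.notMem_iff_infDist_pos ⟨z, hzS⟩).1 fun h => hy ?_
  exact frontier_subset_closure (support_hausdorffOn_subset _ _ h)

/-- Polar coordinates: the set is a continuous image of sphere times half-line, and the sphere is
connected in dimension at least two. -/
theorem isPreconnected_compl_closedBall (hd : 2 ≤ d) (z : Eucl d) {R : ℝ} (hR : 0 ≤ R) :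
    IsPreconnected (closedBall z R)ᶜ := by
  have hrank : 1 < Module.rank ℝ (Eucl d) := by
    rw [← Module.finrank_eq_rank, finrank_euclideanSpace_fin]
    exact_mod_cast hd
  have h1 : IsPreconnected (sphere (0 : Eucl d) 1 ×ˢ Ioi R) :=
    (isPreconnected_sphere hrank 0 1).prod isPreconnected_Ioi
  have h2 := h1.image (fun q : Eucl d × ℝ => z + q.2 • q.1) (by fun_prop)
  convert h2 using 1
  ext x
  simp only [mem_compl_iff, mem_closedBall, not_le, mem_image, mem_prod, mem_sphere_iff_norm,
    sub_zero, mem_Ioi, Prod.exists]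
  constructor
  · intro hx
    have hpos : 0 < ‖x - z‖ := by rw [← dist_eq_norm]; linarith
    refine ⟨‖x - z‖⁻¹ • (x - z), ‖x - z‖, ⟨?_, by rwa [← dist_eq_norm]⟩, ?_⟩
    · rw [norm_smul, norm_inv, norm_norm, inv_mul_cancel₀ hpos.ne']
    · rw [smul_smul, mul_inv_cancel₀ hpos.ne', one_smul]; abel
  · rintro ⟨s, t, ⟨hs, ht⟩, rfl⟩
    rw [dist_eq_norm, add_sub_cancel_left, norm_smul, hs, mul_one]
    exact ht.trans_le (le_abs_self t)

/-- If a point of the exterior is farther from the support than its diameter, then the domain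
is contained in a comparable neighbourhood. -/
theorem dist_le_three_infDist {U : Set (Eucl d)} (hd : 2 ≤ d) (hU : IsOpen U) {x y : Eucl d}
    (hx : x ∈ U) (hy : y ∈ (closure U)ᶜ)
    (hfar : ediam (hausdorffOn (d - 1) (frontier U)).support <
      ENNReal.ofReal (infDist y (hausdorffOn (d - 1) (frontier U)).support)) :
    dist x y ≤ 3 * infDist y (hausdorffOn (d - 1) (frontier U)).support := by
  set S := (hausdorffOn (d - 1) (frontier U)).support with hS
  have hSne : S.Nonempty := by
    obtain ⟨z, -, hzS⟩ := inter_support_nonempty (by omega) hU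
      (convex_segment x y).isPreconnected
      ⟨x, left_mem_segment ℝ _ _, hx⟩ ⟨y, right_mem_segment ℝ _ _, hy⟩
    exact ⟨z, hzS⟩
  obtain ⟨z, hzS, hz⟩ := Measure.isClosed_support.exists_infDist_eq_dist hSne y
  have hDt : ediam S ≠ ∞ := hfar.ne_top
  set D := (ediam S).toReal with hD
  have hDlt : D < infDist y S := (ENNReal.lt_ofReal_iff_toReal_lt hDt).1 hfar
  have hSb : S ⊆ closedBall z D := by
    intro w hw
    have := edist_le_ediam_of_mem hw hzS
    rw [edist_dist, ENNReal.ofReal_le_iff_le_toReal hDt] at this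
    exact this
  -- Otherwise `x` and `y` would both lie in the connected complement of a ball containing the whole
  -- support, and that complement would have to meet the support.
  have hxb : x ∈ closedBall z D := by
    by_contra hxb
    have hyb : y ∉ closedBall z D := by
      rw [mem_closedBall, ← hz]; exact not_le.2 hDlt
    obtain ⟨w, hw, hwS⟩ := inter_support_nonempty (by omega) hU
      (isPreconnected_compl_closedBall hd z ENNReal.toReal_nonneg) ⟨x, hxb, hx⟩ ⟨y, hyb, hy⟩
    exact hw (hSb hwS)
  have h1 : dist x z ≤ D := hxb
  have h2 := dist_triangle_right x y z
  rw [← hz] at h2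
  have h3 : 0 ≤ infDist y S := infDist_nonneg
  linarith

/-! ### Growth and density of the measures -/

theorem HasGrowth.exists_ballGrowth {n : ℕ} {μ : Measure (Eucl d)} (h : HasGrowth n μ) :
    ∃ C : ℝ≥0∞, C ≠ 0 ∧ C ≠ ∞ ∧ BallGrowth n C μ := by
  obtain ⟨c, hc, hg⟩ := h
  refine ⟨ENNReal.ofReal (c * 2 ^ n), by simpa using (by positivity : 0 < c * 2 ^ n),
    ENNReal.ofReal_ne_top, fun x r hr => ?_⟩
  refine (measure_mono (closedBall_subset_ball (by linarith : r < 2 * r))).trans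
    ((hg x (2 * r) (by positivity)).trans (le_of_eq ?_))
  rw [← ENNReal.ofReal_pow hr.le, ← ENNReal.ofReal_mul (by positivity)]
  congr 1; ring

theorem BallGrowth.isLocallyFiniteMeasure {n : ℕ} {C : ℝ≥0∞} (hC : C ≠ ∞)
    {μ : Measure (Eucl d)} (h : BallGrowth n C μ) : IsLocallyFiniteMeasure μ :=
  ⟨fun x => ⟨closedBall x 1, closedBall_mem_nhds x one_pos,
    (h x 1 one_pos).trans_lt (ENNReal.mul_lt_top hC.lt_top (ofReal_pow_ne_top _ _).lt_top)⟩⟩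

/-- Regularity bounds only balls centred on the support with radius at most its diameter. A ball
meeting the support at `w` lies in the ball of radius `3r` about `w`; once `3r` exceeds a finite
diameter, the finite total mass divided by the power of the diameter serves as constant. -/
theorem IsADRegularMeasure.exists_ballGrowth {n : ℕ} {σ : Measure (Eucl d)}
    (h : IsADRegularMeasure n σ) (hdiam : ediam σ.support ≠ 0) :
    ∃ C : ℝ≥0∞, C ≠ ∞ ∧ BallGrowth n C σ := by
  obtain ⟨hloc, c, hc, hreg⟩ := h
  have hS : σ σ.supportᶜ = 0 := Measure.measure_compl_support
  obtain ⟨M, hM, hbig⟩ : ∃ M : ℝ≥0∞, M ≠ ∞ ∧ ∀ r : ℝ, 0 < r → ediam σ.support < ENNReal.ofReal r →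
      ∀ A : Set (Eucl d), σ A ≤ M * ENNReal.ofReal r ^ n := by
    by_cases hDt : ediam σ.support = ∞
    · exact ⟨0, by simp, fun r _ h => by simp [hDt] at h⟩
    have hcpt : IsCompact σ.support :=
      Metric.isCompact_of_isClosed_isBounded Measure.isClosed_support
        (Metric.isBounded_iff_ediam_ne_top.2 hDt)
    have hpow0 : ediam σ.support ^ n ≠ 0 := pow_ne_zero _ hdiam
    have hpowt : ediam σ.support ^ n ≠ ∞ := ENNReal.pow_ne_top hDt
    refine ⟨σ σ.support / ediam σ.support ^ n,
      ENNReal.div_ne_top hcpt.measure_lt_top.ne hpow0, fun r hr hlt A => ?_⟩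
    calc σ A ≤ σ σ.support + σ σ.supportᶜ := by
          refine (measure_mono fun y _ => ?_).trans (measure_union_le _ _)
          exact em (y ∈ σ.support)
      _ = σ σ.support / ediam σ.support ^ n * ediam σ.support ^ n := by
          rw [hS, add_zero, ENNReal.div_mul_cancel hpow0 hpowt]
      _ ≤ _ := by gcongr
  refine ⟨(ENNReal.ofReal c + M) * 3 ^ n, by finiteness, fun x r hr => ?_⟩
  have h3 : ENNReal.ofReal (3 * r) ^ n = 3 ^ n * ENNReal.ofReal r ^ n := by
    rw [ENNReal.ofReal_mul (by norm_num), mul_pow]; simp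
  by_cases hne : (closedBall x r ∩ σ.support).Nonempty
  · obtain ⟨w, hwx, hw⟩ := hne
    rw [mul_assoc, ← h3]
    rcases le_or_gt (ENNReal.ofReal (3 * r)) (ediam σ.support) with hle | hlt
    · have hsub : closedBall x r ⊆ ball w (3 * r) := by
        intro y hy
        have h1 : dist y x ≤ r := hy
        have h2 : dist w x ≤ r := hwx
        have := dist_triangle_right y w x
        rw [mem_ball]; linarith
      refine (measure_mono hsub).trans ((hreg w hw (3 * r) (by positivity) hle).2.trans ?_)
      rw [ENNReal.ofReal_mul hc.le, ENNReal.ofReal_pow (by positivity)]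
      gcongr
      exact le_self_add
    · refine (hbig (3 * r) (by positivity) hlt _).trans ?_
      gcongr
      exact le_add_self
  · have : σ (closedBall x r) = 0 := measure_mono_null (fun y hy hyS => hne ⟨y, hy, hyS⟩) hS
    rw [this]; exact zero_le

theorem IsADRegularMeasure.exists_lower_bound {n : ℕ} {σ : Measure (Eucl d)}
    (h : IsADRegularMeasure n σ) : ∃ a : ℝ≥0∞, a ≠ 0 ∧ a ≠ ∞ ∧ ∀ x ∈ σ.support, ∀ r : ℝ, 0 < r →
      ENNReal.ofReal r ≤ ediam σ.support → a * ENNReal.ofReal r ^ n ≤ σ (closedBall x r) := by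
  obtain ⟨-, c, hc, hreg⟩ := h
  refine ⟨ENNReal.ofReal c⁻¹, by simpa using hc, ENNReal.ofReal_ne_top, fun x hx r hr hle => ?_⟩
  rw [← ENNReal.ofReal_pow hr.le, ← ENNReal.ofReal_mul (by positivity)]
  exact (hreg x hx r hr hle).1.trans (measure_mono ball_subset_closedBall)

/-- A support of diameter zero has at most one point, which is null for Hausdorff measure of
positive dimension. -/
theorem hausdorffOn_eq_zero_of_ediam_eq_zero {n : ℕ} (hn : 1 ≤ n) {E : Set (Eucl d)}
    (h : ediam (hausdorffOn n E).support = 0) : hausdorffOn n E = 0 := by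
  have hsub : (hausdorffOn n E).support.Subsingleton := Metric.ediam_eq_zero_iff.1 h
  have hna := Measure.nullSingletonClass_hausdorff (Eucl d) (d := (n : ℝ)) (by exact_mod_cast hn)
  have h0 : hausdorffOn n E (hausdorffOn n E).support = 0 := by
    have h1 : hausdorffOn n E ≤ Measure.hausdorffMeasure (n : ℝ) := Measure.restrict_le_self
    exact nonpos_iff_eq_zero.1 ((h1 _).trans (le_of_eq (hsub.measure_zero _)))
  have h2 : hausdorffOn n E (hausdorffOn n E).supportᶜ = 0 := Measure.measure_compl_support
  rw [← Measure.measure_univ_eq_zero, ← nonpos_iff_eq_zero]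
  calc _ ≤ hausdorffOn n E (hausdorffOn n E).support +
        hausdorffOn n E (hausdorffOn n E).supportᶜ := by
        refine (measure_mono fun y _ => ?_).trans (measure_union_le _ _)
        exact em (y ∈ (hausdorffOn n E).support)
    _ = 0 := by rw [h0, h2, add_zero]

/-- A set of diameter `r > 0` lies in a ball of radius `r` about any of its points, so its measure
is at most `C r^n`; Hausdorff measure dominates every measure with such a bound. -/
theorem BallGrowth.inv_smul_le_hausdorffMeasure {n : ℕ} {C : ℝ≥0∞} (hC0 : C ≠ 0)
    (hC : C ≠ ∞) {ν : Measure (Eucl d)} (hν : BallGrowth n C ν) :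
    C⁻¹ • ν ≤ Measure.hausdorffMeasure (n : ℝ) := by
  refine Measure.le_hausdorffMeasure _ _ 1 one_pos fun s hs => ?_
  rcases s.eq_empty_or_nonempty with rfl | ⟨x, hx⟩
  · simp
  have hst : ediam s ≠ ∞ := (hs.trans_lt ENNReal.one_lt_top).ne
  have key : ∀ r : ℝ, 0 < r → ediam s ≤ ENNReal.ofReal r →
      (C⁻¹ • ν) s ≤ ENNReal.ofReal r ^ n := by
    intro r hr hle
    have hsub : s ⊆ closedBall x r := by
      intro y hy
      have := (edist_le_ediam_of_mem hy hx).trans hle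
      rwa [edist_dist, ENNReal.ofReal_le_ofReal_iff hr.le] at this
    rw [Measure.smul_apply, smul_eq_mul]
    calc C⁻¹ * ν s ≤ C⁻¹ * (C * ENNReal.ofReal r ^ n) := by
          gcongr
          exact (measure_mono hsub).trans (hν x r hr)
      _ = _ := by rw [← mul_assoc, ENNReal.inv_mul_cancel hC0 hC, one_mul]
  rw [ENNReal.rpow_natCast]
  -- Growth needs a positive radius, so diameter zero is reached in the limit `r → 0`.
  rcases eq_or_ne (ediam s) 0 with h0 | h0
  · have h1 : Tendsto (fun r : ℝ => ENNReal.ofReal r ^ n) (𝓝[>] 0) (𝓝 (0 ^ n)) := by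
      have := ((ENNReal.continuous_pow n).comp ENNReal.continuous_ofReal).tendsto 0
      simp only [Function.comp, ENNReal.ofReal_zero] at this
      exact this.mono_left nhdsWithin_le_nhds
    rw [h0]
    refine ge_of_tendsto h1 ?_
    filter_upwards [self_mem_nhdsWithin] with r hr
    exact key r hr (by rw [h0]; exact zero_le)
  · have := key (ediam s).toReal (ENNReal.toReal_pos h0 hst) (by rw [ENNReal.ofReal_toReal hst])
    rwa [ENNReal.ofReal_toReal hst] at this

/-- A measure of growth `n` has bounded density on a set of locally finite `ℋ^n` measure. -/
theorem BallGrowth.exists_density {n : ℕ} {C : ℝ≥0∞} (hC0 : C ≠ 0)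
    (hC : C ≠ ∞) {ν : Measure (Eucl d)} (hν : BallGrowth n C ν) (E : Set (Eucl d))
    [IsLocallyFiniteMeasure (hausdorffOn n E)] :
    ∃ w : Eucl d → ℝ≥0∞, Measurable w ∧ (∀ y, w y ≤ C) ∧
      ν.restrict E = (hausdorffOn n E).withDensity w := by
  set ν₁ : Measure (Eucl d) := C⁻¹ • ν.restrict E with hν₁
  have hle : ν₁ ≤ hausdorffOn n E := by
    rw [hν₁, ← Measure.restrict_smul, hausdorffOn]
    exact Measure.restrict_mono' (by rfl) (hν.inv_smul_le_hausdorffMeasure hC0 hC)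
  have hfin : IsLocallyFiniteMeasure ν₁ := Measure.isLocallyFiniteMeasure_of_le hle
  -- The derivative is at most one only almost everywhere; the minimum makes the bound hold at every
  -- point without changing the measure.
  refine ⟨fun y => C * min (ν₁.rnDeriv (hausdorffOn n E) y) 1,
    (((Measure.measurable_rnDeriv _ _).min measurable_const).const_mul _),
    fun y => (mul_le_mul_right (min_le_right _ _) C).trans (mul_one C).le, ?_⟩
  have h1 : (hausdorffOn n E).withDensity (fun y => min (ν₁.rnDeriv (hausdorffOn n E) y) 1) =
      ν₁ := by
    rw [← Measure.withDensity_rnDeriv_eq ν₁ (hausdorffOn n E) hle.absolutelyContinuous]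
    refine withDensity_congr_ae ?_
    rw [Measure.withDensity_rnDeriv_eq ν₁ (hausdorffOn n E) hle.absolutelyContinuous]
    filter_upwards [Measure.rnDeriv_le_one_of_le hle] with y hy
    exact min_eq_left hy
  have h2 := withDensity_smul C (μ := hausdorffOn n E)
    ((Measure.measurable_rnDeriv ν₁ (hausdorffOn n E)).min (measurable_const (a := 1)))
  rw [h1, hν₁, smul_smul, ENNReal.mul_inv_cancel hC0 hC, one_smul] at h2
  rw [← h2]
  rfl

end Geometry

/-! ### Transference from the exterior to the surface measure -/

section Transference

variable {d : ℕ} {n : ℕ} {c η : ℝ} {k : Eucl d → Eucl d → ℂ}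

/-- The balls `closedBall y (2 δ(y))` carry at least mass `a δ(y)^n`. -/
def MassNear (n : ℕ) (a : ℝ≥0∞) (σ : Measure (Eucl d)) (δ : Eucl d → ℝ) (y : Eucl d) : Prop :=
  0 < δ y ∧ a * ENNReal.ofReal (δ y) ^ n ≤ σ (closedBall y (2 * δ y))

theorem MassNear.ne_zero {a : ℝ≥0∞} {σ : Measure (Eucl d)} {δ : Eucl d → ℝ} {y : Eucl d}
    (h : MassNear n a σ δ y) (ha : a ≠ 0) : σ (closedBall y (2 * δ y)) ≠ 0 := fun h0 => by
  have := h.2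
  rw [h0, nonpos_iff_eq_zero, mul_eq_zero] at this
  exact this.elim ha (ofReal_pow_ne_zero h.1 n)

theorem BallGrowth.measure_closedBall_ne_top {C : ℝ≥0∞} {σ : Measure (Eucl d)}
    (hσ : BallGrowth n C σ) (hC : C ≠ ∞) (y : Eucl d) {r : ℝ} (hr : 0 < r) :
    σ (closedBall y r) ≠ ∞ :=
  ((hσ y r hr).trans_lt (ENNReal.mul_lt_top hC.lt_top (ofReal_pow_ne_top _ n).lt_top)).ne

theorem MassNear.inv_mul_lintegral_le {a : ℝ≥0∞} {σ μ : Measure (Eucl d)} {δ : Eucl d → ℝ}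
    {y : Eucl d} (h : MassNear n a σ δ y) (ha : a ≠ 0) (ha' : a ≠ ∞) (w : Eucl d → ℝ≥0∞) {b : ℝ}
    (hb : 0 < b) :
    (σ (closedBall y (2 * δ y)))⁻¹ * ∫⁻ x in closedBall y (b * δ y), w x ∂μ ≤
      a⁻¹ * ENNReal.ofReal b ^ n * radialMax n μ w y := by
  have h1 := lintegral_closedBall_le_radialMax n μ w y (mul_pos hb h.1)
  have h2 := ENNReal.inv_mul_cancel (ofReal_pow_ne_zero h.1 n) (ofReal_pow_ne_top (δ y) n)
  rw [ENNReal.ofReal_mul hb.le, mul_pow] at h1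
  calc _ ≤ (a * ENNReal.ofReal (δ y) ^ n)⁻¹ *
      (radialMax n μ w y * (ENNReal.ofReal b ^ n * ENNReal.ofReal (δ y) ^ n)) := by
        gcongr
        exact h.2
    _ = a⁻¹ * ENNReal.ofReal b ^ n * radialMax n μ w y *
        ((ENNReal.ofReal (δ y) ^ n)⁻¹ * ENNReal.ofReal (δ y) ^ n) := by
        rw [ENNReal.mul_inv (Or.inl ha) (Or.inl ha')]; ring
    _ = _ := by rw [h2, mul_one]

theorem measurable_flip {φ : Eucl d → Eucl d → ℝ} (h : Measurable (Function.uncurry φ)) :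
    Measurable fun q : Eucl d × Eucl d => φ q.2 q.1 :=
  h.comp measurable_swap

/-- Averaging over the balls `closedBall y (2 δ(y))` is bounded from `L^p(ν)` to `L^p(σ)`. -/
theorem exists_lintegral_ballAverage_rpow_le (hn : 1 ≤ n) {σ ν : Measure (Eucl d)} [SigmaFinite σ]
    [SFinite ν] {C₁ C₂ a : ℝ≥0∞} (hC₁ : C₁ ≠ ∞) (hC₂ : C₂ ≠ ∞) (hσ : BallGrowth n C₁ σ)
    (hν : BallGrowth n C₂ ν) (ha : a ≠ 0) (ha' : a ≠ ∞) {δ : Eucl d → ℝ} (hδ : Measurable δ)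
    (hmass : ∀ᵐ y ∂ν, MassNear n a σ δ y) {p : ℝ} (hp : 1 < p) :
    ∃ B : ℝ≥0∞, B ≠ ∞ ∧ ∀ f : Eucl d → ℝ≥0∞, Measurable f →
      ∫⁻ z, (∫⁻ y, ENNReal.ofReal (ballAverage σ id (fun y => 2 * δ y) y z) * f y ∂ν) ^ p ∂σ ≤
        B * ∫⁻ y, f y ^ p ∂ν := by
  have hpp := Real.HolderConjugate.conjExponent hp
  obtain ⟨B, hB, h⟩ := exists_lintegral_kernel_rpow_le hn hC₁ hC₂ hσ hν hpp zero_lt_one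
    hpp.symm.lt (A := a⁻¹ * ENNReal.ofReal 2 ^ n) (by
      have := ENNReal.inv_ne_top.2 ha
      finiteness)
  have hm : Measurable fun y => 2 * δ y := by fun_prop
  refine ⟨B, hB, h (fun z y => ENNReal.ofReal (ballAverage σ id (fun y => 2 * δ y) y z)) ?_ ?_⟩
  · exact (measurable_flip (measurable_ballAverage σ measurable_id hm)).ennreal_ofReal
  · filter_upwards [hmass] with y hy w hw
    have h0 := hy.ne_zero ha
    have hT := hσ.measure_closedBall_ne_top hC₁ y (mul_pos two_pos hy.1)
    simp only [ENNReal.rpow_one, one_div, inv_one]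
    refine le_trans (le_of_eq ?_) (hy.inv_mul_lintegral_le ha ha' w two_pos)
    rw [← lintegral_const_mul' _ _ (ENNReal.inv_ne_top.2 h0),
      ← lintegral_indicator measurableSet_closedBall]
    refine lintegral_congr fun z => ?_
    rw [ofReal_ballAverage_le (ctr := id) (rad := fun y => 2 * δ y) h0 hT]
    by_cases hz : z ∈ closedBall y (2 * δ y) <;> simp [hz]

/-- The operator applied to the averages, near the base point. -/
noncomputable def localKernel (k : Eucl d → Eucl d → ℂ) (σ : Measure (Eucl d)) (ε : ℝ)
    (δ : Eucl d → ℝ) (x y : Eucl d) : ℝ≥0∞ :=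
  if dist x y < 4 * δ y then
    ‖∫ z, truncKernel k ε x z * ballAverage σ id (fun y => 2 * δ y) y z ∂σ‖ₑ else 0

theorem CZBound.measurable_localKernel (hk : CZBound n c η k) {ε : ℝ} (hε : 0 < ε)
    (σ : Measure (Eucl d)) [SFinite σ] {δ : Eucl d → ℝ} (hδ : Measurable δ) :
    Measurable (Function.uncurry (localKernel k σ ε δ)) := by
  refine Measurable.ite (measurableSet_lt (by fun_prop) (by fun_prop)) ?_ measurable_const
  refine Measurable.enorm ?_
  have h1 : Measurable fun q : (Eucl d × Eucl d) × Eucl d => truncKernel k ε q.1.1 q.2 :=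
    (hk.measurable_truncKernel hε).comp (f := fun q : (Eucl d × Eucl d) × Eucl d => (q.1.1, q.2))
      (by fun_prop)
  have h2 : Measurable fun q : (Eucl d × Eucl d) × Eucl d =>
      ballAverage σ id (fun y => 2 * δ y) q.1.2 q.2 :=
    (measurable_ballAverage σ measurable_id (show Measurable fun y => 2 * δ y by fun_prop)).comp
      (f := fun q : (Eucl d × Eucl d) × Eucl d => (q.1.2, q.2)) (by fun_prop)
  have h3 : Measurable fun q : (Eucl d × Eucl d) × Eucl d =>
      truncKernel k ε q.1.1 q.2 * (ballAverage σ id (fun y => 2 * δ y) q.1.2 q.2 : ℂ) :=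
    h1.mul (Complex.measurable_ofReal.comp h2)
  exact h3.stronglyMeasurable.integral_prod_right'.measurable

/-- The normalized indicator of a ball of mass `m` has `L^q(σ)` norm `m^(-1/q')`. Hölder on the ball
of radius `4δ(y)` together with the strong bound leaves an average of `w^q'` over a ball with `m` at
least of order `δ^n`, that is, a maximal function of order `q'`. -/
theorem CZBound.lintegral_localKernel_le (hk : CZBound n c η k) {ε : ℝ} (hε : 0 < ε)
    {σ μ : Measure (Eucl d)} [SFinite σ] {C₁ a : ℝ≥0∞} (hC₁ : C₁ ≠ ∞)
    (hσ : BallGrowth n C₁ σ) (ha : a ≠ 0) (ha' : a ≠ ∞) {δ : Eucl d → ℝ} (hδ : Measurable δ)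
    {y : Eucl d} (hy : MassNear n a σ δ y) {q q' : ℝ} (hqq : q.HolderConjugate q') {CT : ℝ≥0∞}
    (hstrong : ∀ g : Eucl d → ℂ, Measurable g → ∫⁻ y, ‖g y‖ₑ ^ q ∂σ ≠ ∞ →
        ∫⁻ x, ‖truncOp k σ ε g x‖ₑ ^ q ∂μ ≤ CT * ∫⁻ y, ‖g y‖ₑ ^ q ∂σ)
    {w : Eucl d → ℝ≥0∞} (hw : Measurable w) :
    ∫⁻ x, localKernel k σ ε δ x y * w x ∂μ ≤
      CT ^ (1 / q) * (a⁻¹ * ENNReal.ofReal 4 ^ n) ^ (1 / q') *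
        radialMax n μ (fun x => w x ^ q') y ^ (1 / q') := by
  have hq0 := hqq.pos
  have hq0' := hqq.symm.pos
  have h0 := hy.ne_zero ha
  have hT := hσ.measure_closedBall_ne_top hC₁ y (mul_pos two_pos hy.1)
  set m := σ (closedBall y (2 * δ y)) with hm
  set g : Eucl d → ℂ := fun z => (ballAverage σ id (fun y => 2 * δ y) y z : ℂ) with hg
  have hgm : Measurable g := by
    have h2 : Measurable fun z => ballAverage σ id (fun y => 2 * δ y) y z :=
      (measurable_ballAverage σ measurable_id
        (show Measurable fun y => 2 * δ y by fun_prop)).of_uncurry_left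
    exact Complex.measurable_ofReal.comp h2
  have hgq : ∫⁻ z, ‖g z‖ₑ ^ q ∂σ = (m⁻¹) ^ q * m := by
    rw [← lintegral_indicator_const measurableSet_closedBall]
    refine lintegral_congr fun z => ?_
    simp only [hg]
    rw [← ofReal_norm, Complex.norm_real, Real.norm_of_nonneg (ballAverage_nonneg _ _ _ _ _),
      ofReal_ballAverage_le (ctr := id) (rad := fun y => 2 * δ y) h0 hT]
    by_cases hz : z ∈ closedBall y (2 * δ y) <;> simp [hz, hq0, hm]
  have hmq : ((m⁻¹) ^ q * m) ^ (1 / q) = (m⁻¹) ^ (1 / q') := by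
    rw [ENNReal.mul_rpow_of_nonneg _ _ hqq.one_div_nonneg, ← ENNReal.rpow_mul,
      mul_one_div_cancel hq0.ne', ENNReal.rpow_one]
    conv_lhs => rw [← rpow_mul_rpow_conj hqq m⁻¹]
    rw [mul_right_comm, ← ENNReal.mul_rpow_of_nonneg _ _ hqq.one_div_nonneg,
      ENNReal.inv_mul_cancel h0 hT, ENNReal.one_rpow, one_mul]
  have hTg : (∫⁻ x, ‖truncOp k σ ε g x‖ₑ ^ q ∂μ) ^ (1 / q) ≤
      CT ^ (1 / q) * (m⁻¹) ^ (1 / q') := by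
    rw [← hmq, ← ENNReal.mul_rpow_of_nonneg _ _ hqq.one_div_nonneg, ← hgq]
    refine ENNReal.rpow_le_rpow (hstrong g hgm ?_) hqq.one_div_nonneg
    rw [hgq]
    exact ENNReal.mul_ne_top (ENNReal.rpow_ne_top_of_nonneg hq0.le (ENNReal.inv_ne_top.2 h0)) hT
  calc ∫⁻ x, localKernel k σ ε δ x y * w x ∂μ
      ≤ ∫⁻ x in closedBall y (4 * δ y), ‖truncOp k σ ε g x‖ₑ * w x ∂μ := by
        rw [← lintegral_indicator measurableSet_closedBall]
        refine lintegral_mono fun x => ?_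
        unfold localKernel
        split_ifs with hx
        · rw [indicator_of_mem (by exact hx.le), truncOp_eq_integral]
        · simp
    _ ≤ (∫⁻ x in closedBall y (4 * δ y), ‖truncOp k σ ε g x‖ₑ ^ q ∂μ) ^ (1 / q) *
        (∫⁻ x in closedBall y (4 * δ y), w x ^ q' ∂μ) ^ (1 / q') :=
        ENNReal.lintegral_mul_le_Lp_mul_Lq _ hqq
          (hk.measurable_truncOp hε σ hgm).enorm.aemeasurable hw.aemeasurable
    _ ≤ CT ^ (1 / q) * (m⁻¹) ^ (1 / q') *
        (∫⁻ x in closedBall y (4 * δ y), w x ^ q' ∂μ) ^ (1 / q') := by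
        gcongr
        refine le_trans ?_ hTg
        exact ENNReal.rpow_le_rpow (setLIntegral_le_lintegral _ _) hqq.one_div_nonneg
    _ = CT ^ (1 / q) * (m⁻¹ * ∫⁻ x in closedBall y (4 * δ y), w x ^ q' ∂μ) ^ (1 / q') := by
        rw [ENNReal.mul_rpow_of_nonneg _ _ hqq.symm.one_div_nonneg, mul_assoc]
    _ ≤ CT ^ (1 / q) * (a⁻¹ * ENNReal.ofReal 4 ^ n *
        radialMax n μ (fun x => w x ^ q') y) ^ (1 / q') := by
        refine mul_le_mul_right (ENNReal.rpow_le_rpow ?_ hqq.symm.one_div_nonneg) _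
        exact hy.inv_mul_lintegral_le ha ha' _ (b := 4) (by norm_num)
    _ = _ := by rw [ENNReal.mul_rpow_of_nonneg _ _ hqq.symm.one_div_nonneg, mul_assoc]

/-- The strict inequality `p < q` enters here as `q' < p'`, which lets the maximal function of order
`q'` act boundedly on `L^p'`. -/
theorem CZBound.exists_measure_lt_localKernel_le (hk : CZBound n c η k) (hn : 1 ≤ n)
    {σ μ ν : Measure (Eucl d)} [SFinite σ] [SigmaFinite μ] [SFinite ν] {C₁ C₂ C₃ a : ℝ≥0∞}
    (hC₁ : C₁ ≠ ∞) (hC₂ : C₂ ≠ ∞) (hC₃ : C₃ ≠ ∞) (hσ : BallGrowth n C₁ σ)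
    (hμ : BallGrowth n C₂ μ) (hν : BallGrowth n C₃ ν) (ha : a ≠ 0) (ha' : a ≠ ∞)
    {δ : Eucl d → ℝ} (hδ : Measurable δ) (hmass : ∀ᵐ y ∂ν, MassNear n a σ δ y) {p q : ℝ}
    (hp : 1 < p) (hpq : p < q) (hT : IsStrongBounded k σ μ q) :
    ∃ B : ℝ≥0∞, B ≠ ∞ ∧ ∀ ε : ℝ, 0 < ε → ∀ f : Eucl d → ℝ≥0∞, Measurable f →
      ∀ t : ℝ≥0∞, t ≠ 0 → t ≠ ∞ →
        μ {x | t < ∫⁻ y, localKernel k σ ε δ x y * f y ∂ν} ≤ B * (∫⁻ y, f y ^ p ∂ν) / t ^ p := by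
  have hpp := Real.HolderConjugate.conjExponent hp
  have hqq := Real.HolderConjugate.conjExponent (hp.trans hpq)
  set p' := Real.conjExponent p
  set q' := Real.conjExponent q
  have hlt : q' < p' := by
    have h1 := hpp.inv_add_inv_eq_one
    have h2 := hqq.inv_add_inv_eq_one
    have h3 : q⁻¹ < p⁻¹ := inv_strictAnti₀ hpp.pos hpq
    exact (inv_lt_inv₀ hpp.symm.pos hqq.symm.pos).1 (by linarith)
  obtain ⟨CT, hCT, hstrong⟩ := hT.exists_lintegral_le hqq.pos
  obtain ⟨B, hB, h⟩ := exists_lintegral_kernel_rpow_le hn hC₂ hC₃ hμ hν hpp hqq.symm.pos hlt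
    (A := CT ^ (1 / q) * (a⁻¹ * ENNReal.ofReal 4 ^ n) ^ (1 / q')) (by
      have := ENNReal.inv_ne_top.2 ha
      exact ENNReal.mul_ne_top (ENNReal.rpow_ne_top_of_nonneg hqq.one_div_nonneg hCT)
        (ENNReal.rpow_ne_top_of_nonneg hqq.symm.one_div_nonneg (by finiteness)))
  refine ⟨B, hB, fun ε hε f hf t ht ht' => ?_⟩
  have hm := hk.measurable_localKernel hε σ hδ
  refine measure_lt_le_of_lintegral_rpow_le hpp.pos ?_ (h _ hm ?_ f hf) ht ht'
  · exact (hm.mul (hf.comp measurable_snd)).lintegral_prod_right'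
  · filter_upwards [hmass] with y hy w hw
    exact hk.lintegral_localKernel_le hε hC₁ hσ ha ha' hδ hy hqq (hstrong ε hε) hw

/-- Size bound at points whose distance is at most four times the scale. -/
theorem CZBound.enorm_truncKernel_le_tailKernel (hk : CZBound n c η k) {ε : ℝ} (hε : 0 < ε)
    {δ : Eucl d → ℝ} {x y : Eucl d} (h0 : 0 < δ y) (h1 : δ y ≤ dist x y)
    (h4 : dist x y ≤ 4 * δ y) :
    ‖truncKernel k ε x y‖ₑ ≤ ENNReal.ofReal (c * 4 ^ η) * tailKernel n η δ x y := by
  have hc := hk.c_pos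
  have hη := hk.η_pos
  have hd : 0 < dist x y := h0.trans_le h1
  refine (hk.enorm_truncKernel_le_inv hε x y).trans ?_
  rw [tailKernel, if_pos h1, ← ENNReal.ofReal_mul (by positivity), ← dist_eq_norm]
  refine ENNReal.ofReal_le_ofReal ?_
  rw [Real.rpow_add hd, Real.rpow_natCast, mul_div_assoc', div_le_div_iff₀ (by positivity)
    (by positivity)]
  have h5 : dist x y ^ η ≤ 4 ^ η * δ y ^ η := by
    rw [← Real.mul_rpow (by norm_num) h0.le]
    exact Real.rpow_le_rpow hd.le h4 hη.le
  calc c * (dist x y ^ n * dist x y ^ η) ≤ c * (dist x y ^ n * (4 ^ η * δ y ^ η)) := by gcongr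
    _ = _ := by ring

theorem tailKernel_two_mul_le (hη : 0 < η) {δ : Eucl d → ℝ} {x y : Eucl d} (h0 : 0 < δ y) :
    tailKernel n η (fun y => 2 * δ y) x y ≤ ENNReal.ofReal (4 ^ η) * tailKernel n η δ x y := by
  unfold tailKernel
  by_cases h : 2 * δ y ≤ dist x y
  · have hd : 0 < dist x y := by linarith
    rw [if_pos h, if_pos (by linarith), ← ENNReal.ofReal_mul (by positivity)]
    refine ENNReal.ofReal_le_ofReal ?_
    rw [Real.mul_rpow (by norm_num) h0.le, mul_div_assoc]
    gcongr
    norm_num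
  · rw [if_neg h]; exact zero_le

theorem CZBound.enorm_transferError_le_kernels (hk : CZBound n c η k) {ε : ℝ} (hε : 0 < ε)
    {σ : Measure (Eucl d)} [SFinite σ] {C₁ a : ℝ≥0∞} (hC₁ : C₁ ≠ ∞) (hσ : BallGrowth n C₁ σ)
    (ha : a ≠ 0) {δ : Eucl d → ℝ} (hδ : Measurable δ) {x y : Eucl d}
    (hy : MassNear n a σ δ y) (hxy : δ y ≤ dist x y) :
    ‖transferError k (ballAverage σ id fun y => 2 * δ y) σ ε x y‖ₑ ≤
      ENNReal.ofReal (c * 4 ^ η) * tailKernel n η δ x y + ENNReal.ofReal c * annulusKernel n ε x y +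
        localKernel k σ ε δ x y := by
  have hc := hk.c_pos
  have h0 := hy.ne_zero ha
  have hT := hσ.measure_closedBall_ne_top hC₁ y (mul_pos two_pos hy.1)
  -- Averaging radius `2δ` and separation `4δ` match the requirement `2 r ≤ |x - y|` of the
  -- smoothness estimate. Closer than that, the two halves of the error are bounded separately.
  rcases le_or_gt (4 * δ y) (dist x y) with h | h
  · refine le_trans ?_ le_self_add
    set r : Eucl d → ℝ := fun y => 2 * δ y with hr
    have hrm : Measurable r := by fun_prop
    have hr0 : 0 < r y := mul_pos two_pos hy.1
    have h2r : 2 * r y ≤ ‖x - y‖ := by rw [← dist_eq_norm]; simp only [hr]; linarith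
    have hsupp : ∀ z, ballAverage σ id r y z ≠ 0 → ‖z - y‖ ≤ r y := fun z hz => by
      rw [← dist_eq_norm]
      exact dist_le_of_ballAverage_ne_zero (ctr := id) (rad := r) hz
    have hint : ∫⁻ z, ENNReal.ofReal (ballAverage σ id r y z) ∂σ = 1 :=
      lintegral_ballAverage (ctr := id) (rad := r) h0 hT
    refine (hk.enorm_transferError_le hε (measurable_ballAverage σ measurable_id hrm)
      (ballAverage_nonneg σ id r) hr0 h2r hint hsupp).trans ?_
    · rw [mul_add, ENNReal.ofReal_mul hc.le, mul_assoc]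
      gcongr
      exact tailKernel_two_mul_le hk.η_pos hy.1
  · refine (enorm_sub_le).trans ?_
    rw [localKernel, if_pos h]
    gcongr
    exact (hk.enorm_truncKernel_le_tailKernel hε hy.1 hxy h.le).trans le_self_add

theorem measure_lt_le_of_rescale {X : Type*} [MeasurableSpace X] {μ : Measure X} {A B N : ℝ≥0∞}
    {p : ℝ} (hp : 0 < p) (hA : A ≠ ∞) {F : X → ℝ≥0∞}
    (h : ∀ t : ℝ≥0∞, t ≠ 0 → t ≠ ∞ → μ {x | A * t < F x} ≤ B * (N / t ^ p)) {s : ℝ≥0∞}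
    (hs : s ≠ 0) (hs' : s ≠ ∞) : μ {x | s < F x} ≤ B * (A + 1) ^ p * (N / s ^ p) := by
  have hA0 : A + 1 ≠ 0 := by simp
  have hAt : A + 1 ≠ ∞ := by finiteness
  set t := s / (A + 1) with ht_def
  have hst : (A + 1) * t = s := ENNReal.mul_div_cancel hA0 hAt
  have ht : t ≠ 0 := fun h => hs (by rw [← hst, h, mul_zero])
  have ht' : t ≠ ∞ := ENNReal.div_ne_top hs' hA0
  have hAp0 : (A + 1) ^ p ≠ 0 := (ENNReal.rpow_pos (pos_iff_ne_zero.2 hA0) hAt).ne'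
  have hApt : (A + 1) ^ p ≠ ∞ := ENNReal.rpow_ne_top_of_nonneg hp.le hAt
  have hrescale : B * (A + 1) ^ p * (N / s ^ p) = B * (N / t ^ p) := by
    rw [← hst, ENNReal.mul_rpow_of_nonneg _ _ hp.le, mul_assoc, ← mul_div_assoc,
      ENNReal.mul_div_mul_left _ _ hAp0 hApt]
  rw [hrescale]
  refine (measure_mono fun x hx => ?_).trans (h t ht ht')
  rw [mem_ofPred_eq] at hx ⊢
  refine lt_of_le_of_lt ?_ hx
  rw [← hst]
  gcongr
  exact le_self_add

theorem truncOp_withDensity (k : Eucl d → Eucl d → ℂ) (σ : Measure (Eucl d)) (ε : ℝ)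
    {w : Eucl d → ℝ≥0∞} (hw : Measurable w) {C : ℝ≥0∞} (hC : C ≠ ∞) (hwC : ∀ y, w y ≤ C)
    (f : Eucl d → ℂ) (x : Eucl d) :
    truncOp k (σ.withDensity w) ε f x = truncOp k σ ε (fun y => ((w y).toReal : ℂ) * f y) x := by
  rw [truncOp_eq_integral, truncOp_eq_integral, integral_withDensity_eq_integral_toReal_smul hw
    (ae_of_all _ fun y => (hwC y).trans_lt hC.lt_top)]
  refine integral_congr_ae (ae_of_all _ fun y => ?_)
  simp only [Complex.real_smul]
  ring

/-- Pointwise `w^p ≤ C^(p-1) w`: one factor of the density is kept to recover the original measure.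
-/
theorem lintegral_enorm_density_mul_rpow_le {σ : Measure (Eucl d)} {w : Eucl d → ℝ≥0∞}
    (hw : Measurable w) {C : ℝ≥0∞} (hC : C ≠ ∞) (hwC : ∀ y, w y ≤ C) {f : Eucl d → ℂ}
    (hf : Measurable f) {p : ℝ} (hp : 1 < p) :
    ∫⁻ y, ‖((w y).toReal : ℂ) * f y‖ₑ ^ p ∂σ ≤
      C ^ (p - 1) * ∫⁻ y, ‖f y‖ₑ ^ p ∂(σ.withDensity w) := by
  have hp1 : 0 ≤ p - 1 := by linarith
  rw [lintegral_withDensity_eq_lintegral_mul _ hw (hf.enorm.pow_const p),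
    ← lintegral_const_mul' _ _ (ENNReal.rpow_ne_top_of_nonneg hp1 hC)]
  refine lintegral_mono fun y => ?_
  have hwt : w y ≠ ∞ := ((hwC y).trans_lt hC.lt_top).ne
  have h1 : ‖((w y).toReal : ℂ)‖ₑ = w y := by
    rw [← ofReal_norm, Complex.norm_real, Real.norm_of_nonneg ENNReal.toReal_nonneg,
      ENNReal.ofReal_toReal hwt]
  rw [enorm_mul, h1, ENNReal.mul_rpow_of_nonneg _ _ (by linarith)]
  have h2 : w y ^ p = w y ^ (p - 1) * w y := by
    conv_lhs => rw [show p = (p - 1) + 1 by ring]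
    rw [ENNReal.rpow_add_of_nonneg _ _ hp1 zero_le_one, ENNReal.rpow_one]
  rw [h2, Pi.mul_apply, mul_assoc]
  gcongr
  exact hwC y

theorem truncOp_add_restrict_compl {ν : Measure (Eucl d)} {ε : ℝ} {f : Eucl d → ℂ} {x : Eucl d}
    (h : Integrable (fun y => truncKernel k ε x y * f y) ν) {A : Set (Eucl d)}
    (hA : MeasurableSet A) :
    truncOp k (ν.restrict A) ε f x + truncOp k (ν.restrict Aᶜ) ε f x = truncOp k ν ε f x := by
  rw [truncOp_eq_integral, truncOp_eq_integral, truncOp_eq_integral]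
  exact integral_add_compl hA h

end Transference

/-! ### The weak type estimate -/

section Main

variable {d : ℕ} {c η : ℝ} {k : Eucl d → Eucl d → ℂ}

/-- With no surface measure, the exterior is empty, since a segment into it would cross the support;
and `ν` does not charge the boundary, where it has a density with respect to the zero measure. -/
theorem measure_eq_zero_of_hausdorffOn_eq_zero (hd : 2 ≤ d) {U : Set (Eucl d)} (hU : IsOpen U)
    (hne : U.Nonempty) {ν : Measure (Eucl d)} {C : ℝ≥0∞} (hC0 : C ≠ 0) (hC : C ≠ ∞)
    (hν : BallGrowth (d - 1) C ν) (hνU : ν U = 0) (hσ : hausdorffOn (d - 1) (frontier U) = 0) :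
    ν = 0 := by
  have hloc : IsLocallyFiniteMeasure (hausdorffOn (d - 1) (frontier U)) := by
    rw [hσ]; infer_instance
  obtain ⟨w, -, -, hw⟩ := hν.exists_density hC0 hC (frontier U)
  rw [hσ, withDensity_zero_left] at hw
  have hΓ : ν (frontier U) = 0 := Measure.restrict_eq_zero.1 hw
  obtain ⟨x, hx⟩ := hne
  rw [← Measure.measure_univ_eq_zero]
  refine measure_mono_null (t := U ∪ frontier U) (fun y _ => ?_) (measure_union_null hνU hΓ)
  rw [← closure_eq_self_union_frontier]
  by_contra hy
  obtain ⟨z, -, hz⟩ := inter_support_nonempty (by omega) hU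
    (convex_segment x y).isPreconnected
    ⟨x, left_mem_segment ℝ _ _, hx⟩ ⟨y, right_mem_segment ℝ _ _, hy⟩
  rw [hσ, Measure.support_zero] at hz
  exact hz

/-- The ball of radius `δ(y)` about the nearest support point lies in the ball of radius `2δ(y)`
about `y`. -/
theorem massNear_infDist {n : ℕ} {σ : Measure (Eucl d)} {a : ℝ≥0∞}
    (hlow : ∀ x ∈ σ.support, ∀ r : ℝ, 0 < r → ENNReal.ofReal r ≤ ediam σ.support →
      a * ENNReal.ofReal r ^ n ≤ σ (closedBall x r)) (hne : σ.support.Nonempty) {y : Eucl d}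
    (h0 : 0 < infDist y σ.support)
    (hnear : ENNReal.ofReal (infDist y σ.support) ≤ ediam σ.support) :
    MassNear n a σ (fun y => infDist y σ.support) y := by
  obtain ⟨z, hz, hyz⟩ := Measure.isClosed_support.exists_infDist_eq_dist hne y
  refine ⟨h0, (hlow z hz _ h0 hnear).trans (measure_mono ?_)⟩
  refine closedBall_subset_closedBall' ?_
  rw [dist_comm, ← hyz]
  linarith

theorem lintegral_three_kernels {ν : Measure (Eucl d)} {K₁ K₂ K₃ : Eucl d → ℝ≥0∞}
    (h₁ : Measurable K₁) (h₂ : Measurable K₂) {f : Eucl d → ℝ≥0∞}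
    (hf : Measurable f) {a b : ℝ≥0∞} (ha : a ≠ ∞) (hb : b ≠ ∞) :
    ∫⁻ y, (a * K₁ y + b * K₂ y + K₃ y) * f y ∂ν =
      a * ∫⁻ y, K₁ y * f y ∂ν + b * ∫⁻ y, K₂ y * f y ∂ν + ∫⁻ y, K₃ y * f y ∂ν := by
  simp_rw [add_mul, mul_assoc]
  rw [lintegral_add_left, lintegral_add_left, lintegral_const_mul' _ _ ha,
    lintegral_const_mul' _ _ hb]
  · fun_prop
  · fun_prop

/-- The weak type estimate in dimension at least two. -/
theorem CZBound.exists_weak_bound (hd : 2 ≤ d) (hk : CZBound (d - 1) c η k) {U : Set (Eucl d)}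
    (hU : IsOpen U) (hne : U.Nonempty) (hΓ : IsADRegularSet (d - 1) (frontier U))
    {μ ν : Measure (Eucl d)} (hμ : HasGrowth (d - 1) μ) (hν : HasGrowth (d - 1) ν)
    (hμU : μ Uᶜ = 0) (hνU : ν U = 0) {p q : ℝ} (hp : 1 < p) (hpq : p < q)
    (hT : IsStrongBounded k (hausdorffOn (d - 1) (frontier U)) μ q) :
    ∃ B : ℝ≥0∞, B ≠ ∞ ∧ ∀ ε : ℝ, 0 < ε → ∀ f : Eucl d → ℂ, Measurable f →
      ∀ t : ℝ≥0∞, t ≠ 0 → t ≠ ∞ →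
        μ {x | t < ‖truncOp k ν ε f x‖ₑ} ≤ B * ((∫⁻ y, ‖f y‖ₑ ^ p ∂ν) / t ^ p) := by
  have hn : 1 ≤ d - 1 := by omega
  have hp0 : 0 < p := by linarith
  obtain ⟨Cμ, -, hCμ, hμg⟩ := hμ.exists_ballGrowth
  obtain ⟨Cν, hCν0, hCν, hνg⟩ := hν.exists_ballGrowth
  have hμl := hμg.isLocallyFiniteMeasure hCμ
  have hνl := hνg.isLocallyFiniteMeasure hCν
  set n := d - 1 with hn_def
  set σ := hausdorffOn n (frontier U) with hσ
  rcases eq_or_ne (ediam σ.support) 0 with hdiam | hdiam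
  · have h0 := measure_eq_zero_of_hausdorffOn_eq_zero hd hU hne hCν0 hCν hνg hνU
      (hausdorffOn_eq_zero_of_ediam_eq_zero hn hdiam)
    refine ⟨0, by simp, fun ε _ f _ t _ _ => ?_⟩
    simp [h0, truncOp]
  have hσl : IsLocallyFiniteMeasure σ := hΓ.1
  have hSne : σ.support.Nonempty := by
    by_contra h
    rw [not_nonempty_iff_eq_empty] at h
    exact hdiam (by rw [h, ediam_empty])
  obtain ⟨Cσ, hCσ, hσg⟩ := IsADRegularMeasure.exists_ballGrowth hΓ hdiam
  obtain ⟨a, ha, ha', hlow⟩ := IsADRegularMeasure.exists_lower_bound hΓ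
  obtain ⟨w, hw, hwC, hwν⟩ := hνg.exists_density hCν0 hCν (frontier U)
  set δ : Eucl d → ℝ := fun y => infDist y σ.support with hδ_def
  have hδ : Measurable δ := (continuous_infDist_pt _).measurable
  set ν' := ν.restrict (frontier U)ᶜ with hν'
  -- Points of `A` are close enough for the regularity lower bound to apply at scale `δ`, so their
  -- mass can be transferred. Points outside `A` see all of `U` at distances comparable with `δ` and
  -- need no cancellation.
  set A : Set (Eucl d) := {y | ENNReal.ofReal (δ y) ≤ ediam σ.support} with hA
  have hAm : MeasurableSet A := measurableSet_le (by fun_prop) measurable_const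
  set ν₁ := ν'.restrict A with hν₁
  set ν₂ := ν'.restrict Aᶜ with hν₂
  have hν'g : BallGrowth n Cν ν' :=
    fun x r hr => (Measure.restrict_apply_le _ _).trans (hνg x r hr)
  have hν₁g : BallGrowth n Cν ν₁ :=
    fun x r hr => (Measure.restrict_apply_le _ _).trans (hν'g x r hr)
  have hext : ∀ᵐ y ∂ν', y ∈ (closure U)ᶜ := by
    have h1 : ∀ᵐ y ∂ν', y ∉ U := ae_restrict_of_ae (measure_eq_zero_iff_ae_notMem.1 hνU)
    filter_upwards [h1, ae_restrict_mem isClosed_frontier.measurableSet.compl] with y hy1 hy2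
    rw [closure_eq_self_union_frontier]
    exact fun h => h.elim hy1 hy2
  have hδpos : ∀ᵐ y ∂ν', 0 < δ y := hext.mono fun y hy => infDist_support_pos (by omega) hU hne hy
  have hmass : ∀ᵐ y ∂ν₁, MassNear n a σ δ y := by
    filter_upwards [ae_restrict_of_ae hδpos, ae_restrict_mem hAm] with y hy hyA
    exact massNear_infDist hlow hSne hy hyA
  obtain ⟨Bσ, hBσ, hweakσ⟩ := hk.exists_measure_lt_truncOp_le hn hCσ hCμ hσg hμg ha ha' hlow hdiam
    hp hpq hT
  obtain ⟨BP, hBP, haver⟩ := exists_lintegral_ballAverage_rpow_le hn hCσ hCν hσg hν₁g ha ha' hδ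
    hmass hp
  obtain ⟨Bt, hBt, htail⟩ := exists_measure_lt_tailKernel_le hn hCμ hCν hμg hν'g hp hk.η_pos
  obtain ⟨Ba, hBa, hann⟩ := exists_measure_lt_annulusKernel_le hn hCμ hCν hμg hν'g hp
  obtain ⟨Bl, hBl, hloc⟩ := hk.exists_measure_lt_localKernel_le hn hCσ hCμ hCν hσg hμg hν₁g ha ha'
    hδ hmass hp hpq hT
  set c₄ := ENNReal.ofReal (c * 4 ^ η) with hc₄
  have hc₄t : c₄ ≠ ∞ := ENNReal.ofReal_ne_top
  set c₁ := ENNReal.ofReal c with hc₁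
  have hc₁t : c₁ ≠ ∞ := ENNReal.ofReal_ne_top
  -- The coefficients of the pointwise bound: one each for `g₁`, `g₂`, `G₃`, then `2 c₄` for `G₁`
  -- (near and far exterior points) and `c₁` for `G₂`.
  set L : ℝ≥0∞ := 3 + 2 * c₄ + c₁ with hL
  have hLt : L ≠ ∞ := by finiteness
  -- The added `1` keeps the constant nonzero, so that the claim is trivial when the `L^p` integral
  -- is infinite.
  set B : ℝ≥0∞ := Bσ * Cν ^ (p - 1) + Bσ * BP + Bt + Ba + Bl + 1 with hB
  have hBt' : B ≠ ∞ := by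
    have := ENNReal.rpow_ne_top_of_nonneg (by linarith : 0 ≤ p - 1) hCν
    finiteness
  refine ⟨B * (L + 1) ^ p, ENNReal.mul_ne_top hBt'
    (ENNReal.rpow_ne_top_of_nonneg hp0.le (by finiteness)), fun ε hε f hf s hs hs' => ?_⟩
  set N := ∫⁻ y, ‖f y‖ₑ ^ p ∂ν with hN
  rcases eq_or_ne N ∞ with hfin | hfin
  · rw [hfin, ENNReal.top_div_of_ne_top (ENNReal.rpow_ne_top_of_nonneg hp0.le hs'),
      ENNReal.mul_top (mul_ne_zero (by simp [hB])
        (ENNReal.rpow_pos (by simp) (by finiteness)).ne')]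
    exact le_top
  refine measure_lt_le_of_rescale hp0 hLt (fun t ht ht' => ?_) hs hs'
  have hN' : ∫⁻ y, ‖f y‖ₑ ^ p ∂ν' ≤ N := setLIntegral_le_lintegral _ _
  have hN₁ : ∫⁻ y, ‖f y‖ₑ ^ p ∂ν₁ ≤ N := (setLIntegral_le_lintegral _ _).trans hN'
  set φ := ballAverage σ id (fun y => 2 * δ y) with hφ
  have hφm : Measurable (Function.uncurry φ) :=
    measurable_ballAverage σ measurable_id (show Measurable fun y => 2 * δ y by fun_prop)
  have hφ0 : ∀ y z, 0 ≤ φ y z := ballAverage_nonneg σ id _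
  set g₁ : Eucl d → ℂ := fun y => ((w y).toReal : ℂ) * f y with hg₁
  have hg₁m : Measurable g₁ := by fun_prop
  set g₂ := transfer φ ν₁ f with hg₂
  have hg₂m : Measurable g₂ := measurable_transfer hφm ν₁ hf
  have hFp : ∫⁻ z, (∫⁻ y, ENNReal.ofReal (φ y z) * ‖f y‖ₑ ∂ν₁) ^ p ∂σ ≤ BP * N :=
    (haver _ hf.enorm).trans (mul_le_mul_right hN₁ _)
  have hm₁ : μ {x | t < ‖truncOp k σ ε g₁ x‖ₑ} ≤ Bσ * Cν ^ (p - 1) * (N / t ^ p) := by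
    refine (hweakσ ε hε g₁ hg₁m t ht ht').trans ?_
    rw [mul_assoc, ← mul_div_assoc _ N]
    refine mul_le_mul_right (ENNReal.div_le_div_right ?_ _) _
    refine (lintegral_enorm_density_mul_rpow_le hw hCν hwC hf hp).trans ?_
    rw [← hwν]
    exact mul_le_mul_right (setLIntegral_le_lintegral _ _) _
  have hm₂ : μ {x | t < ‖truncOp k σ ε g₂ x‖ₑ} ≤ Bσ * BP * (N / t ^ p) := by
    refine (hweakσ ε hε g₂ hg₂m t ht ht').trans ?_
    rw [mul_assoc, ← mul_div_assoc _ N]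
    refine mul_le_mul_right (ENNReal.div_le_div_right (le_trans ?_ hFp) _) _
    exact lintegral_mono fun z => ENNReal.rpow_le_rpow (enorm_transfer_le hφ0 ν₁ f z) hp0.le
  set G₁ : Eucl d → ℝ≥0∞ := fun x => ∫⁻ y, tailKernel n η δ x y * ‖f y‖ₑ ∂ν' with hG₁
  set G₂ : Eucl d → ℝ≥0∞ := fun x => ∫⁻ y, annulusKernel n ε x y * ‖f y‖ₑ ∂ν' with hG₂
  set G₃ : Eucl d → ℝ≥0∞ := fun x => ∫⁻ y, localKernel k σ ε δ x y * ‖f y‖ₑ ∂ν₁ with hG₃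
  have hm₃ : μ {x | t < G₁ x} ≤ Bt * (N / t ^ p) := by
    refine (htail δ hδ hδpos _ hf.enorm t ht ht').trans ?_
    rw [mul_div_assoc]
    gcongr
  have hm₄ : μ {x | t < G₂ x} ≤ Ba * (N / t ^ p) := by
    refine (hann ε hε _ hf.enorm t ht ht').trans ?_
    rw [mul_div_assoc]
    gcongr
  have hm₅ : μ {x | t < G₃ x} ≤ Bl * (N / t ^ p) := by
    refine (hloc ε hε _ hf.enorm t ht ht').trans ?_
    rw [mul_div_assoc]
    gcongr
  have hpoint : ∀ x ∈ U, ‖truncOp k ν ε f x‖ₑ ≤ ‖truncOp k σ ε g₁ x‖ₑ + ‖truncOp k σ ε g₂ x‖ₑ +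
      (2 * c₄ * G₁ x + c₁ * G₂ x + G₃ x) := by
    intro x hx
    have hi := hk.integrable_truncKernel_mul hn hε hCν hνg hp hf.aestronglyMeasurable hfin x
    have hs1 := truncOp_add_restrict_compl hi (isClosed_frontier (s := U)).measurableSet
    have hs2 := truncOp_add_restrict_compl (hi.mono_measure Measure.restrict_le_self :
      Integrable (fun y => truncKernel k ε x y * f y) ν') hAm
    rw [hwν, truncOp_withDensity k σ ε hw hCν hwC f x] at hs1
    have herr := hk.truncOp_sub_truncOp_transfer hn hε hCσ hCν hσg hν₁g hp hφm hφ0 hf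
      ((hN₁.trans_lt hfin.lt_top).ne) ((hFp.trans_lt (by finiteness)).ne) x
    have hdist : ∀ᵐ y ∂ν', δ y ≤ dist x y := hext.mono fun y hy =>
      infDist_support_le_dist (by omega) hU hx hy
    have hE₁ : ‖∫ y, transferError k φ σ ε x y * f y ∂ν₁‖ₑ ≤ c₄ * G₁ x + c₁ * G₂ x + G₃ x := by
      calc ‖∫ y, transferError k φ σ ε x y * f y ∂ν₁‖ₑ
          ≤ ∫⁻ y, ‖transferError k φ σ ε x y * f y‖ₑ ∂ν₁ := enorm_integral_le_lintegral_enorm _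
        _ ≤ ∫⁻ y, (c₄ * tailKernel n η δ x y + c₁ * annulusKernel n ε x y +
              localKernel k σ ε δ x y) * ‖f y‖ₑ ∂ν₁ := by
            refine lintegral_mono_ae ?_
            filter_upwards [hmass, ae_restrict_of_ae hdist] with y hy hyd
            rw [enorm_mul]
            gcongr
            exact hk.enorm_transferError_le_kernels hε hCσ hσg ha hδ hy hyd
        _ = c₄ * ∫⁻ y, tailKernel n η δ x y * ‖f y‖ₑ ∂ν₁ +
            c₁ * ∫⁻ y, annulusKernel n ε x y * ‖f y‖ₑ ∂ν₁ + G₃ x :=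
            lintegral_three_kernels (measurable_tailKernel n η hδ).of_uncurry_left
              (measurable_annulusKernel n ε).of_uncurry_left hf.enorm hc₄t hc₁t
        _ ≤ _ := by
            gcongr
            · exact setLIntegral_le_lintegral _ _
            · exact setLIntegral_le_lintegral _ _
    have hE₂ : ‖truncOp k ν₂ ε f x‖ₑ ≤ c₄ * G₁ x := by
      calc ‖truncOp k ν₂ ε f x‖ₑ ≤ ∫⁻ y, ‖truncKernel k ε x y‖ₑ * ‖f y‖ₑ ∂ν₂ :=
            enorm_truncOp_le k ν₂ ε f x
        _ ≤ ∫⁻ y, c₄ * (tailKernel n η δ x y * ‖f y‖ₑ) ∂ν₂ := by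
            refine lintegral_mono_ae ?_
            filter_upwards [ae_restrict_of_ae hdist, ae_restrict_of_ae hδpos,
              ae_restrict_of_ae hext, ae_restrict_mem hAm.compl] with y hy1 hy2 hy3 hy4
            rw [← mul_assoc]
            gcongr
            have h3 := dist_le_three_infDist hd hU hx hy3 (not_le.1 hy4)
            exact hk.enorm_truncKernel_le_tailKernel hε hy2 hy1 (h3.trans (by linarith))
        _ ≤ c₄ * G₁ x := by
            rw [lintegral_const_mul' _ _ hc₄t]
            gcongr
            exact setLIntegral_le_lintegral _ _
    calc ‖truncOp k ν ε f x‖ₑ = ‖truncOp k σ ε g₁ x + truncOp k σ ε g₂ x +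
        (∫ y, transferError k φ σ ε x y * f y ∂ν₁ + truncOp k ν₂ ε f x)‖ₑ := by
          rw [← herr, ← hs1, ← hs2]; congr 1; ring
      _ ≤ ‖truncOp k σ ε g₁ x‖ₑ + ‖truncOp k σ ε g₂ x‖ₑ +
          ((c₄ * G₁ x + c₁ * G₂ x + G₃ x) + c₄ * G₁ x) := by
          refine (enorm_add_le _ _).trans ?_
          gcongr
          · exact enorm_add_le _ _
          · refine (enorm_add_le _ _).trans ?_
            gcongr
      _ = _ := by ring
  have hcover : {x | L * t < ‖truncOp k ν ε f x‖ₑ} ⊆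
      Uᶜ ∪ {x | t < ‖truncOp k σ ε g₁ x‖ₑ} ∪ {x | t < ‖truncOp k σ ε g₂ x‖ₑ} ∪
        {x | t < G₁ x} ∪ {x | t < G₂ x} ∪ {x | t < G₃ x} := by
    intro x hx
    rw [mem_ofPred_eq] at hx
    by_contra hcon
    simp only [mem_union, mem_ofPred_eq, not_or, not_lt, mem_compl_iff, not_not] at hcon
    obtain ⟨⟨⟨⟨⟨h0, h1⟩, h2⟩, h3⟩, h4⟩, h5⟩ := hcon
    refine absurd hx (not_lt.2 ((hpoint x h0).trans ?_))
    calc _ ≤ t + t + (2 * c₄ * t + c₁ * t + t) := by gcongr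
      _ = _ := by rw [hL]; ring
  calc μ {x | L * t < ‖truncOp k ν ε f x‖ₑ}
      ≤ μ Uᶜ + μ {x | t < ‖truncOp k σ ε g₁ x‖ₑ} + μ {x | t < ‖truncOp k σ ε g₂ x‖ₑ} +
        μ {x | t < G₁ x} + μ {x | t < G₂ x} + μ {x | t < G₃ x} := by
        refine (measure_mono hcover).trans ((measure_union_le _ _).trans ?_)
        gcongr
        refine (measure_union_le _ _).trans ?_
        gcongr
        refine (measure_union_le _ _).trans ?_
        gcongr
        refine (measure_union_le _ _).trans ?_
        gcongr
        exact measure_union_le _ _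
    _ ≤ 0 + Bσ * Cν ^ (p - 1) * (N / t ^ p) + Bσ * BP * (N / t ^ p) + Bt * (N / t ^ p) +
        Ba * (N / t ^ p) + Bl * (N / t ^ p) := by
        gcongr
        exact hμU.le
    _ = (Bσ * Cν ^ (p - 1) + Bσ * BP + Bt + Ba + Bl) * (N / t ^ p) := by ring
    _ ≤ B * (N / t ^ p) := by
        gcongr
        exact le_self_add

/-! ### Dimension one, and passage to the stated form -/

theorem HasGrowth.measure_univ_ne_top {μ : Measure (Eucl d)} (h : HasGrowth 0 μ) :
    μ univ ≠ ∞ := by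
  obtain ⟨c, -, hg⟩ := h
  have h1 : (⋃ i : ℕ, ball (0 : Eucl d) i) = univ := iUnion_ball_nat 0
  have hmono : Monotone fun i : ℕ => ball (0 : Eucl d) i :=
    fun i j hij => ball_subset_ball (by exact_mod_cast hij)
  rw [← h1, hmono.measure_iUnion]
  refine ne_top_of_le_ne_top (b := ENNReal.ofReal c) ENNReal.ofReal_ne_top (iSup_le fun i => ?_)
  rcases Nat.eq_zero_or_pos i with rfl | hi
  · simp
  · simpa using hg 0 i (by exact_mod_cast hi)

/-- For kernels of dimension zero and finite measures, the weak type estimate is Hölder's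
inequality. -/
theorem CZBound.exists_weak_bound_of_finite (hk : CZBound 0 c η k) {μ ν : Measure (Eucl d)}
    (hμ : μ univ ≠ ∞) (hν : ν univ ≠ ∞) {p : ℝ} (hp : 1 < p) :
    ∃ B : ℝ≥0∞, B ≠ ∞ ∧ ∀ ε : ℝ, 0 < ε → ∀ f : Eucl d → ℂ, Measurable f →
      ∀ t : ℝ≥0∞, t ≠ 0 → t ≠ ∞ →
        μ {x | t < ‖truncOp k ν ε f x‖ₑ} ≤ B * ((∫⁻ y, ‖f y‖ₑ ^ p ∂ν) / t ^ p) := by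
  obtain ⟨p', hpp⟩ : ∃ p', p.HolderConjugate p' := ⟨_, Real.HolderConjugate.conjExponent hp⟩
  have hp0 := hpp.pos
  set M : ℝ≥0∞ := ENNReal.ofReal c * ν univ ^ (1 / p') with hM
  have hMt : M ≠ ∞ := ENNReal.mul_ne_top ENNReal.ofReal_ne_top
    (ENNReal.rpow_ne_top_of_nonneg hpp.symm.one_div_nonneg hν)
  refine ⟨μ univ * M ^ p, ENNReal.mul_ne_top hμ (ENNReal.rpow_ne_top_of_nonneg hp0.le hMt),
    fun ε hε f hf t ht ht' => ?_⟩
  set N := ∫⁻ y, ‖f y‖ₑ ^ p ∂ν with hN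
  have hbound : ∀ x, ‖truncOp k ν ε f x‖ₑ ≤ M * N ^ (1 / p) := by
    intro x
    have h1 := lintegral_enorm_le_holder hpp hf (σ := ν) univ
    rw [Measure.restrict_univ] at h1
    calc ‖truncOp k ν ε f x‖ₑ ≤ ∫⁻ y, ‖truncKernel k ε x y‖ₑ * ‖f y‖ₑ ∂ν :=
          enorm_truncOp_le k ν ε f x
      _ ≤ ∫⁻ y, ENNReal.ofReal c * ‖f y‖ₑ ∂ν := by
          refine lintegral_mono fun y => ?_
          gcongr
          simpa using hk.enorm_truncKernel_le hε x y
      _ ≤ ENNReal.ofReal c * (N ^ (1 / p) * ν univ ^ (1 / p')) := by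
          rw [lintegral_const_mul' _ _ ENNReal.ofReal_ne_top]
          gcongr
      _ = _ := by rw [hM]; ring
  have htp0 : t ^ p ≠ 0 := (ENNReal.rpow_pos (pos_iff_ne_zero.2 ht) ht').ne'
  have htpt : t ^ p ≠ ∞ := ENNReal.rpow_ne_top_of_nonneg hp0.le ht'
  -- The operator is bounded by `M N^(1/p)` everywhere: above that height the level set is empty,
  -- and below it the total mass of `μ` is already within the bound.
  by_cases hlt : t < M * N ^ (1 / p)
  · have h2 : t ^ p ≤ M ^ p * N := by
      have := ENNReal.rpow_le_rpow hlt.le hp0.le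
      rwa [ENNReal.mul_rpow_of_nonneg _ _ hp0.le, ← ENNReal.rpow_mul,
        one_div_mul_cancel hp0.ne', ENNReal.rpow_one] at this
    calc _ ≤ μ univ := measure_mono (subset_univ _)
      _ = μ univ * 1 := (mul_one _).symm
      _ ≤ μ univ * (M ^ p * N / t ^ p) := by
          gcongr
          rw [ENNReal.le_div_iff_mul_le (Or.inl htp0) (Or.inl htpt), one_mul]
          exact h2
      _ = _ := by rw [mul_assoc, mul_div_assoc]
  · have : {x | t < ‖truncOp k ν ε f x‖ₑ} = ∅ := by
      ext x
      simp only [mem_ofPred_eq, mem_empty_iff_false, iff_false, not_lt]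
      exact (hbound x).trans (not_lt.1 hlt)
    rw [this, measure_empty]
    exact zero_le

theorem CZBound.integrable_of_measure_univ_ne_top (hk : CZBound 0 c η k) {ε : ℝ} (hε : 0 < ε)
    {ν : Measure (Eucl d)} (hν : ν univ ≠ ∞) {p : ℝ} (hp : 1 < p) {f : Eucl d → ℂ}
    (hf : MemLp f (ENNReal.ofReal p) ν) (x : Eucl d) :
    Integrable (fun y => truncKernel k ε x y * f y) ν := by
  have : IsFiniteMeasure ν := ⟨hν.lt_top⟩
  have hfi : Integrable f ν := hf.integrable (by
    rw [← ENNReal.ofReal_one]; exact ENNReal.ofReal_le_ofReal hp.le)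
  have hkm : Measurable fun z => truncKernel k ε x z :=
    (hk.measurable_truncKernel hε).of_uncurry_left
  refine hfi.bdd_mul (c := c) hkm.aestronglyMeasurable (ae_of_all _ fun z => ?_)
  have h := hk.enorm_truncKernel_le hε x z
  rw [pow_zero, inv_one, mul_one, ← ofReal_norm, ENNReal.ofReal_le_ofReal_iff hk.c_pos.le] at h
  exact h

theorem integrableOn_of_integrable_truncKernel {ν : Measure (Eucl d)} {ε : ℝ} {f : Eucl d → ℂ}
    {x : Eucl d} (h : Integrable (fun y => truncKernel k ε x y * f y) ν) :
    IntegrableOn (fun y => k x y * f y) {y | ε < ‖x - y‖} ν := by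
  have hs : MeasurableSet {y : Eucl d | ε < ‖x - y‖} :=
    measurableSet_lt measurable_const (by fun_prop)
  rw [← integrable_indicator_iff hs]
  refine h.congr (ae_of_all _ fun y => ?_)
  by_cases hy : ε < ‖x - y‖ <;> simp [truncKernel, indicator, hy]

theorem lintegral_enorm_rpow_eq_eLpNorm_rpow {ν : Measure (Eucl d)} {p : ℝ} (hp : 0 < p)
    (f : Eucl d → ℂ) : eLpNorm f (ENNReal.ofReal p) ν ^ p = ∫⁻ y, ‖f y‖ₑ ^ p ∂ν := by
  rw [eLpNorm_eq_lintegral_rpow_enorm_toReal (by simpa using hp) ENNReal.ofReal_ne_top,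
    ENNReal.toReal_ofReal hp.le, ← ENNReal.rpow_mul, one_div_mul_cancel hp.ne', ENNReal.rpow_one]

/-- The operator sees `f` only up to `ν`-null sets, so a measurable representative may be used
without changing its value at any point. -/
theorem isWeakBounded_of_exists {μ ν : Measure (Eucl d)} {p : ℝ} (hp : 0 < p)
    (h : ∃ B : ℝ≥0∞, B ≠ ∞ ∧ ∀ ε : ℝ, 0 < ε → ∀ f : Eucl d → ℂ, Measurable f →
      ∀ t : ℝ≥0∞, t ≠ 0 → t ≠ ∞ →
        μ {x | t < ‖truncOp k ν ε f x‖ₑ} ≤ B * ((∫⁻ y, ‖f y‖ₑ ^ p ∂ν) / t ^ p)) :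
    IsWeakBounded k ν μ p := by
  obtain ⟨B, hB, h⟩ := h
  lift B to ℝ≥0 using hB
  refine ⟨B, fun ε hε f hf t ht => ?_⟩
  have hae := hf.1.ae_eq_mk
  have h1 := h ε hε (hf.1.mk f) hf.1.stronglyMeasurable_mk.measurable (ENNReal.ofReal t)
    (by simpa using ht) ENNReal.ofReal_ne_top
  rw [← lintegral_enorm_rpow_eq_eLpNorm_rpow hp, ← eLpNorm_congr_ae hae] at h1
  refine le_trans (le_of_eq ?_) (h1.trans (le_of_eq ?_))
  · congr 1
    ext x
    rw [mem_ofPred_eq, mem_ofPred_eq, ← truncOp_congr_ae hae, ← ofReal_norm,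
      ENNReal.ofReal_lt_ofReal_iff_of_nonneg ht.le]
  · rw [ENNReal.div_eq_inv_mul, ENNReal.div_eq_inv_mul]
    ring

end Main

theorem theorem3p3 (d : ℕ) (hd : 1 ≤ d)
    (U : Set (EuclideanSpace ℝ (Fin d))) (hUopen : IsOpen U) (hUconn : IsConnected U)
    (hΓ : IsADRegularSet (d - 1) (frontier U))
    (μ ν : Measure (EuclideanSpace ℝ (Fin d)))
    (hμ : HasGrowth (d - 1) μ) (hν : HasGrowth (d - 1) ν)
    (hμU : μ Uᶜ = 0) (hνU : ν U = 0)
    (k : EuclideanSpace ℝ (Fin d) → EuclideanSpace ℝ (Fin d) → ℂ)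
    (hk : IsCZKernel (d - 1) k)
    (q : ℝ) (hq : 1 < q)
    (hT : IsStrongBounded k (hausdorffOn (d - 1) (frontier U)) μ q)
    (p : ℝ) (hp : 1 < p) (hpq : p < q) :
    (∀ ε : ℝ, 0 < ε → ∀ f : EuclideanSpace ℝ (Fin d) → ℂ, MemLp f (ENNReal.ofReal p) ν →
      ∀ x, IntegrableOn (fun y => k x y * f y) {y | ε < ‖x - y‖} ν) ∧
    IsWeakBounded k ν μ p := by
  obtain ⟨c, η, hc, hη, -, hsize, hsmooth⟩ := hk
  have hk : CZBound (d - 1) c η k := ⟨hc, hη, hsize, hsmooth⟩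
  have hp0 : 0 < p := by linarith
  -- In dimension one the growth exponent is zero. The arguments based on `n ≥ 1` and on connected
  -- complements of balls then fail, but both measures are finite.
  rcases hd.eq_or_lt with rfl | hd2
  · have hμt := HasGrowth.measure_univ_ne_top hμ
    have hνt := HasGrowth.measure_univ_ne_top hν
    exact ⟨fun ε hε f hf x => integrableOn_of_integrable_truncKernel
      (hk.integrable_of_measure_univ_ne_top hε hνt hp hf x),
      isWeakBounded_of_exists hp0 (hk.exists_weak_bound_of_finite hμt hνt hp)⟩
  · refine ⟨fun ε hε f hf x => integrableOn_of_integrable_truncKernel ?_,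
      isWeakBounded_of_exists hp0 (hk.exists_weak_bound hd2 hUopen hUconn.nonempty hΓ hμ hν hμU
        hνU hp hpq hT)⟩
    obtain ⟨C, -, hC, hg⟩ := hν.exists_ballGrowth
    refine hk.integrable_truncKernel_mul (by omega) hε hC hg hp hf.1 ?_ x
    rw [← lintegral_enorm_rpow_eq_eLpNorm_rpow hp0]
    exact ENNReal.rpow_ne_top_of_nonneg hp0.le hf.2.ne
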